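/- Let $\mathrm{Top}$ be the category of topological spaces with the Quillen model structure (weak equivalences are the weak homotopy equivalences: maps inducing a bijection on $\pi_0$ and isomorphisms on $\pi_n$ for all $n\ge 1$ and all base points), and let $\mathrm{Ch}$ be the category of $\mathbb{Z}$-graded (possibly unbounded) chain complexes of abelian groups with the projective model structure (weak equivalences are the quasi-isomorphisms, fibrations are the degreewise surjective chain maps, cofibrations are the maps with the left lifting property against fibrations that are weak equivalences). Let $C\colon\mathrm{Top}\to\mathrm{Ch}$ be the singular chain complex functor with integer coefficients (zero in negative degrees). A commutative square in $\mathrm{Top}$ given by maps $f\colon W\to U$, $g\colon W\to V$, $p\colon U\to X$, $q\colon V\to X$ with $pf=qg$ is called a homotopy pushout square if the composite $$\bigl(U\sqcup (W\times[0,1])\sqcup V\bigr)/{\sim}\;\longrightarrow\; U\sqcup_W V\;\longrightarrow\; X$$ is a weak equivalence. Here $\sim$ is the equivalence relation generated by $f(w)\sim(w,0)$ and $(w,1)\sim g(w)$ for $w\in W$ (so the source is the double mapping cylinder of $f$ and $g$), $U\sqcup_W V$ is the pushout of $f$ and $g$, the first map is given by $u\mapsto u$, $v\mapsto v$, $(w,t)\mapsto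 f(w)$, and the second map is induced by $p$ and $q$. A commutative square in $\mathrm{Ch}$ given by $f\colon A\to B$, $g\colon A\to B_2$, $p\colon B\to D$, $q\colon B_2\to D$ with $pf=qg$ is called a homotopy pullback square if there are factorizations $B\to B'\to D$ of $p$ and $B_2\to B_2'\to D$ of $q$, each into a trivial cofibration (a cofibration that is a weak equivalence) followed by a fibration, such that the induced map $A\to B'\times_D B_2'$ is a weak equivalence. (Since $\mathrm{Ch}$ is right proper, this does not depend on the choice of factorizations.) Proposition. The functor $C$ sends homotopy pushout squares in $\mathrm{Top}$ to homotopy pullback squares in $\mathrm{Ch}$: if $$\begin{array}{ccc} W & \xrightarrow{\,f\,} & U\\ {\scriptstyle g}\downarrow & & \downarrow{\scriptstyle p}\\ V & \xrightarrow{\,q\,} & X\end{array}$$ is a homotopy pushout square of topological spaces, then $$\begin{array}{ccc} C(W) & \xrightarrow{C(f)} & C(U)\\ {\scriptstyle C(g)}\downarrow & & \downarrow{\scriptstyle C(p)}\\ C(V) & \xrightarrow{C(q)} & C(X)\end{array}$$ is a homotopy pullback square in $\mathrm{Ch}$. -/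

import Mathlib

open CategoryTheory CategoryTheory.Limits HomotopicalAlgebra
open scoped unitInterval Topology

universe u

noncomputable section

/-! ## Weak homotopy equivalences of topological spaces -/

/-- The map `ZerothHomotopy X → ZerothHomotopy Y` (i.e. `π₀ X → π₀ Y`) induced by a continuous
map. -/
def ZerothHomotopy.mapOf {X Y : Type u} [TopologicalSpace X] [TopologicalSpace Y] (f : C(X, Y)) :
    ZerothHomotopy X → ZerothHomotopy Y :=
  Quotient.map f fun _ _ h => h.map f.continuous

/-- The map on `n`-dimensional based loops (maps of pairs from the `n`-cube relative to its
boundary) induced by a continuous map. -/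
def GenLoop.mapOf {X Y : Type u} [TopologicalSpace X] [TopologicalSpace Y] (f : C(X, Y)) (n : ℕ)
    (x : X) (γ : GenLoop (Fin n) X x) : GenLoop (Fin n) Y (f x) :=
  ⟨f.comp γ.1, fun y hy => congrArg f (γ.2 y hy)⟩

/-- The map `π_n(X, x) → π_n(Y, f x)` induced by a continuous map. -/
def HomotopyGroup.mapOf {X Y : Type u} [TopologicalSpace X] [TopologicalSpace Y] (f : C(X, Y))
    (n : ℕ) (x : X) : HomotopyGroup.Pi n X x → HomotopyGroup.Pi n Y (f x) :=
  Quotient.map (GenLoop.mapOf f n x) fun _ _ h => ContinuousMap.HomotopicRel.comp_continuousMap h f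

/-- Weak (homotopy) equivalences of topological spaces, the weak equivalences of the Quillen model
structure: bijective on path components, and on the homotopy groups in all positive degrees at all
base points.  (A bijective homomorphism of groups is an isomorphism.) -/
def IsWeakHomotopyEquiv {X Y : TopCat.{u}} (f : X ⟶ Y) : Prop :=
  Function.Bijective (ZerothHomotopy.mapOf f.hom) ∧
    ∀ (n : ℕ) (x : X), 1 ≤ n → Function.Bijective (HomotopyGroup.mapOf f.hom n x)

/-! ## The double mapping cylinder and homotopy pushout squares -/

section Cylinder

variable {W U V : TopCat.{u}} (f : W ⟶ U) (g : W ⟶ V)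

/-- The generating identifications `f w ∼ (w, 0)` and `(w, 1) ∼ g w` on `U ⊔ (W × [0,1]) ⊔ V`. -/
inductive DoubleMappingCylinder.Rel : U ⊕ (W × I) ⊕ V → U ⊕ (W × I) ⊕ V → Prop
  | left (w : W) : Rel (Sum.inl (f w)) (Sum.inr (Sum.inl (w, 0)))
  | right (w : W) : Rel (Sum.inr (Sum.inl (w, 1))) (Sum.inr (Sum.inr (g w)))

/-- The double mapping cylinder of `f` and `g`, i.e. the topological quotient of
`U ⊔ (W × [0,1]) ⊔ V` by the equivalence relation generated by `DoubleMappingCylinder.Rel`. -/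
def doubleMappingCylinder : TopCat.{u} :=
  TopCat.of (Quot (DoubleMappingCylinder.Rel f g))

/-- The map from `U ⊔ (W × [0,1]) ⊔ V` to the pushout of `f` and `g` given by `u ↦ u`, `v ↦ v`,
`(w, t) ↦ f w`. -/
def DoubleMappingCylinder.preCollapse : U ⊕ (W × I) ⊕ V → (pushout f g : TopCat.{u}) :=
  Sum.elim (pushout.inl f g) (Sum.elim (fun wt => pushout.inl f g (f wt.1)) (pushout.inr f g))

/-- The canonical map from the double mapping cylinder to the pushout. -/
def doubleMappingCylinderCollapse : doubleMappingCylinder f g ⟶ pushout f g :=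
  TopCat.ofHom
    { toFun := Quot.lift (DoubleMappingCylinder.preCollapse f g) (by
        rintro _ _ (w | w)
        · rfl
        · exact ConcreteCategory.congr_hom (pushout.condition (f := f) (g := g)) w)
      continuous_toFun := by
        refine continuous_quot_lift _ ?_
        unfold DoubleMappingCylinder.preCollapse
        fun_prop }

/-- A commutative square of spaces `W ⟶ U ⟶ X`, `W ⟶ V ⟶ X` is a homotopy pushout square if the
composite of the canonical maps from the double mapping cylinder of `f` and `g` to their pushout
and from the pushout to `X` is a weak equivalence. -/
structure IsHomotopyPushout {W U V X : TopCat.{u}} (f : W ⟶ U) (g : W ⟶ V) (p : U ⟶ X)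
    (q : V ⟶ X) : Prop where
  comm : f ≫ p = g ≫ q
  isWeakHomotopyEquiv :
    IsWeakHomotopyEquiv (doubleMappingCylinderCollapse f g ≫ pushout.desc p q comm)

end Cylinder

/-! ## Chain complexes with the projective model structure -/

/-- Chain complexes of abelian groups, indexed by `ℤ` (i.e. possibly unbounded), with differentials
lowering the degree by one. -/
abbrev Ch : Type (u + 1) := ChainComplex AddCommGrpCat.{u} ℤ

namespace Ch

/-- The weak equivalences of the projective model structure: the quasi-isomorphisms. -/
instance : CategoryWithWeakEquivalences Ch.{u} where
  weakEquivalences := HomologicalComplex.quasiIso AddCommGrpCat.{u} (ComplexShape.down ℤ)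

/-- The fibrations of the projective model structure: the degreewise surjective chain maps. -/
instance : CategoryWithFibrations Ch.{u} where
  fibrations := fun _ _ φ => ∀ n : ℤ, Function.Surjective (φ.f n)

/-- The cofibrations of the projective model structure: the chain maps with the left lifting
property against the trivial fibrations. -/
instance : CategoryWithCofibrations Ch.{u} where
  cofibrations := (trivialFibrations Ch.{u}).llp

end Ch

/-! ## Homotopy pullback squares -/

/-- A commutative square `A ⟶ B ⟶ D`, `A ⟶ C ⟶ D` is a homotopy pullback square (in a right proper
model category) if both maps `p : B ⟶ D` and `q : C ⟶ D` admit factorizations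
`B ⟶ B' ⟶ D`, `C ⟶ C' ⟶ D` into a trivial cofibration followed by a fibration for which the
induced map `A ⟶ B' ×_D C'` is a weak equivalence.  By right properness, the choice of the
factorizations does not matter. -/
structure IsHomotopyPullback {M : Type*} [Category M] [HasPullbacks M]
    [CategoryWithWeakEquivalences M] [CategoryWithFibrations M] [CategoryWithCofibrations M]
    {A B C D : M} (f : A ⟶ B) (g : A ⟶ C) (p : B ⟶ D) (q : C ⟶ D) : Prop where
  comm : f ≫ p = g ≫ q
  exists_weakEquivalence :
    ∃ (P : (trivialCofibrations M).MapFactorizationData (fibrations M) p)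
      (Q : (trivialCofibrations M).MapFactorizationData (fibrations M) q),
      WeakEquivalence
        (pullback.lift (f := P.p) (g := Q.p) (f ≫ P.i) (g ≫ Q.i) (by simpa using comm))

/-! ## The singular chain complex functor -/

/-- The inclusion `n ↦ n` of the non-negative degrees, for chain complexes. -/
def embeddingNatIntDown : (ComplexShape.down ℕ).Embedding (ComplexShape.down ℤ) :=
  ComplexShape.Embedding.mk' _ _ (fun n : ℕ => (n : ℤ)) (fun _ _ h => Int.ofNat_inj.mp h) (by
    intro i j
    simp only [ComplexShape.down_Rel]
    omega)

/-- The singular chain complex functor with integral coefficients: the complex `C(X)` is the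
alternating face map complex of the free abelian group on the singular simplices of `X`, extended
by zero to negative degrees. -/
def singularChains : TopCat.{u} ⥤ Ch.{u} :=
  (AlgebraicTopology.singularChainComplexFunctor AddCommGrpCat.{u}).obj
      (AddCommGrpCat.of (ULift.{u} ℤ)) ⋙
    embeddingNatIntDown.extendFunctor AddCommGrpCat.{u}

end

/-! Let M be the double mapping cylinder. It is covered by the open sets S (height below 2/3) and T
(height above 1/3), which deformation retract onto U and V, while S ∩ T deformation retracts onto W.
These retractions commute strictly with f, g, p, q and the canonical map M → X, because that map
forgets the cylinder coordinate.

Mayer-Vietoris gives a short exact sequence of complexes C(S ∩ T) → C(S) ⊕ C(T) → C'(M), where C'(M)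
is generated by the simplices lying in S or in T (`TopCat.elementwiseExact_small`). Barycentric
subdivision shows that C'(M) → C(M) is a quasi-isomorphism (`TopCat.quasiIso_smallι`), and C(M) →
C(X) is one because M → X is a weak equivalence. The given square of chains is therefore
quasi-isomorphic, vertex by vertex, to a square whose sequence is short exact. In `Ch` this makes it
a homotopy pullback: a pullback along a degreewise surjection also has a short exact sequence, and
the five lemma compares the two (`Ch.isHomotopyPullback_of_shortExact`).

That weak equivalences induce quasi-isomorphisms (`IsWeakHomotopyEquiv.quasiIso_natSingularChains`)
is proved without CW approximation. A map factors as a homotopy equivalence followed by its path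
fibration. If the map is a weak equivalence, the path fibration lifts balls relative to spheres
(`IsWeakHomotopyEquiv.hasLifts`). Its singular simplicial map is then a trivial fibration, hence a
simplicial homotopy equivalence. -/

noncomputable section

attribute [-instance] CategoryTheory.catToReflQuiver
set_option linter.unusedSectionVars false

/-! ### The five lemma in homology. -/

namespace HomologicalComplex.HomologySequence

variable {C : Type*} [Category C] [Abelian C] {ι : Type*} {c : ComplexShape ι}
  {S₁ S₂ : ShortComplex (HomologicalComplex C c)}

/-- The five lemma for the first map of a morphism of short exact sequences of complexes. -/
lemma quasiIso_τ₁ (φ : S₁ ⟶ S₂) (hS₁ : S₁.ShortExact) (hS₂ : S₂.ShortExact)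
    (hc : ∀ j, ∃ i, c.Rel i j) (h₂ : QuasiIso φ.τ₂) (h₃ : QuasiIso φ.τ₃) : QuasiIso φ.τ₁ := by
  rw [quasiIso_iff]
  intro j
  rw [quasiIsoAt_iff_isIso_homologyMap]
  obtain ⟨i, hij⟩ := hc j
  -- The five terms are H_i(X₂), H_i(X₃), H_j(X₁), H_j(X₂), H_j(X₃); `δ₀` discards the leading
  -- H_i(X₁).
  exact Abelian.isIso_of_epi_of_isIso_of_isIso_of_mono
    (composableArrows₅_exact hS₁ i j hij).δ₀ (composableArrows₅_exact hS₂ i j hij).δ₀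
    (ComposableArrows.δ₀Functor.map (mapComposableArrows₅ φ hS₁ hS₂ i j hij))
    (inferInstanceAs (Epi (homologyMap φ.τ₂ i)))
    (inferInstanceAs (IsIso (homologyMap φ.τ₃ i)))
    (inferInstanceAs (IsIso (homologyMap φ.τ₂ j)))
    (inferInstanceAs (Mono (homologyMap φ.τ₃ j)))

end HomologicalComplex.HomologySequence

/-! ### Factorizations by free disks, and a criterion for homotopy pullbacks in `Ch`. -/

namespace Ch

/-- The free abelian group on the elements of `D` of degree `n`. -/
abbrev freeX (D : Ch.{u}) (n : ℤ) : AddCommGrpCat.{u} := AddCommGrpCat.free.obj (D.X n)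

/-- The direct sum of the disk complexes indexed by the homogeneous elements of `D`. -/
def freeDisks (D : Ch.{u}) : Ch.{u} :=
  ChainComplex.of (fun n => freeX D n ⊞ freeX D (n + 1)) (fun _ => biprod.fst ≫ biprod.inr)
    (by simp)

/-- The inclusion of the generators of degree `n` whose boundary is not imposed to vanish. -/
def freeDisksι (D : Ch.{u}) (n : ℤ) : freeX D n ⟶ (freeDisks D).X n :=
  (biprod.inl : _ ⟶ freeX D n ⊞ freeX D (n + 1))

/-- The second summand in degree `n` consists of the boundaries of the generators of degree `n + 1`.
Hence maps out of `freeDisks D` can be built and compared on generators alone. -/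
lemma freeDisksι_d (D : Ch.{u}) (n : ℤ) :
    freeDisksι D (n + 1) ≫ (freeDisks D).d (n + 1) n =
      (biprod.inr : _ ⟶ freeX D n ⊞ freeX D (n + 1)) := by
  have e : (freeDisks D).d (n + 1) n = (biprod.fst ≫ biprod.inr :
      freeX D (n + 1) ⊞ freeX D (n + 1 + 1) ⟶ freeX D n ⊞ freeX D (n + 1)) :=
    ChainComplex.of_d (fun n => freeX D n ⊞ freeX D (n + 1)) (fun _ => biprod.fst ≫ biprod.inr) n
  rw [e]
  exact biprod.inl_fst_assoc _

lemma freeDisks_X_hom_ext {D : Ch.{u}} {n : ℤ} {A : AddCommGrpCat.{u}}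
    {a b : (freeDisks D).X n ⟶ A} (h₁ : freeDisksι D n ≫ a = freeDisksι D n ≫ b)
    (h₂ : freeDisksι D (n + 1) ≫ (freeDisks D).d (n + 1) n ≫ a =
      freeDisksι D (n + 1) ≫ (freeDisks D).d (n + 1) n ≫ b) : a = b := by
  rw [← Category.assoc, ← Category.assoc, freeDisksι_d] at h₂
  exact biprod.hom_ext' _ _ h₁ h₂

/-- Morphisms out of a term of `freeDisks D`. -/
def freeDisksXDesc {D : Ch.{u}} {n : ℤ} {A : AddCommGrpCat.{u}} (a : freeX D n ⟶ A)
    (b : freeX D (n + 1) ⟶ A) : (freeDisks D).X n ⟶ A :=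
  (biprod.desc a b : freeX D n ⊞ freeX D (n + 1) ⟶ A)

@[simp]
lemma freeDisksι_XDesc {D : Ch.{u}} {n : ℤ} {A : AddCommGrpCat.{u}} (a : freeX D n ⟶ A)
    (b : freeX D (n + 1) ⟶ A) : freeDisksι D n ≫ freeDisksXDesc a b = a :=
  biprod.inl_desc _ _

@[simp]
lemma freeDisksι_XDesc_assoc {D : Ch.{u}} {n : ℤ} {A B : AddCommGrpCat.{u}} (a : freeX D n ⟶ A)
    (b : freeX D (n + 1) ⟶ A) (k : A ⟶ B) :
    freeDisksι D n ≫ freeDisksXDesc a b ≫ k = a ≫ k := by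
  rw [← Category.assoc, freeDisksι_XDesc]

@[simp]
lemma freeDisksι_d_XDesc {D : Ch.{u}} {n : ℤ} {A : AddCommGrpCat.{u}} (a : freeX D n ⟶ A)
    (b : freeX D (n + 1) ⟶ A) :
    freeDisksι D (n + 1) ≫ (freeDisks D).d (n + 1) n ≫ freeDisksXDesc a b = b := by
  rw [← Category.assoc, freeDisksι_d]
  exact biprod.inr_desc _ _

@[simp]
lemma freeDisksι_d_XDesc_assoc {D : Ch.{u}} {n : ℤ} {A B : AddCommGrpCat.{u}} (a : freeX D n ⟶ A)
    (b : freeX D (n + 1) ⟶ A) (k : A ⟶ B) :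
    freeDisksι D (n + 1) ≫ (freeDisks D).d (n + 1) n ≫ freeDisksXDesc a b ≫ k = b ≫ k := by
  rw [← freeDisksι_d_XDesc a b, Category.assoc, Category.assoc, freeDisksι_d_XDesc]

lemma freeDisks_hom_ext {D K : Ch.{u}} {φ ψ : freeDisks D ⟶ K}
    (h : ∀ n, freeDisksι D n ≫ φ.f n = freeDisksι D n ≫ ψ.f n) : φ = ψ := by
  ext1 n
  refine freeDisks_X_hom_ext (h n) ?_
  rw [← φ.comm, ← ψ.comm, reassoc_of% h (n + 1)]

/-- The sum of disk complexes is contractible. -/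
def freeDisksContraction (D : Ch.{u}) : Homotopy (𝟙 (freeDisks D)) 0 :=
  (Homotopy.ofEq (by
    refine freeDisks_hom_ext fun n => ?_
    obtain ⟨m, rfl⟩ : ∃ m, n = m + 1 := ⟨n - 1, by simp⟩
    rw [Homotopy.nullHomotopicMap'_f (c := ComplexShape.down ℤ) (k₂ := m + 1 + 1) (k₁ := m + 1)
      (k₀ := m) rfl rfl]
    simp)).trans
  (Homotopy.nullHomotopy' (C := freeDisks D) (D := freeDisks D) (c := ComplexShape.down ℤ)
    -- The contraction kills every generator and sends the boundary of a generator back to that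
    -- generator.
    fun i j hij => freeDisksXDesc 0 (freeDisksι D (i + 1)) ≫
      eqToHom (by obtain rfl : i + 1 = j := hij; rfl))

/-- The morphism out of a sum of disk complexes determined by the images of the generators. -/
def freeDisksDesc {D K : Ch.{u}} (h : ∀ n, freeX D n ⟶ K.X n) : freeDisks D ⟶ K :=
  ChainComplex.ofHom (fun n => freeDisksXDesc (h n) (h (n + 1) ≫ K.d (n + 1) n))
    (fun n => by
      refine freeDisks_X_hom_ext ?_ ?_ <;> simp)

@[simp]
lemma freeDisksι_desc_f {D K : Ch.{u}} (h : ∀ n, freeX D n ⟶ K.X n) (n : ℤ) :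
    freeDisksι D n ≫ (freeDisksDesc h).f n = h n :=
  freeDisksι_XDesc _ _

@[simp]
lemma freeDisksι_desc_f_assoc {D K : Ch.{u}} (h : ∀ n, freeX D n ⟶ K.X n) (n : ℤ)
    {A : AddCommGrpCat.{u}} (k : K.X n ⟶ A) :
    freeDisksι D n ≫ (freeDisksDesc h).f n ≫ k = h n ≫ k := by
  rw [← Category.assoc, freeDisksι_desc_f]

/-- A surjection of abelian groups lifts any morphism out of a free abelian group. -/
lemma exists_lift_of_free {S : Type u} {A B : AddCommGrpCat.{u}} (e : A ⟶ B)
    (he : Function.Surjective e) (b : AddCommGrpCat.free.obj S ⟶ B) :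
    ∃ a : AddCommGrpCat.free.obj S ⟶ A, a ≫ e = b := by
  choose s hs using he
  refine ⟨(AddCommGrpCat.adj.homEquiv _ _).symm
    (↾ fun x => s (AddCommGrpCat.adj.homEquiv _ _ b x)), ?_⟩
  apply (AddCommGrpCat.adj.homEquiv _ _).injective
  rw [Adjunction.homEquiv_naturality_right, Equiv.apply_symm_apply]
  ext x
  exact hs _

/-- The canonical surjection from a sum of disks. -/
def freeDisksπ (D : Ch.{u}) : freeDisks D ⟶ D :=
  freeDisksDesc fun n => (AddCommGrpCat.adj.counit.app (D.X n))

lemma freeDisksπ_f_surjective (D : Ch.{u}) (n : ℤ) :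
    Function.Surjective ((freeDisksπ D).f n) := by
  intro x
  have h₁ : freeDisksι D n ≫ (freeDisksπ D).f n = AddCommGrpCat.adj.counit.app (D.X n) :=
    freeDisksι_desc_f _ _
  have h₂ := ConcreteCategory.congr_hom
    (AddCommGrpCat.adj.right_triangle_components (D.X n)) x
  rw [← h₁] at h₂
  exact ⟨_, h₂⟩

/-- The generators satisfy no relations, so their images can be lifted independently of one another;
the boundaries follow. -/
lemma exists_lift_of_freeDisks {D E Y : Ch.{u}} (e : E ⟶ Y)
    (he : ∀ n, Function.Surjective (e.f n)) (y : freeDisks D ⟶ Y) :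
    ∃ x : freeDisks D ⟶ E, x ≫ e = y := by
  choose a ha using fun n => exists_lift_of_free (e.f n) (he n) (freeDisksι D n ≫ y.f n)
  refine ⟨freeDisksDesc a, freeDisks_hom_ext fun n => ?_⟩
  simp [ha]

/-- A lift is prescribed on `B` and exists on the disks by projectivity. Contractibility of the
disks makes `biprod.fst` a homotopy inverse. -/
lemma trivialCofibrations_inl (B D : Ch.{u}) :
    trivialCofibrations Ch.{u} (biprod.inl : B ⟶ B ⊞ freeDisks D) := by
  refine ⟨fun E Y e he => ⟨fun {t b} sq => ?_⟩, ?_⟩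
  · obtain ⟨x, hx⟩ := exists_lift_of_freeDisks e he.1 (biprod.inr ≫ b)
    exact ⟨⟨⟨biprod.desc t x, by simp, biprod.hom_ext' _ _ (by simp [sq.w]) (by simp [hx])⟩⟩⟩
  · let H : HomotopyEquiv B (B ⊞ freeDisks D) :=
      { hom := biprod.inl
        inv := biprod.fst
        homotopyHomInvId := Homotopy.ofEq (by simp)
        homotopyInvHomId := Homotopy.symm <| (Homotopy.ofEq (by simp [biprod.total])).trans
          (((Homotopy.refl (biprod.fst ≫ biprod.inl)).add
            (((freeDisksContraction D).compLeft biprod.snd).compRight biprod.inr)).trans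
              (Homotopy.ofEq (by simp))) }
    exact H.quasiIso_hom

/-- Every morphism of complexes is a trivial cofibration followed by a fibration. -/
lemma nonempty_mapFactorizationData {B D : Ch.{u}} (p : B ⟶ D) :
    Nonempty ((trivialCofibrations Ch.{u}).MapFactorizationData (fibrations Ch.{u}) p) :=
  ⟨{  Z := B ⊞ freeDisks D
      i := biprod.inl
      p := biprod.desc p (freeDisksπ D)
      fac := by simp
      hi := trivialCofibrations_inl B D
      hp := fun n x => by
        obtain ⟨y, rfl⟩ := freeDisksπ_f_surjective D n x
        refine ⟨(biprod.inr : _ ⟶ B ⊞ freeDisks D).f n y, ?_⟩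
        rw [← ConcreteCategory.comp_apply, ← HomologicalComplex.comp_f, biprod.inr_desc] }⟩

lemma _root_.CategoryTheory.Functor.isIso_map_biprod_map {C D : Type*} [Category C] [Category D]
    [Preadditive C] [Preadditive D] [HasBinaryBiproducts C] (F : C ⥤ D) [F.Additive]
    {X Y X' Y' : C} (b : X ⟶ X') (c : Y ⟶ Y') [IsIso (F.map b)] [IsIso (F.map c)] :
    IsIso (F.map (biprod.map b c)) := by
  refine ⟨F.map biprod.fst ≫ inv (F.map b) ≫ F.map biprod.inl +
    F.map biprod.snd ≫ inv (F.map c) ≫ F.map biprod.inr, ?_, ?_⟩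
  · rw [Preadditive.comp_add, ← F.map_comp_assoc, ← F.map_comp_assoc, biprod.map_fst,
      biprod.map_snd]
    simp only [F.map_comp, Category.assoc, IsIso.hom_inv_id_assoc]
    rw [← F.map_comp, ← F.map_comp, ← F.map_add, biprod.total, F.map_id]
  · rw [Preadditive.add_comp, Category.assoc, Category.assoc, Category.assoc, Category.assoc,
      ← F.map_comp, ← F.map_comp, biprod.inl_map, biprod.inr_map]
    simp only [F.map_comp, IsIso.inv_hom_id_assoc]
    rw [← F.map_comp, ← F.map_comp, ← F.map_add, biprod.total, F.map_id]

lemma quasiIso_biprod_map {B C B' C' : Ch.{u}} (b : B ⟶ B') (c : C ⟶ C') [QuasiIso b]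
    [QuasiIso c] : QuasiIso (biprod.map b c) := by
  rw [quasiIso_iff]
  intro n
  rw [quasiIsoAt_iff_isIso_homologyMap]
  let F := HomologicalComplex.homologyFunctor AddCommGrpCat.{u} (ComplexShape.down ℤ) n
  have hb : IsIso (F.map b) := inferInstanceAs (IsIso (HomologicalComplex.homologyMap b n))
  have hc : IsIso (F.map c) := inferInstanceAs (IsIso (HomologicalComplex.homologyMap c n))
  exact F.isIso_map_biprod_map b c

lemma epi_of_fibrations {B D : Ch.{u}} {p : B ⟶ D} (hp : fibrations Ch.{u} p) : Epi p := by
  have (n : ℤ) : Epi (p.f n) := by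
    rw [AddCommGrpCat.epi_iff_surjective]
    exact hp n
  exact HomologicalComplex.epi_of_epi_f _ this

/-- A square weakly equivalent to one whose associated Mayer-Vietoris sequence is short exact is a
homotopy pullback square. -/
lemma isHomotopyPullback_of_shortExact {A B C D A' B' C' D' : Ch.{u}}
    {f : A ⟶ B} {g : A ⟶ C} {p : B ⟶ D} {q : C ⟶ D} (comm : f ≫ p = g ≫ q)
    {f' : A' ⟶ B'} {g' : A' ⟶ C'} {p' : B' ⟶ D'} {q' : C' ⟶ D'} (sq : CommSq f' g' p' q')
    (h : sq.shortComplex'.ShortExact) (a : A' ⟶ A) (b : B' ⟶ B) (c : C' ⟶ C) (d : D' ⟶ D)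
    (hf : f' ≫ b = a ≫ f) (hg : g' ≫ c = a ≫ g) (hp : p' ≫ d = b ≫ p) (hq : q' ≫ d = c ≫ q)
    (ha : QuasiIso a) (hb : QuasiIso b) (hc : QuasiIso c) (hd : QuasiIso d) :
    IsHomotopyPullback f g p q := by
  refine ⟨comm, ?_⟩
  obtain ⟨P⟩ := nonempty_mapFactorizationData p
  obtain ⟨Q⟩ := nonempty_mapFactorizationData q
  refine ⟨P, Q, ?_⟩
  have hP' := epi_of_fibrations P.hp
  have sq' := IsPullback.of_hasPullback P.p Q.p
  let l : A ⟶ pullback P.p Q.p := pullback.lift (f ≫ P.i) (g ≫ Q.i) (by simpa using comm)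
  -- A pullback square is always left exact; exactness on the right holds because the fibration
  -- `P.p` alone is already epi.
  have hS : sq'.shortComplex'.ShortExact :=
    { exact := sq'.exact_shortComplex'
      mono_f := sq'.mono_shortComplex'_f
      epi_g := @epi_of_epi_fac _ _ _ _ _ biprod.inl _ P.p hP' (biprod.inl_desc P.p (-Q.p)) }
  let φ : sq.shortComplex' ⟶ sq'.shortComplex' :=
    { τ₁ := a ≫ l
      τ₂ := biprod.map (b ≫ P.i) (c ≫ Q.i)
      τ₃ := d
      comm₁₂ := by
        change (a ≫ l) ≫ biprod.lift (pullback.fst P.p Q.p) (pullback.snd P.p Q.p) =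
          biprod.lift f' g' ≫ biprod.map (b ≫ P.i) (c ≫ Q.i)
        apply biprod.hom_ext <;> simp [l, reassoc_of% hf, reassoc_of% hg, pullback.lift_fst,
          pullback.lift_snd]
      comm₂₃ := by
        change biprod.map (b ≫ P.i) (c ≫ Q.i) ≫ biprod.desc P.p (-Q.p) = biprod.desc p' (-q') ≫ d
        apply biprod.hom_ext' <;> simp [hp, hq] }
  have hP : QuasiIso P.i := P.hi.2
  have hQ : QuasiIso Q.i := Q.hi.2
  -- The five lemma applies to `a ≫ l`; two out of three then isolates the comparison map `l`.
  have hφ : QuasiIso φ.τ₁ := HomologicalComplex.HomologySequence.quasiIso_τ₁ φ h hS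
    (fun j => ⟨j + 1, rfl⟩) (quasiIso_biprod_map _ _) hd
  rw [weakEquivalence_iff]
  have hl : QuasiIso (a ≫ l) := hφ
  exact quasiIso_of_comp_left a l

end Ch

/-! ## Extension and lifting of homotopies over balls -/

/-- Two continuous maps on closed subsets covering a space, which agree on the intersection, glue to
a continuous map. -/
lemma exists_continuousMap_glue {A Z : Type*} [TopologicalSpace A] [TopologicalSpace Z]
    {C₁ C₂ : Set A} (h₁ : IsClosed C₁) (h₂ : IsClosed C₂) (h : ∀ a, a ∈ C₁ ∨ a ∈ C₂)
    (g₁ : C(C₁, Z)) (g₂ : C(C₂, Z)) (hg : ∀ a (ha₁ : a ∈ C₁) (ha₂ : a ∈ C₂),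
      g₁ ⟨a, ha₁⟩ = g₂ ⟨a, ha₂⟩) :
    ∃ G : C(A, Z), (∀ a (ha : a ∈ C₁), G a = g₁ ⟨a, ha⟩) ∧
      ∀ a (ha : a ∈ C₂), G a = g₂ ⟨a, ha⟩ := by
  classical
  let G : A → Z := fun a => if ha : a ∈ C₁ then g₁ ⟨a, ha⟩ else g₂ ⟨a, (h a).resolve_left ha⟩
  have hG₁ (a) (ha : a ∈ C₁) : G a = g₁ ⟨a, ha⟩ := dif_pos ha
  have hG₂ (a) (ha : a ∈ C₂) : G a = g₂ ⟨a, ha⟩ := by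
    by_cases h' : a ∈ C₁
    · rw [hG₁ a h', hg]
    · exact dif_neg h'
  refine ⟨⟨G, ?_⟩, hG₁, hG₂⟩
  have c₁ : ContinuousOn G C₁ := by
    rw [continuousOn_iff_continuous_domRestrict]
    exact g₁.continuous.congr fun a => (hG₁ a a.2).symm
  have c₂ : ContinuousOn G C₂ := by
    rw [continuousOn_iff_continuous_domRestrict]
    exact g₂.continuous.congr fun a => (hG₂ a a.2).symm
  rw [← continuousOn_univ, ← Set.eq_univ_of_forall h]
  exact c₁.union_of_isClosed c₂ h₁ h₂

namespace BallLifting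

variable {V : Type*} [NormedAddCommGroup V] [NormedSpace ℝ V]

variable (V) in
/-- The closed unit ball. -/
abbrev Ball : Type _ := Metric.closedBall (0 : V) 1

variable (V) in
/-- The unit sphere. -/
abbrev Sph : Type _ := Metric.sphere (0 : V) 1

/-- The inclusion of the unit sphere in the closed unit ball. -/
def incl : C(Sph V, Ball V) := ⟨fun s => ⟨s, Metric.sphere_subset_closedBall s.2⟩, by fun_prop⟩

@[simp] lemma coe_incl (s : Sph V) : (incl s : V) = s := rfl

lemma norm_le_one (b : Ball V) : ‖(b : V)‖ ≤ 1 := mem_closedBall_zero_iff.1 b.2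

lemma norm_eq_one (s : Sph V) : ‖(s : V)‖ = 1 := mem_sphere_zero_iff_norm.1 s.2

/-- The radial retraction of a normed space onto its closed unit ball. -/
def radial : C(V, Ball V) where
  toFun v := ⟨(max 1 ‖v‖)⁻¹ • v, by
    have : 0 < max 1 ‖v‖ := lt_max_of_lt_left one_pos
    rw [mem_closedBall_zero_iff, norm_smul, norm_inv, Real.norm_of_nonneg this.le,
      inv_mul_le_iff₀ this, mul_one]
    exact le_max_right _ _⟩
  continuous_toFun := by
    refine Continuous.subtype_mk (Continuous.smul (Continuous.inv₀ (by fun_prop) fun v => ?_)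
      continuous_id) _
    exact (lt_max_of_lt_left one_pos).ne'

@[simp] lemma radial_coe (b : Ball V) : radial (b : V) = b := by
  apply Subtype.ext
  change (max 1 ‖(b : V)‖)⁻¹ • (b : V) = b
  rw [max_eq_left (norm_le_one b), inv_one, one_smul]

/-- The scaling factor of the radial retraction of the cylinder on a ball onto the union of its
bottom and its sides. -/
def scale (z : Ball V × I) : ℝ := max (1 - (z.2 : ℝ) / 2) ‖(z.1 : V)‖

lemma half_le_scale (z : Ball V × I) : 1 / 2 ≤ scale z :=
  le_max_of_le_left (by linarith [z.2.2.2])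

lemma scale_pos (z : Ball V × I) : 0 < scale z := lt_of_lt_of_le (by norm_num) (half_le_scale z)

lemma scale_le_one (z : Ball V × I) : scale z ≤ 1 :=
  max_le (by linarith [z.2.2.1]) (norm_le_one _)

lemma continuous_scale : Continuous (scale : Ball V × I → ℝ) := by
  unfold scale; fun_prop

/-- The radial retraction of the cylinder on a ball onto the union of its bottom and its sides. -/
def retract : C(Ball V × I, Ball V × I) where
  -- This is the projection from the point (0, 2) above the cylinder: the displacement (b, t - 2) is
  -- divided by `scale z`.
  toFun z := (⟨(scale z)⁻¹ • (z.1 : V), by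
      rw [mem_closedBall_zero_iff, norm_smul, norm_inv, Real.norm_of_nonneg (scale_pos z).le,
        inv_mul_le_iff₀ (scale_pos z), mul_one]
      exact le_max_right _ _⟩,
    ⟨2 - (2 - z.2) / scale z, by
      have h1 : (2 - (z.2 : ℝ)) / scale z ≤ 2 := by
        rw [div_le_iff₀ (scale_pos z)]
        linarith [le_max_left (1 - (z.2 : ℝ) / 2) ‖(z.1 : V)‖,
          show scale z = max (1 - (z.2 : ℝ) / 2) ‖(z.1 : V)‖ from rfl]
      have h2 : 1 ≤ (2 - (z.2 : ℝ)) / scale z := by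
        rw [le_div_iff₀ (scale_pos z)]
        linarith [scale_le_one z, z.2.2.2]
      constructor <;> linarith⟩)
  continuous_toFun := by
    have h : Continuous fun z : Ball V × I => (scale z)⁻¹ :=
      continuous_scale.inv₀ fun z => (scale_pos z).ne'
    simp only [div_eq_mul_inv]
    fun_prop

lemma retract_zero (b : Ball V) : retract (b, 0) = (b, 0) := by
  have : scale (b, (0 : I)) = 1 := by simp [scale, norm_le_one b]
  ext <;> simp [retract, this]

lemma retract_incl (s : Sph V) (t : I) : retract (incl s, t) = (incl s, t) := by
  have : scale (incl s, t) = 1 := by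
    have := t.2.1
    simp only [scale, coe_incl, norm_eq_one]
    exact max_eq_right (by linarith)
  ext <;> simp [retract, this]

/-- Extension of homotopies from the sphere to the ball, with control on the extension. -/
lemma exists_extension {Z : Type*} [TopologicalSpace Z] (g : C(Ball V, Z)) (h : C(Sph V × I, Z))
    (hgh : ∀ s, h (s, 0) = g (incl s)) :
    ∃ G : C(Ball V × I, Z), ∀ z, (∃ b, retract z = (b, 0) ∧ G z = g b) ∨
      ∃ s t, retract z = (incl s, t) ∧ G z = h (s, t) := by
  -- `C₁` is the part projected to the bottom and `C₂` the part projected to the sides, according to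
  -- which term of the maximum in `scale` dominates.
  let C₁ : Set (Ball V × I) := {z | ‖(z.1 : V)‖ ≤ 1 - (z.2 : ℝ) / 2}
  let C₂ : Set (Ball V × I) := {z | 1 - (z.2 : ℝ) / 2 ≤ ‖(z.1 : V)‖}
  have hC₁ : IsClosed C₁ := isClosed_le (by fun_prop) (by fun_prop)
  have hC₂ : IsClosed C₂ := isClosed_le (by fun_prop) (by fun_prop)
  have r₁ (z) (hz : z ∈ C₁) : retract z = ((retract z).1, 0) := by
    have : scale z = 1 - (z.2 : ℝ) / 2 := max_eq_left hz
    have h0 := scale_pos z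
    refine Prod.ext rfl (Subtype.ext ?_)
    change 2 - (2 - (z.2 : ℝ)) / scale z = 0
    field_simp
    linarith
  have r₂ (z) (hz : z ∈ C₂) : ((retract z).1 : V) ∈ Metric.sphere (0 : V) 1 := by
    have : scale z = ‖(z.1 : V)‖ := max_eq_right hz
    have h0 := scale_pos z
    rw [mem_sphere_zero_iff_norm]
    change ‖(scale z)⁻¹ • (z.1 : V)‖ = 1
    rw [norm_smul, norm_inv, Real.norm_of_nonneg h0.le, ← this, inv_mul_cancel₀ h0.ne']
  let q : C(C₂, Sph V) := ⟨fun z => ⟨_, r₂ z z.2⟩, Continuous.subtype_mk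
    (continuous_subtype_val.comp (continuous_fst.comp
      (retract.continuous.comp continuous_subtype_val))) _⟩
  have hq (z : C₂) : incl (q z) = (retract z.1).1 := rfl
  obtain ⟨G, hG₁, hG₂⟩ := exists_continuousMap_glue hC₁ hC₂
    (fun z => le_total ‖(z.1 : V)‖ (1 - (z.2 : ℝ) / 2))
    (g.comp ⟨fun z => (retract z.1).1,
      continuous_fst.comp (retract.continuous.comp continuous_subtype_val)⟩)
    (h.comp ⟨fun z => (q z, (retract z.1).2), q.continuous.prodMk
      (continuous_snd.comp (retract.continuous.comp continuous_subtype_val))⟩)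
    (fun a h₁ h₂ => by
      have e : (retract a).2 = 0 := congrArg Prod.snd (r₁ a h₁)
      change g (retract a).1 = h (q ⟨a, h₂⟩, (retract a).2)
      rw [e, hgh, hq])
  refine ⟨G, fun z => ?_⟩
  rcases le_total ‖(z.1 : V)‖ (1 - (z.2 : ℝ) / 2) with hz | hz
  · exact Or.inl ⟨_, r₁ z hz, hG₁ z hz⟩
  · exact Or.inr ⟨q ⟨z, hz⟩, (retract z).2, rfl, hG₂ z hz⟩

/-- The homotopy extension property of the sphere in the ball. -/
lemma exists_homotopy_extension {Z : Type*} [TopologicalSpace Z] (g : C(Ball V, Z))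
    (h : C(Sph V × I, Z)) (hgh : ∀ s, h (s, 0) = g (incl s)) :
    ∃ G : C(Ball V × I, Z), (∀ b, G (b, 0) = g b) ∧ ∀ s t, G (incl s, t) = h (s, t) := by
  obtain ⟨G, hG⟩ := exists_extension g h hgh
  refine ⟨G, fun b => ?_, fun s t => ?_⟩
  · obtain ⟨b', h1, h2⟩ | ⟨s, t, h1, h2⟩ := hG (b, 0)
    · rw [retract_zero, Prod.mk_inj] at h1
      rw [h2, h1.1]
    · rw [retract_zero, Prod.mk_inj] at h1
      rw [h2, h1.1, ← h1.2, hgh]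
  · obtain ⟨b', h1, h2⟩ | ⟨s', t', h1, h2⟩ := hG (incl s, t)
    · rw [retract_incl, Prod.mk_inj] at h1
      rw [h2, h1.2, hgh, ← h1.1]
    · rw [retract_incl, Prod.mk_inj] at h1
      have hs : s = s' := Subtype.ext (congrArg (fun b : Ball V => (b : V)) h1.1)
      rw [h2, hs, h1.2]

/-- The point at distance `min τ ‖v‖` from the origin on the segment from `0` to `v`. -/
def clip (v : V) (τ : ℝ) : V := (max τ 0 / max (max τ 0) ‖v‖) • v

/-- The denominator can vanish only at `v = 0`, where the bound of the norm of `clip v τ` by that of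
`v` gives continuity. -/
lemma continuous_clip : Continuous fun z : V × ℝ => clip z.1 z.2 := by
  rw [continuous_iff_continuousAt]
  rintro ⟨v, τ⟩
  by_cases h : v = 0
  · subst h
    have h0 : clip (0 : V) τ = 0 := smul_zero _
    rw [ContinuousAt, h0]
    refine squeeze_zero_norm (a := fun z : V × ℝ => ‖z.1‖) (fun z => ?_) ?_
    · rw [clip, norm_smul]
      refine mul_le_of_le_one_left (norm_nonneg _) ?_
      rw [Real.norm_of_nonneg (by positivity)]
      exact div_le_one_of_le₀ (le_max_left _ _) (by positivity)
    · have : ContinuousAt (fun z : V × ℝ => ‖z.1‖) (0, τ) := by fun_prop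
      simpa [ContinuousAt] using this
  · have h1 : max (max τ 0) ‖v‖ ≠ 0 := (lt_max_of_lt_right (norm_pos_iff.2 h)).ne'
    unfold clip
    refine ContinuousAt.smul (ContinuousAt.div (by fun_prop) (by fun_prop) h1) (by fun_prop)

lemma clip_zero (v : V) : clip v 0 = 0 := by simp [clip]

lemma clip_of_norm_le {v : V} {τ : ℝ} (h : ‖v‖ ≤ τ) : clip v τ = v := by
  have h0 : 0 ≤ τ := (norm_nonneg v).trans h
  rw [clip, max_eq_left h0, max_eq_left h]
  rcases h0.eq_or_lt with rfl | h0
  · simp [norm_le_zero_iff.1 h]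
  · rw [div_self h0.ne', one_smul]

/-! ## The path fibration -/

section PathFibration

variable {X Y : Type*} [TopologicalSpace X] [TopologicalSpace Y] (f : C(X, Y))

/-- The mapping path space of a continuous map. -/
def MappingPath : Type _ := {z : X × C(I, Y) // z.2 0 = f z.1}

instance : TopologicalSpace (MappingPath f) := inferInstanceAs (TopologicalSpace (Subtype _))

/-- The evaluation at the end point. -/
def MappingPath.p : C(MappingPath f, Y) := ⟨fun z => z.1.2 1, by fun_prop⟩

/-- The inclusion of the constant paths. -/
def MappingPath.const : C(X, MappingPath f) :=
  ⟨fun x => ⟨(x, ContinuousMap.const I (f x)), rfl⟩, by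
    refine Continuous.subtype_mk (continuous_id.prodMk ?_) _
    exact ContinuousMap.continuous_const'.comp f.continuous⟩

/-- The starting point. -/
def MappingPath.fst : C(MappingPath f, X) := ⟨fun z => z.1.1, by fun_prop⟩

variable {f}

/-- A map into the mapping path space. -/
def MappingPath.mk {A : Type*} [TopologicalSpace A] (x : C(A, X)) (γ : C(A × I, Y))
    (h : ∀ a, γ (a, 0) = f (x a)) : C(A, MappingPath f) :=
  ⟨fun a => ⟨(x a, γ.curry a), h a⟩, by
    refine Continuous.subtype_mk (x.continuous.prodMk ?_) _
    exact γ.curry.continuous⟩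

lemma MappingPath.continuous_path {A : Type*} [TopologicalSpace A] {x : A → MappingPath f}
    (hx : Continuous x) {t : A → I} (ht : Continuous t) : Continuous fun a => (x a).1.2 (t a) := by
  have : Continuous fun a => (x a).1.2 := by fun_prop
  fun_prop

variable (f)

/-- A relative form of the homotopy lifting property, for the inclusion of the sphere in the
ball. -/
def RelHomotopyLifting (V : Type*) [NormedAddCommGroup V] [NormedSpace ℝ V] : Prop :=
  ∀ (k : C(Ball V × I, Y)) (g : C(Ball V, X)) (h : C(Sph V × I, X)),
    (∀ s, h (s, 0) = g (incl s)) → (∀ b, f (g b) = k (b, 0)) →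
      (∀ s t, f (h (s, t)) = k (incl s, t)) →
    ∃ G : C(Ball V × I, X), (∀ b, G (b, 0) = g b) ∧ (∀ s t, G (incl s, t) = h (s, t)) ∧
      ∀ z, f (G z) = k z

variable (V)

/-- The path fibration has the relative homotopy lifting property. -/
lemma MappingPath.relHomotopyLifting : RelHomotopyLifting (MappingPath.p f) V := by
  intro k g h hgh hg hh
  -- Extending along the retraction produces a map over `k ∘ retract` instead of `k`. The error is
  -- corrected by prolonging each path with the image under `k` of the segment from `retract z` to
  -- `z`.
  obtain ⟨G, hG⟩ := exists_extension g h hgh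
  have hpG (z) : MappingPath.p f (G z) = k (retract z) := by
    obtain ⟨b, h1, h2⟩ | ⟨s, t, h1, h2⟩ := hG z
    · rw [h2, h1, hg]
    · rw [h2, h1, hh]
  let c : C(Ball V × I, V × ℝ) := ⟨fun z => (z.1, z.2), by fun_prop⟩
  -- `e` retracts the ambient vector space onto the cylinder, so that the segment can be written
  -- with vector operations.
  let e : C(V × ℝ, Ball V × I) := ⟨fun z => (radial z.1, Set.projIcc 0 1 zero_le_one z.2), by
    have := continuous_projIcc (h := zero_le_one (α := ℝ))
    fun_prop⟩
  have hec (z) : e (c z) = z := Prod.ext (radial_coe z.1) (Set.projIcc_val zero_le_one z.2)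
  let w : C(Ball V × I, V × ℝ) := c - c.comp retract
  have hw (z) : w z = c z - c (retract z) := rfl
  -- The prolonged path has duration 1 + ‖w‖: time 1 for the old path, then the segment at unit
  -- speed. Where `retract z = z` this duration is 1, so the path is literally unchanged and the
  -- prescribed values on bottom and sides survive.
  let T (z : (Ball V × I) × I) : ℝ := (1 + ‖w z.1‖) * (z.2 : ℝ)
  have hT : Continuous T := by fun_prop
  let P (z : (Ball V × I) × I) : Y := if T z ≤ 1 then
    (G z.1).1.2 (Set.projIcc 0 1 zero_le_one (T z))
    else k (e (c (retract z.1) + clip (w z.1) (T z - 1)))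
  have hP : Continuous P := by
    refine Continuous.if_le ?_ ?_ hT continuous_const ?_
    · exact MappingPath.continuous_path (G.continuous.comp continuous_fst)
        (continuous_projIcc.comp hT)
    · refine k.continuous.comp (e.continuous.comp (Continuous.add ?_ ?_))
      · exact c.continuous.comp (retract.continuous.comp continuous_fst)
      · exact continuous_clip.comp ((w.continuous.comp continuous_fst).prodMk
          (hT.sub continuous_const))
    · intro z hz
      rw [hz, sub_self, clip_zero, add_zero, hec, ← hpG, Set.projIcc_right]
      rfl
  have hP0 (z) : P (z, 0) = f (MappingPath.fst f (G z)) := by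
    have : T (z, 0) = 0 := by simp [T]
    simp only [P]
    rw [this, if_pos zero_le_one, Set.projIcc_left]
    exact (G z).2
  have hP' (z) (hz : retract z = z) (s : I) : P (z, s) = (G z).1.2 s := by
    have : T (z, s) = s := by simp [T, hw, hz]
    simp only [P]
    rw [this, if_pos s.2.2, Set.projIcc_val]
  let G' : C(Ball V × I, MappingPath f) :=
    MappingPath.mk ((MappingPath.fst f).comp G) ⟨P, hP⟩ hP0
  have hG' (z) (hz : retract z = z) : G' z = G z :=
    Subtype.ext (Prod.ext rfl (ContinuousMap.ext fun s => hP' z hz s))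
  refine ⟨G', fun b => ?_, fun s t => ?_, fun z => ?_⟩
  · rw [hG' _ (retract_zero b)]
    obtain ⟨b', h1, h2⟩ | ⟨s, t, h1, h2⟩ := hG (b, 0)
    · rw [retract_zero, Prod.mk_inj] at h1
      rw [h2, h1.1]
    · rw [retract_zero, Prod.mk_inj] at h1
      rw [h2, h1.1, ← h1.2, hgh]
  · rw [hG' _ (retract_incl s t)]
    obtain ⟨b', h1, h2⟩ | ⟨s', t', h1, h2⟩ := hG (incl s, t)
    · rw [retract_incl, Prod.mk_inj] at h1
      rw [h2, h1.2, hgh, ← h1.1]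
    · rw [retract_incl, Prod.mk_inj] at h1
      have hs : s = s' := Subtype.ext (congrArg (fun b : Ball V => (b : V)) h1.1)
      rw [h2, hs, h1.2]
  · change P (z, 1) = k z
    have hT1 : T (z, 1) = 1 + ‖w z‖ := by simp [T]
    simp only [P]
    rw [hT1]
    split_ifs with h1
    · have hz : w z = 0 := norm_le_zero_iff.1 (by linarith)
      have hz' : retract z = z := by
        rw [← hec (retract z), ← sub_eq_zero.1 ((hw z).symm.trans hz), hec]
      rw [hz, norm_zero, add_zero, Set.projIcc_right]
      exact (hpG z).trans (by rw [hz'])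
    · rw [add_sub_cancel_left, clip_of_norm_le le_rfl, hw, add_sub_cancel, hec]

end PathFibration

end BallLifting

/-! ### Homotopy invariance of lifting problems for balls. -/

namespace BallLifting

section Homotopy

variable {V : Type*} [NormedAddCommGroup V] [NormedSpace ℝ V]
  {E B : Type*} [TopologicalSpace E] [TopologicalSpace B]

/-- All lifting problems with given boundary values on the sphere have a solution. -/
def HasLifts (p : C(E, B)) (φ : C(Sph V, E)) : Prop :=
  ∀ ψ : C(Ball V, B), (∀ s, ψ (incl s) = p (φ s)) →
    ∃ Φ : C(Ball V, E), (∀ s, Φ (incl s) = φ s) ∧ ∀ b, p (Φ b) = ψ b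

/-- Solvability of lifting problems is a homotopy invariant of the boundary values. -/
lemma HasLifts.of_homotopy {p : C(E, B)} (hp : RelHomotopyLifting p V) (h : C(Sph V × I, E))
    {φ₀ φ₁ : C(Sph V, E)} (h₀ : ∀ s, h (s, 0) = φ₀ s) (h₁ : ∀ s, h (s, 1) = φ₁ s)
    (H : HasLifts p φ₁) : HasLifts p φ₀ := by
  intro ψ hψ
  -- The problem is transported along `h` to one with boundary values `φ₁`; its solution is brought
  -- back by lifting the reversed homotopy relative to the sphere.
  obtain ⟨Ψ, hΨ₀, hΨ⟩ := exists_homotopy_extension ψ (p.comp h)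
    (fun s => by rw [hψ, ← h₀]; rfl)
  obtain ⟨Φ₁, hΦ₁, hΦ₁'⟩ := H ⟨fun b => Ψ (b, 1), by fun_prop⟩
    (fun s => by rw [← h₁]; exact hΨ s 1)
  obtain ⟨G, hG₀, hG, hG'⟩ := hp ⟨fun z => Ψ (z.1, unitInterval.symm z.2), by fun_prop⟩ Φ₁
    ⟨fun z => h (z.1, unitInterval.symm z.2), by fun_prop⟩
    (fun s => by
      change h (s, unitInterval.symm 0) = _
      rw [unitInterval.symm_zero, h₁, hΦ₁])
    (fun b => by
      change _ = Ψ (b, unitInterval.symm 0)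
      rw [unitInterval.symm_zero, hΦ₁']
      rfl)
    (fun s t => (hΨ s _).symm)
  refine ⟨⟨fun b => G (b, 1), by fun_prop⟩, fun s => ?_, fun b => ?_⟩
  · refine (hG s 1).trans ?_
    change h (s, unitInterval.symm 1) = _
    rw [unitInterval.symm_one, h₀]
  · refine (hG' (b, 1)).trans ?_
    change Ψ (b, unitInterval.symm 1) = _
    rw [unitInterval.symm_one, hΨ₀]

end Homotopy

/-! ### Contracting the complement of a face of the cube boundary. -/

section Contraction

variable {W : Type*} [NormedAddCommGroup W] [NormedSpace ℝ W]

/-- A function on the unit sphere of `ℝ × W`, equal to `1` outside of the interior of the face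
given by the equation `x.1 = -1`. -/
def height (x : ℝ × W) : ℝ := max ‖x.2‖ ((x.1 + 1) / 2)

lemma continuous_height : Continuous (height : ℝ × W → ℝ) := by unfold height; fun_prop

lemma norm_cases {x : ℝ × W} (hx : ‖x‖ = 1) : |x.1| ≤ 1 ∧ ‖x.2‖ ≤ 1 ∧ (|x.1| = 1 ∨ ‖x.2‖ = 1) := by
  rw [Prod.norm_def, Real.norm_eq_abs] at hx
  refine ⟨hx ▸ le_max_left _ _, hx ▸ le_max_right _ _, ?_⟩
  rcases max_choice |x.1| ‖x.2‖ with h | h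
  · exact Or.inl (h ▸ hx)
  · exact Or.inr (h ▸ hx)

lemma height_le_one {x : ℝ × W} (hx : ‖x‖ = 1) : height x ≤ 1 := by
  obtain ⟨h1, h2, -⟩ := norm_cases hx
  exact max_le h2 (by linarith [abs_le.1 h1])

lemma height_nonneg (x : ℝ × W) : 0 ≤ height x := le_max_of_le_left (norm_nonneg _)

lemma eq_neg_one_or_height_eq_one {x : ℝ × W} (hx : ‖x‖ = 1) : x.1 = -1 ∨ height x = 1 := by
  have h0 := height_le_one hx
  obtain ⟨h1, h2, h | h⟩ := norm_cases hx
  · rcases eq_or_eq_neg_of_abs_eq h with h | h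
    · right
      exact le_antisymm h0 (le_max_of_le_right (by rw [h]; norm_num))
    · exact Or.inl h
  · exact Or.inr (le_antisymm h0 (h ▸ le_max_left _ _))

/-- The homotopy on the sphere before normalization. -/
def pushVec (x : ℝ × W) (t : ℝ) : ℝ × W :=
  ((1 - t) * x.1 + t * (2 * height x - 1), (1 - t * height x) • x.2)

/-- If the second component vanishes, either `t` and the height are both 1, or `x.2 = 0` and `x` is
one of the points (±1, 0), of height 1 or 0. The first component is then 1 or -1 for every such `t`.
-/
lemma pushVec_ne_zero {x : ℝ × W} (hx : ‖x‖ = 1) {t : ℝ} (ht₀ : 0 ≤ t) (ht₁ : t ≤ 1) :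
    pushVec x t ≠ 0 := by
  intro h
  have h1 : (1 - t) * x.1 + t * (2 * height x - 1) = 0 := congrArg Prod.fst h
  have h2 : (1 - t * height x) • x.2 = 0 := congrArg Prod.snd h
  have hm := height_le_one hx
  have hm₀ := height_nonneg x
  rcases smul_eq_zero.1 h2 with h2 | h2
  · have e1 : t * height x ≤ t := mul_le_of_le_one_right ht₀ hm
    have e2 : t = 1 := by linarith
    subst e2
    linarith
  · obtain ⟨-, -, h3 | h3⟩ := norm_cases hx
    · rcases eq_or_eq_neg_of_abs_eq h3 with h3 | h3
      · have : height x = 1 := by simp [height, h2, h3]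
        rw [this, h3] at h1
        linarith
      · have : height x = 0 := by simp [height, h2, h3]
        rw [this, h3] at h1
        linarith
    · rw [h2, norm_zero] at h3
      exact zero_ne_one h3

/-- A homotopy from the identity of the sphere to a map contracting the complement of an open face
to a point. -/
def push : C(Sph (ℝ × W) × I, Sph (ℝ × W)) where
  toFun z := ⟨‖pushVec (z.1 : ℝ × W) z.2‖⁻¹ • pushVec (z.1 : ℝ × W) z.2, by
    have h := pushVec_ne_zero (norm_eq_one z.1) z.2.2.1 z.2.2.2
    rw [mem_sphere_zero_iff_norm, norm_smul, norm_inv, norm_norm,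
      inv_mul_cancel₀ (norm_ne_zero_iff.2 h)]⟩
  continuous_toFun := by
    have h : Continuous fun z : Sph (ℝ × W) × I => pushVec (z.1 : ℝ × W) z.2 := by
      have := continuous_height (W := W)
      unfold pushVec
      fun_prop
    refine Continuous.subtype_mk (Continuous.smul (h.norm.inv₀ fun z => ?_) h) _
    exact norm_ne_zero_iff.2 (pushVec_ne_zero (norm_eq_one z.1) z.2.2.1 z.2.2.2)

lemma push_zero (s : Sph (ℝ × W)) : push (s, 0) = s := by
  apply Subtype.ext
  have : pushVec (s : ℝ × W) ((0 : I) : ℝ) = s := by simp [pushVec]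
  change ‖pushVec (s : ℝ × W) ((0 : I) : ℝ)‖⁻¹ • pushVec (s : ℝ × W) ((0 : I) : ℝ) = s
  rw [this, norm_eq_one, inv_one, one_smul]

variable (W) in
/-- The point to which the complement of a face is contracted. -/
def pole : Sph (ℝ × W) := ⟨(1, 0), by simp⟩

lemma push_one {s : Sph (ℝ × W)} (hs : height (s : ℝ × W) = 1) : push (s, 1) = pole W := by
  apply Subtype.ext
  have : pushVec (s : ℝ × W) ((1 : I) : ℝ) = (1, 0) := by simp [pushVec, hs]; norm_num
  change ‖pushVec (s : ℝ × W) ((1 : I) : ℝ)‖⁻¹ • pushVec (s : ℝ × W) ((1 : I) : ℝ) = (1, 0)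
  rw [this]
  simp

end Contraction

/-! ### Passing between the unit cube and the sup-norm ball. -/

section Cube

variable {k : ℕ}

lemma abs_two_mul_sub_one (t : I) : |2 * (t : ℝ) - 1| ≤ 1 := by
  rw [abs_le]
  constructor <;> linarith [t.2.1, t.2.2]

lemma abs_two_mul_sub_one_eq {t : I} (ht : t = 0 ∨ t = 1) : |2 * (t : ℝ) - 1| = 1 := by
  rcases ht with rfl | rfl <;> norm_num

lemma eq_zero_or_eq_one_of_abs {t : I} (ht : |2 * (t : ℝ) - 1| = 1) : t = 0 ∨ t = 1 := by
  rcases eq_or_eq_neg_of_abs_eq ht with h | h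
  · exact Or.inr (Subtype.ext (by change (t : ℝ) = 1; linarith))
  · exact Or.inl (Subtype.ext (by change (t : ℝ) = 0; linarith))

/-- The affine homeomorphism from the unit cube to the unit ball for the sup norm. -/
def ofCube : C(Fin (k + 1) → I, Ball (ℝ × (Fin k → ℝ))) where
  toFun y := ⟨(2 * (y 0 : ℝ) - 1, fun i => 2 * (y i.succ : ℝ) - 1), by
    rw [mem_closedBall_zero_iff, Prod.norm_def]
    exact max_le (abs_two_mul_sub_one _)
      ((pi_norm_le_iff_of_nonneg zero_le_one).2 fun i => abs_two_mul_sub_one _)⟩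
  continuous_toFun := by fun_prop

lemma norm_ofCube {y : Fin (k + 1) → I} (hy : y ∈ Cube.boundary (Fin (k + 1))) :
    ‖(ofCube y : ℝ × (Fin k → ℝ))‖ = 1 := by
  refine le_antisymm (norm_le_one _) ?_
  obtain ⟨i, hi⟩ := hy
  have h := abs_two_mul_sub_one_eq hi
  rw [Prod.norm_def]
  cases i using Fin.cases with
  | zero => exact le_max_of_le_left h.ge
  | succ i =>
    refine le_max_of_le_right (h.ge.trans ?_)
    exact norm_le_pi_norm (fun i : Fin k => 2 * (y i.succ : ℝ) - 1) i

/-- The affine homeomorphism from the unit ball for the sup norm to the unit cube. -/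
def toCube : C(Ball (ℝ × (Fin k → ℝ)), Fin (k + 1) → I) where
  toFun b := Fin.cons (Set.projIcc 0 1 zero_le_one (((b : ℝ × (Fin k → ℝ)).1 + 1) / 2))
    fun i => Set.projIcc 0 1 zero_le_one (((b : ℝ × (Fin k → ℝ)).2 i + 1) / 2)
  continuous_toFun := by
    have := continuous_projIcc (h := zero_le_one (α := ℝ))
    refine continuous_pi fun i => ?_
    cases i using Fin.cases with
    | zero => simp only [Fin.cons_zero]; fun_prop
    | succ i => simp only [Fin.cons_succ]; fun_prop

lemma two_mul_projIcc {r : ℝ} (hr : |r| ≤ 1) :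
    2 * (Set.projIcc 0 1 (zero_le_one (α := ℝ)) ((r + 1) / 2) : ℝ) - 1 = r := by
  rw [abs_le] at hr
  rw [Set.projIcc_of_mem zero_le_one (show (r + 1) / 2 ∈ Set.Icc (0 : ℝ) 1 by
    constructor <;> linarith)]
  ring

lemma ofCube_toCube (b : Ball (ℝ × (Fin k → ℝ))) : ofCube (toCube b) = b := by
  have hb := norm_le_one b
  rw [Prod.norm_def, max_le_iff] at hb
  refine Subtype.ext (Prod.ext (two_mul_projIcc hb.1) (funext fun i => two_mul_projIcc ?_))
  exact (norm_le_pi_norm (b : ℝ × (Fin k → ℝ)).2 i).trans hb.2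

lemma toCube_mem_boundary {b : Ball (ℝ × (Fin k → ℝ))} (hb : ‖(b : ℝ × (Fin k → ℝ))‖ = 1) :
    toCube b ∈ Cube.boundary (Fin (k + 1)) := by
  rw [← ofCube_toCube b] at hb
  by_contra h
  have h' (i : Fin (k + 1)) : |2 * (toCube b i : ℝ) - 1| < 1 :=
    lt_of_le_of_ne (abs_two_mul_sub_one _) fun e => h ⟨i, eq_zero_or_eq_one_of_abs e⟩
  refine hb.not_lt ?_
  rw [Prod.norm_def]
  exact max_lt (h' 0) ((pi_norm_lt_iff zero_lt_one).2 fun i => h' i.succ)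

lemma mem_boundary_cons {t : I} {y : Fin k → I} (h : t = 0 ∨ t = 1 ∨ y ∈ Cube.boundary (Fin k)) :
    (Fin.cons t y : Fin (k + 1) → I) ∈ Cube.boundary (Fin (k + 1)) := by
  rcases h with h | h | ⟨i, h⟩
  · exact ⟨0, Or.inl h⟩
  · exact ⟨0, Or.inr h⟩
  · exact ⟨i.succ, h⟩

end Cube

end BallLifting

/-! ## Lifting properties of path fibrations of weak equivalences -/

namespace IsWeakHomotopyEquiv

variable {X Y : TopCat.{u}} {f : X ⟶ Y}

lemma exists_joined (hf : IsWeakHomotopyEquiv f) (y : Y) : ∃ x, Joined (f x) y := by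
  obtain ⟨⟨x⟩, hx⟩ := hf.1.2 (Quotient.mk _ y)
  exact ⟨x, Quotient.exact hx⟩

lemma joined (hf : IsWeakHomotopyEquiv f) {x x' : X} (h : Joined (f x) (f x')) : Joined x x' := by
  refine Quotient.exact (hf.1.1 (a₁ := Quotient.mk _ x) (a₂ := Quotient.mk _ x') ?_)
  exact Quotient.sound (s := pathSetoid Y) h

/-- For `k = 0` a loop is just a point and a null homotopy is a path to `x`, so injectivity on π₀
replaces injectivity on π_k. This lets spheres of all dimensions be treated uniformly. -/
lemma homotopic_const (hf : IsWeakHomotopyEquiv f) {k : ℕ} {x : X} (γ : GenLoop (Fin k) X x)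
    (h : GenLoop.Homotopic (GenLoop.mapOf f.hom k x γ) GenLoop.const) :
    GenLoop.Homotopic γ GenLoop.const := by
  rcases k with _ | k
  · obtain ⟨H⟩ := h
    have e : Joined (f (γ default)) (f x) :=
      ⟨{ toFun := fun t => H (t, default)
         continuous_toFun := by fun_prop
         source' := H.apply_zero default
         target' := H.apply_one default }⟩
    obtain ⟨P⟩ := hf.joined e
    refine ⟨⟨⟨⟨fun z => P z.1, by fun_prop⟩, fun y => ?_, fun y => ?_⟩, ?_⟩⟩
    · rw [Subsingleton.elim y default]
      exact P.source
    · exact P.target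
    · rintro t y ⟨i, -⟩
      exact i.elim0
  · refine Quotient.exact ((hf.2 (k + 1) x (by omega)).1
      (a₁ := Quotient.mk _ γ) (a₂ := Quotient.mk _ GenLoop.const) ?_)
    exact Quotient.sound (s := GenLoop.Homotopic.setoid (Fin (k + 1)) (f x)) h

lemma exists_homotopic (hf : IsWeakHomotopyEquiv f) {k : ℕ} {x : X}
    (γ : GenLoop (Fin (k + 1)) Y (f x)) :
    ∃ δ : GenLoop (Fin (k + 1)) X x, GenLoop.Homotopic (GenLoop.mapOf f.hom (k + 1) x δ) γ := by
  obtain ⟨⟨δ⟩, h⟩ := (hf.2 (k + 1) x (by omega)).2 (Quotient.mk _ γ)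
  exact ⟨δ, Quotient.exact h⟩

open BallLifting

lemma surjective_mappingPath (hf : IsWeakHomotopyEquiv f) :
    Function.Surjective (MappingPath.p f.hom) := by
  intro y
  obtain ⟨x, ⟨P⟩⟩ := hf.exists_joined y
  exact ⟨⟨(x, P.toContinuousMap), P.source⟩, P.target⟩

variable {k : ℕ}

/-- With constant boundary values, `ψ` represents an element of π_{k+1}(Y, f x). Surjectivity lifts
it up to a homotopy relative to the boundary, and the relative homotopy lifting property turns this
into a strict lift. -/
lemma hasLifts_const (hf : IsWeakHomotopyEquiv f) (x : X) :
    HasLifts (V := ℝ × (Fin k → ℝ)) (MappingPath.p f.hom)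
      (ContinuousMap.const _ (MappingPath.const f.hom x)) := by
  intro ψ hψ
  let γ : GenLoop (Fin (k + 1)) Y (f x) := ⟨ψ.comp ofCube, fun y hy =>
    hψ ⟨_, mem_sphere_zero_iff_norm.2 (norm_ofCube hy)⟩⟩
  obtain ⟨δ, ⟨N⟩⟩ := hf.exists_homotopic γ
  have hs (s : Sph (ℝ × (Fin k → ℝ))) : toCube (incl s) ∈ Cube.boundary (Fin (k + 1)) :=
    toCube_mem_boundary (norm_eq_one s)
  obtain ⟨G, hG₀, hG, hG'⟩ := MappingPath.relHomotopyLifting (ℝ × (Fin k → ℝ)) f.hom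
    ⟨fun z => N (z.2, toCube z.1), by fun_prop⟩
    ((MappingPath.const f.hom).comp (δ.1.comp toCube))
    (ContinuousMap.const _ (MappingPath.const f.hom x))
    (fun s => congrArg (MappingPath.const f.hom) (δ.2 _ (hs s)).symm)
    (fun b => (N.apply_zero (toCube b)).symm)
    (fun s t => by
      refine Eq.trans ?_ (N.eq_fst t (hs s)).symm
      exact congrArg f (δ.2 _ (hs s)).symm)
  refine ⟨⟨fun b => G (b, 1), by fun_prop⟩, fun s => hG s 1, fun b => ?_⟩
  refine (hG' (b, 1)).trans ((N.apply_one (toCube b)).trans ?_)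
  change ψ (ofCube (toCube b)) = _
  rw [ofCube_toCube]

/-- The point of the face `x.1 = -1` of the sphere given by a point of the cube. -/
def face : C(Fin k → I, Sph (ℝ × (Fin k → ℝ))) where
  toFun y := ⟨ofCube (Fin.cons 0 y),
    mem_sphere_zero_iff_norm.2 (norm_ofCube (mem_boundary_cons (Or.inl rfl)))⟩
  continuous_toFun := by
    refine Continuous.subtype_mk (continuous_subtype_val.comp (ofCube.continuous.comp ?_)) _
    fun_prop

lemma height_ofCube {t : I} {y : Fin k → I} (h : t = 1 ∨ y ∈ Cube.boundary (Fin k)) :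
    height (ofCube (Fin.cons t y) : ℝ × (Fin k → ℝ)) = 1 := by
  have h0 := norm_ofCube (mem_boundary_cons (Or.inr h))
  refine le_antisymm (height_le_one h0) ?_
  rcases h with rfl | ⟨i, hi⟩
  · refine le_max_of_le_right ?_
    change 1 ≤ (2 * ((1 : I) : ℝ) - 1 + 1) / 2
    norm_num
  · refine le_max_of_le_left ((abs_two_mul_sub_one_eq hi).ge.trans ?_)
    exact norm_le_pi_norm (fun i : Fin k => 2 * (y i : ℝ) - 1) i

lemma cons_tail_toCube {s : Sph (ℝ × (Fin k → ℝ))} (hs : (s : ℝ × (Fin k → ℝ)).1 ≤ -1) :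
    (Fin.cons 0 (Fin.tail (toCube (incl s))) : Fin (k + 1) → I) = toCube (incl s) := by
  have : toCube (incl s) 0 = 0 := by
    refine Set.projIcc_of_le_left zero_le_one ?_
    change ((s : ℝ × (Fin k → ℝ)).1 + 1) / 2 ≤ 0
    linarith
  rw [← this, Fin.cons_self_tail]

lemma face_tail_toCube {s : Sph (ℝ × (Fin k → ℝ))} (hs : (s : ℝ × (Fin k → ℝ)).1 ≤ -1) :
    face (Fin.tail (toCube (incl s))) = s := by
  apply Subtype.ext
  change (ofCube (Fin.cons 0 (Fin.tail (toCube (incl s)))) : ℝ × (Fin k → ℝ)) = s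
  rw [cons_tail_toCube hs, ofCube_toCube, coe_incl]

/-- The path fibration of a weak equivalence has the right lifting property with respect to
the inclusions of spheres in balls. -/
lemma hasLifts (hf : IsWeakHomotopyEquiv f) (φ : C(Sph (ℝ × (Fin k → ℝ)), MappingPath f.hom)) :
    HasLifts (MappingPath.p f.hom) φ := by
  have hp := MappingPath.relHomotopyLifting (ℝ × (Fin k → ℝ)) f.hom
  let x : C(Sph (ℝ × (Fin k → ℝ)), X) := (MappingPath.fst f.hom).comp φ
  -- Shrinking all paths to their starting points reduces the boundary values to constant paths.
  refine HasLifts.of_homotopy hp (φ₁ := (MappingPath.const f.hom).comp x)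
    (MappingPath.mk (x.comp ContinuousMap.fst)
      ⟨fun z => (φ z.1.1).1.2 (z.2 * unitInterval.symm z.1.2),
        MappingPath.continuous_path (by fun_prop) (by fun_prop)⟩
      fun a => ?_) (fun s => ?_) (fun s => ?_) ?_
  · change (φ a.1).1.2 (0 * _) = _
    rw [zero_mul]
    exact (φ a.1).2
  · refine Subtype.ext (Prod.ext rfl (ContinuousMap.ext fun t => ?_))
    change (φ s).1.2 (t * unitInterval.symm 0) = _
    rw [unitInterval.symm_zero, mul_one]
  · refine Subtype.ext (Prod.ext rfl (ContinuousMap.ext fun t => ?_))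
    change (φ s).1.2 (t * unitInterval.symm 1) = _
    rw [unitInterval.symm_one, mul_zero]
    exact (φ s).2
  -- After pushing, the map on the sphere is constant outside one open face, so that face carries a
  -- class in π_k(X, x₀).
  let x₁ : C(Sph (ℝ × (Fin k → ℝ)), X) := x.comp ⟨fun s => push (s, 1), by fun_prop⟩
  refine HasLifts.of_homotopy hp (φ₁ := (MappingPath.const f.hom).comp x₁)
    (((MappingPath.const f.hom).comp x).comp push) (fun s => ?_) (fun s => rfl) ?_
  · change (MappingPath.const f.hom) (x (push (s, 0))) = _
    rw [push_zero]
    rfl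
  let x₀ : X := x (pole _)
  have hx₁ (s : Sph (ℝ × (Fin k → ℝ))) (hs : height (s : ℝ × (Fin k → ℝ)) = 1) : x₁ s = x₀ :=
    congrArg x (push_one hs)
  intro ψ hψ
  let γ : GenLoop (Fin k) X x₀ := ⟨x₁.comp face, fun y hy =>
    hx₁ _ (height_ofCube (Or.inr hy))⟩
  have hψ' (t : I) (y : Fin k → I) (h : t = 1 ∨ y ∈ Cube.boundary (Fin k)) :
      ψ (ofCube (Fin.cons t y)) = f x₀ :=
    (hψ ⟨_, mem_sphere_zero_iff_norm.2 (norm_ofCube (mem_boundary_cons (Or.inr h)))⟩).trans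
      (congrArg f (hx₁ _ (height_ofCube h)))
  -- Read along the first cube coordinate, `ψ` is a null homotopy of `f ∘ γ`. Injectivity yields a
  -- null homotopy `N` of `γ`, which is extended by `x₀` off the face to contract `x₁`.
  obtain ⟨N⟩ := hf.homotopic_const γ ⟨⟨⟨⟨fun z => ψ (ofCube (Fin.cons z.1 z.2)), by fun_prop⟩,
    fun y => hψ (face y), fun y => hψ' 1 y (Or.inl rfl)⟩, fun t y hy => by
      exact (hψ' t y (Or.inr hy)).trans (congrArg f (γ.2 y hy)).symm⟩⟩
  have hN (t : I) (y : Fin k → I) (hy : y ∈ Cube.boundary (Fin k)) : N (t, y) = x₀ :=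
    (N.eq_fst t hy).trans (γ.2 y hy)
  obtain ⟨G, hG₁, hG₂⟩ := exists_continuousMap_glue
    (C₁ := {z : Sph (ℝ × (Fin k → ℝ)) × I | (z.1 : ℝ × (Fin k → ℝ)).1 ≤ -1})
    (C₂ := {z : Sph (ℝ × (Fin k → ℝ)) × I | 1 ≤ height (z.1 : ℝ × (Fin k → ℝ))})
    (isClosed_le (by fun_prop) (by fun_prop))
    (isClosed_le (by fun_prop) (continuous_height.comp (by fun_prop)))
    (fun z => (eq_neg_one_or_height_eq_one (norm_eq_one z.1)).imp (fun h => h.le) fun h => h.ge)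
    ⟨fun z => N (z.1.2, Fin.tail (toCube (incl z.1.1))), by unfold Fin.tail; fun_prop⟩
    (ContinuousMap.const _ x₀)
    (fun z h₁ h₂ => hN _ _ (by
      by_contra h
      have e : face (Fin.tail (toCube (incl z.1))) = z.1 := face_tail_toCube h₁
      have e' : toCube (incl z.1) ∈ Cube.boundary (Fin (k + 1)) :=
        toCube_mem_boundary (norm_eq_one z.1)
      have h₁' : (z.1 : ℝ × (Fin k → ℝ)).1 ≤ -1 := h₁
      have h₂' : 1 ≤ height (z.1 : ℝ × (Fin k → ℝ)) := h₂
      -- On the face the term `(x.1 + 1) / 2` of the height is at most 0, so height 1 must come from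
      -- the other coordinates: the point lies over the boundary of the `k`-cube, where `N` equals
      -- `x₀`.
      have h₃ : 1 ≤ ‖(z.1 : ℝ × (Fin k → ℝ)).2‖ := by
        rcases le_max_iff.1 h₂' with h | h
        · exact h
        · linarith
      rw [← e] at h₃
      refine h₃.not_gt ((pi_norm_lt_iff zero_lt_one).2 fun i => ?_)
      exact lt_of_le_of_ne (abs_two_mul_sub_one _) fun e => h ⟨i, eq_zero_or_eq_one_of_abs e⟩))
  refine HasLifts.of_homotopy hp ((MappingPath.const f.hom).comp G)
    (φ₁ := ContinuousMap.const _ (MappingPath.const f.hom x₀)) (fun s => ?_) (fun s => ?_)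
    (hf.hasLifts_const x₀) ψ hψ
  · refine congrArg (MappingPath.const f.hom) ?_
    rcases eq_neg_one_or_height_eq_one (norm_eq_one s) with h | h
    · refine (hG₁ (s, 0) h.le).trans ((N.apply_zero _).trans ?_)
      exact congrArg x₁ (face_tail_toCube h.le)
    · exact (hG₂ (s, 0) h.ge).trans (hx₁ s h).symm
  · refine congrArg (MappingPath.const f.hom) ?_
    rcases eq_neg_one_or_height_eq_one (norm_eq_one s) with h | h
    · exact (hG₁ (s, 1) h.le).trans (N.apply_one _)
    · exact hG₂ (s, 1) h.ge

end IsWeakHomotopyEquiv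

/-! ## The simplex as a ball -/

namespace SimplexBall

open BallLifting

variable {k : ℕ}

/-- The barycentric coordinates of a point. -/
def coords : C(ℝ × (Fin k → ℝ), Fin (k + 2) → ℝ) where
  toFun y := Fin.cons (1 - y.1 - ∑ i, y.2 i) (Fin.cons y.1 y.2)
  continuous_toFun := by fun_prop

lemma sum_coords (y : ℝ × (Fin k → ℝ)) : ∑ i, coords y i = 1 := by
  simp only [coords, ContinuousMap.coe_mk, Fin.sum_univ_succ, Fin.cons_zero, Fin.cons_succ]
  ring

lemma coords_combo {a b : ℝ} (hab : a + b = 1) (y z : ℝ × (Fin k → ℝ)) (i : Fin (k + 2)) :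
    coords (a • y + b • z) i = a * coords y i + b * coords z i := by
  cases i using Fin.cases with
  | zero =>
    simp only [coords, ContinuousMap.coe_mk, Fin.cons_zero, Prod.fst_add, Prod.smul_fst,
      Prod.snd_add, Prod.smul_snd, Pi.add_apply, Pi.smul_apply, smul_eq_mul,
      Finset.sum_add_distrib, ← Finset.mul_sum]
    linear_combination (-1 : ℝ) * hab
  | succ i =>
    cases i using Fin.cases with
    | zero => simp [coords]
    | succ i => simp [coords]

variable (k) in
/-- The simplex in `ℝ × (Fin k → ℝ)`. -/
def simplex : Set (ℝ × (Fin k → ℝ)) := {y | ∀ i, 0 ≤ coords y i}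

lemma isClosed_simplex : IsClosed (simplex k) := by
  simp only [simplex, Set.ofPred_forall]
  exact isClosed_iInter fun i => isClosed_le continuous_const (by fun_prop)

lemma convex_simplex : Convex ℝ (simplex k) := by
  intro y hy z hz a b ha hb hab i
  rw [coords_combo hab]
  exact add_nonneg (mul_nonneg ha (hy i)) (mul_nonneg hb (hz i))

/-- The homeomorphism from the standard simplex to the simplex in `ℝ × (Fin k → ℝ)`. -/
def homeomorph : stdSimplex ℝ (Fin (k + 2)) ≃ₜ simplex k where
  toFun x := ⟨(x 1, fun i => x i.succ.succ), by
    have e : coords (x 1, fun i : Fin k => x i.succ.succ) = x := by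
      funext i
      cases i using Fin.cases with
      | zero =>
        have := x.2.2
        simp only [Fin.sum_univ_succ] at this
        change 1 - x 1 - ∑ i : Fin k, x i.succ.succ = x 0
        rw [sub_sub, sub_eq_iff_eq_add]
        exact this.symm
      | succ i =>
        cases i using Fin.cases with
        | zero => rfl
        | succ i => rfl
    intro i
    rw [e]
    exact x.2.1 i⟩
  invFun y := ⟨coords y, y.2, sum_coords _⟩
  left_inv x := by
    apply Subtype.ext
    funext i
    cases i using Fin.cases with
    | zero =>
      have := x.2.2
      simp only [Fin.sum_univ_succ] at this
      change 1 - x 1 - ∑ i : Fin k, x i.succ.succ = x 0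
      rw [sub_sub, sub_eq_iff_eq_add]
      exact this.symm
    | succ i =>
      cases i using Fin.cases with
      | zero => rfl
      | succ i => rfl
  right_inv y := Subtype.ext rfl
  continuous_toFun := by
    have h (i) : Continuous fun x : stdSimplex ℝ (Fin (k + 2)) => x i :=
      (continuous_apply i).comp continuous_subtype_val
    exact Continuous.subtype_mk ((h 1).prodMk (continuous_pi fun i : Fin k => h i.succ.succ)) _
  continuous_invFun := by fun_prop

lemma coords_homeomorph (x : stdSimplex ℝ (Fin (k + 2))) : coords (homeomorph x) = x :=
  congrArg Subtype.val (homeomorph.symm_apply_apply x)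

lemma isOpen_pos : IsOpen {y : ℝ × (Fin k → ℝ) | ∀ i, 0 < coords y i} := by
  simp only [Set.ofPred_forall]
  exact isOpen_iInter_of_finite fun i => isOpen_lt continuous_const (by fun_prop)

/-- The barycenter of the simplex. -/
lemma exists_pos : ∃ c : ℝ × (Fin k → ℝ), ∀ i, 0 < coords c i := by
  refine ⟨(homeomorph stdSimplex.barycenter).1, fun i => ?_⟩
  rw [coords_homeomorph]
  exact lt_of_lt_of_eq (by positivity) (stdSimplex.barycenter_apply i).symm

/-- Where a coordinate vanishes, a small step directly away from a point with positive coordinates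
makes it negative, so such a point is not interior. -/
lemma interior_simplex : interior (simplex k) = {y | ∀ i, 0 < coords y i} := by
  refine subset_antisymm (fun y hy i => ?_)
    (interior_maximal (fun y hy i => (hy i).le) isOpen_pos)
  refine lt_of_le_of_ne (interior_subset hy i) fun h => ?_
  obtain ⟨c, hc⟩ := exists_pos (k := k)
  have h1 : Filter.Tendsto (fun t : ℝ => (1 + t) • y + (-t) • c) (𝓝 0) (𝓝 y) := by
    have : Continuous fun t : ℝ => (1 + t) • y + (-t) • c := by fun_prop
    simpa using this.tendsto 0
  have h2 := h1.eventually (mem_interior_iff_mem_nhds.1 hy)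
  obtain ⟨t, ht, ht0⟩ := ((h2.filter_mono nhdsWithin_le_nhds).and
    (self_mem_nhdsWithin (s := Set.Ioi (0 : ℝ)))).exists
  have h3 := ht i
  rw [coords_combo (by ring), ← h, mul_zero, zero_add] at h3
  have : 0 < t * coords c i := mul_pos ht0 (hc i)
  linarith

/-- A bounded convex set with nonempty interior is carried to the unit ball by an ambient
homeomorphism matching frontiers. By `interior_simplex`, the frontier is where some coordinate
vanishes. -/
lemma exists_homeomorph_ball : ∃ e : stdSimplex ℝ (Fin (k + 2)) ≃ₜ Ball (ℝ × (Fin k → ℝ)),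
    ∀ x, (∃ i, x i = 0) ↔ ‖(e x : ℝ × (Fin k → ℝ))‖ = 1 := by
  have hne : (interior (simplex k)).Nonempty := by
    rw [interior_simplex]
    exact exists_pos
  have hb : Bornology.IsBounded (simplex k) := by
    refine Bornology.IsBounded.subset (Metric.isBounded_closedBall (x := 0) (r := 1)) fun y hy => ?_
    have h (i) : |coords y i| ≤ 1 := by
      rw [abs_of_nonneg (hy i), ← sum_coords y]
      exact Finset.single_le_sum (fun j _ => hy j) (Finset.mem_univ i)
    rw [mem_closedBall_zero_iff, Prod.norm_def]
    exact max_le (h 1) ((pi_norm_le_iff_of_nonneg zero_le_one).2 fun i => h i.succ.succ)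
  obtain ⟨h, -, h1, h2⟩ :=
    exists_homeomorph_image_interior_closure_frontier_eq_unitBall convex_simplex hne hb
  rw [isClosed_simplex.closure_eq] at h1
  rw [isClosed_simplex.frontier_eq, interior_simplex] at h2
  refine ⟨homeomorph.trans ((h.image _).trans (Homeomorph.setCongr h1)), fun x => ?_⟩
  change _ ↔ ‖h (homeomorph x)‖ = 1
  rw [← mem_sphere_zero_iff_norm, ← h2, h.injective.mem_set_image, Set.mem_sdiff,
    and_iff_right (homeomorph x).2, Set.mem_ofPred_eq, coords_homeomorph, not_forall]
  exact exists_congr fun i => ⟨fun e => by rw [e]; exact lt_irrefl _,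
    fun e => le_antisymm (not_lt.1 e) (x.2.1 i)⟩

/-- The boundary of the standard simplex. -/
abbrev Bdry (k : ℕ) : Type := {x : stdSimplex ℝ (Fin (k + 2)) // ∃ i, x i = 0}

lemma exists_lift {E B : Type*} [TopologicalSpace E] [TopologicalSpace B] {p : C(E, B)}
    (hp : ∀ φ : C(Sph (ℝ × (Fin k → ℝ)), E), HasLifts p φ) (φ : C(Bdry k, E))
    (ψ : C(stdSimplex ℝ (Fin (k + 2)), B)) (h : ∀ x : Bdry k, ψ x = p (φ x)) :
    ∃ Φ : C(stdSimplex ℝ (Fin (k + 2)), E), (∀ x : Bdry k, Φ x = φ x) ∧ ∀ x, p (Φ x) = ψ x := by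
  obtain ⟨e, he⟩ := exists_homeomorph_ball (k := k)
  let j : C(Sph (ℝ × (Fin k → ℝ)), Bdry k) := ⟨fun s => ⟨e.symm (incl s), by
    rw [he, e.apply_symm_apply]
    exact norm_eq_one s⟩, by fun_prop⟩
  obtain ⟨Φ, h1, h2⟩ := hp (φ.comp j) (ψ.comp ⟨e.symm, e.symm.continuous⟩) (fun s => h (j s))
  refine ⟨Φ.comp ⟨e, e.continuous⟩, fun x => ?_, fun x => ?_⟩
  · refine (h1 ⟨e x, mem_sphere_zero_iff_norm.2 ((he _).1 x.2)⟩).trans (congrArg φ ?_)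
    exact Subtype.ext (e.symm_apply_apply x.1)
  · exact (h2 (e x)).trans (congrArg ψ (e.symm_apply_apply x))

end SimplexBall

/-! ## Singular simplicial sets and lifting properties -/

namespace stdSimplex

lemma map_apply_apply_of_injective {α β : Type*} [Fintype α] [Fintype β] {f : α → β}
    (hf : Function.Injective f) (z : stdSimplex ℝ α) (a : α) : map f z (f a) = z a := by
  classical
  rw [map_coe, FunOnFinite.linearMap_apply_apply]
  rw [Finset.sum_eq_single a]
  · intro b hb hba
    exact absurd (hf (Finset.mem_filter.1 hb).2) hba
  · intro h
    exact absurd (by simp) h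

lemma map_apply_eq_zero {α β : Type*} [Fintype α] [Fintype β] {f : α → β}
    (z : stdSimplex ℝ α) {b : β} (hb : ∀ a, f a ≠ b) : map f z b = 0 := by
  classical
  rw [map_coe, FunOnFinite.linearMap_apply_apply]
  refine Finset.sum_eq_zero fun a ha => ?_
  exact absurd (Finset.mem_filter.1 ha).2 (hb a)

lemma map_injective {α β : Type*} [Fintype α] [Fintype β] {f : α → β}
    (hf : Function.Injective f) : Function.Injective (map (S := ℝ) f) := by
  intro z z' h
  refine stdSimplex.ext (funext fun a => ?_)
  exact (map_apply_apply_of_injective hf z a).symm.trans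
    ((congrArg (fun y : stdSimplex ℝ β => y (f a)) h).trans (map_apply_apply_of_injective hf z' a))

/-- Forgetting a vanishing coordinate. -/
def del {n : ℕ} (i : Fin (n + 1)) (x : stdSimplex ℝ (Fin (n + 1))) (h : x i = 0) :
    stdSimplex ℝ (Fin n) :=
  ⟨fun j => x (i.succAbove j), fun j => x.2.1 _, by
    have := x.2.2
    rw [Fin.sum_univ_succAbove _ i] at this
    change x i + ∑ j, x (i.succAbove j) = 1 at this
    rwa [h, zero_add] at this⟩

lemma map_del {n : ℕ} (i : Fin (n + 1)) (x : stdSimplex ℝ (Fin (n + 1))) (h : x i = 0) :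
    map i.succAbove (del i x h) = x := by
  refine stdSimplex.ext (funext fun j => ?_)
  rcases Fin.eq_self_or_eq_succAbove i j with rfl | ⟨j, rfl⟩
  · rw [h, map_apply_eq_zero]
    exact Fin.succAbove_ne j
  · rw [map_apply_apply_of_injective Fin.succAbove_right_injective]
    rfl

end stdSimplex

namespace SimplexBall

/-- The boundary is a finite union of closed faces. A vanishing coordinate is chosen at each point;
compatibility makes the value independent of this choice, and continuity is checked on each face. -/
lemma exists_glue {k : ℕ} {E : Type*} [TopologicalSpace E]
    (s : Fin (k + 2) → C(stdSimplex ℝ (Fin (k + 1)), E))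
    (hs : ∀ i j z z', stdSimplex.map (Fin.succAbove i) z = stdSimplex.map (Fin.succAbove j) z' →
      s i z = s j z') :
    ∃ φ : C(Bdry k, E), ∀ i x (h : x.1 i = 0), φ x = s i (stdSimplex.del i x.1 h) := by
  let φ (x : Bdry k) : E := s x.2.choose (stdSimplex.del _ x.1 x.2.choose_spec)
  have hφ (i) (x : Bdry k) (h : x.1 i = 0) : φ x = s i (stdSimplex.del i x.1 h) :=
    hs _ _ _ _ (by rw [stdSimplex.map_del, stdSimplex.map_del])
  have hc (i : Fin (k + 2)) : Continuous fun x : stdSimplex ℝ (Fin (k + 2)) => x i :=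
    (continuous_apply i).comp continuous_subtype_val
  refine ⟨⟨φ, ?_⟩, hφ⟩
  refine LocallyFinite.continuous (f := fun i : Fin (k + 2) => {x : Bdry k | x.1 i = 0})
    (locallyFinite_of_finite _) (Set.eq_univ_of_forall fun x => Set.mem_iUnion.2 x.2)
    (fun i => isClosed_eq ((hc i).comp continuous_subtype_val) continuous_const) (fun i => ?_)
  rw [continuousOn_iff_continuous_domRestrict]
  refine Continuous.congr (f := fun x : {x : Bdry k | x.1 i = 0} =>
    s i (stdSimplex.del i x.1.1 x.2)) ?_ (fun x => (hφ i x.1 x.2).symm)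
  refine (s i).continuous.comp (Continuous.subtype_mk (continuous_pi fun j => ?_) _)
  exact (hc _).comp (continuous_subtype_val.comp continuous_subtype_val)

end SimplexBall

namespace TopCat

open SSet Simplicial Opposite

lemma toSSet_map_toSSetObjEquiv {E B : TopCat.{u}} (p : E ⟶ B) (n : SimplexCategoryᵒᵖ)
    (x : (toSSet.obj E).obj n) (z : stdSimplex ℝ (Fin (n.unop.len + 1))) :
    toSSetObjEquiv B n ((toSSet.map p).app n x) z = p (toSSetObjEquiv E n x z) := rfl

lemma δ_yonedaEquiv {S : SSet.{u}} {n : ℕ} (g : (Δ[n + 1] : SSet.{u}) ⟶ S) (i : Fin (n + 2)) :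
    S.δ i (yonedaEquiv g) = yonedaEquiv (SSet.stdSimplex.δ i ≫ g) :=
  SSet.yonedaEquiv_naturality _ _

lemma boundary_δ_comp_ι {n : ℕ} (i j : Fin (n + 2)) (h : i ≤ j) :
    SSet.stdSimplex.δ j ≫ SSet.boundary.ι.{u} i.castSucc =
      SSet.stdSimplex.δ i ≫ SSet.boundary.ι j.succ := by
  rw [← cancel_mono (SSet.boundary _).ι, Category.assoc, Category.assoc, boundary.ι_ι,
    boundary.ι_ι]
  exact (SSet.stdSimplex.map_comp _ _).symm.trans
    ((congrArg SSet.stdSimplex.map (SimplexCategory.δ_comp_δ h).symm).trans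
      (SSet.stdSimplex.map_comp _ _))

/-- The faces of a map from the boundary of a simplex, as maps on the topological simplices. -/
def bdryFace {E : TopCat.{u}} {k : ℕ} (a : (∂Δ[k + 1] : SSet.{u}) ⟶ toSSet.obj E)
    (i : Fin (k + 2)) : C(stdSimplex ℝ (Fin (k + 1)), E) :=
  toSSetObjEquiv E (op ⦋k⦌) (yonedaEquiv (boundary.ι i ≫ a))

/-- A point common to two distinct faces comes from a point `y` of a face of codimension two, on
which both restrictions agree by the simplicial identity for `δ`. -/
lemma bdryFace_castSucc_apply {E : TopCat.{u}} {k : ℕ}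
    (a : (∂Δ[k + 1] : SSet.{u}) ⟶ toSSet.obj E) (i j : Fin (k + 1)) (h : i ≤ j)
    (z z' : stdSimplex ℝ (Fin (k + 1)))
    (hz : stdSimplex.map i.castSucc.succAbove z = stdSimplex.map j.succ.succAbove z') :
    bdryFace a i.castSucc z = bdryFace a j.succ z' := by
  have hij : i.castSucc < j.succ := Fin.castSucc_lt_succ_iff.2 h
  have h0 : z j = 0 := by
    rw [← stdSimplex.map_apply_apply_of_injective Fin.succAbove_right_injective z j, hz,
      Fin.succAbove_castSucc_of_le _ _ h]
    exact stdSimplex.map_apply_eq_zero _ (Fin.succAbove_ne _)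
  -- The two faces of a 1-simplex are disjoint: the only coordinate of a point of the 0-simplex is
  -- 1, not 0.
  rcases k with _ | k
  · have h1 := z.2.2
    rw [Finset.sum_eq_single_of_mem j (Finset.mem_univ j)
      fun b _ hb => absurd (Subsingleton.elim (α := Fin 1) b j) hb] at h1
    exact absurd (h0.symm.trans h1) zero_ne_one
  let y := stdSimplex.del j z h0
  have hy : stdSimplex.map j.succAbove y = z := stdSimplex.map_del _ _ _
  have hy' : stdSimplex.map i.succAbove y = z' := by
    refine stdSimplex.map_injective (f := j.succ.succAbove) Fin.succAbove_right_injective ?_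
    rw [← hz, ← hy, stdSimplex.map_comp_apply, stdSimplex.map_comp_apply]
    congr 1
    exact congrArg (fun φ : ⦋k⦌ ⟶ ⦋k + 2⦌ => ⇑φ.toOrderHom) (SimplexCategory.δ_comp_δ h)
  rw [← hy, ← hy']
  unfold bdryFace
  rw [← toSSetObjEquiv_δ_apply, ← toSSetObjEquiv_δ_apply, δ_yonedaEquiv, δ_yonedaEquiv,
    ← Category.assoc, ← Category.assoc, boundary_δ_comp_ι _ _ h]

lemma bdryFace_apply {E : TopCat.{u}} {k : ℕ}
    (a : (∂Δ[k + 1] : SSet.{u}) ⟶ toSSet.obj E) (i j : Fin (k + 2))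
    (z z' : stdSimplex ℝ (Fin (k + 1)))
    (hz : stdSimplex.map i.succAbove z = stdSimplex.map j.succAbove z') :
    bdryFace a i z = bdryFace a j z' := by
  rcases lt_trichotomy i j with h | rfl | h
  · obtain ⟨i, rfl⟩ := Fin.exists_castSucc_eq.2 (h.trans_le (Fin.le_last _)).ne
    obtain ⟨j, rfl⟩ := Fin.exists_succ_eq_of_ne_zero ((Fin.zero_le _).trans_lt h).ne'
    exact bdryFace_castSucc_apply a i j (Fin.castSucc_lt_succ_iff.1 h) z z' hz
  · rw [stdSimplex.map_injective Fin.succAbove_right_injective hz]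
  · obtain ⟨j, rfl⟩ := Fin.exists_castSucc_eq.2 (h.trans_le (Fin.le_last _)).ne
    obtain ⟨i, rfl⟩ := Fin.exists_succ_eq_of_ne_zero ((Fin.zero_le _).trans_lt h).ne'
    exact (bdryFace_castSucc_apply a j i (Fin.castSucc_lt_succ_iff.1 h) z' z hz.symm).symm

open BallLifting in
/-- A surjective map with the right lifting property with respect to the inclusions of spheres in
balls induces a trivial fibration on singular simplicial sets. -/
lemma rlp_toSSet_map {E B : TopCat.{u}} (p : E ⟶ B) (h₀ : Function.Surjective p)
    (h : ∀ (k : ℕ) (φ : C(Sph (ℝ × (Fin k → ℝ)), E)), HasLifts p.hom φ) :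
    (MorphismProperty.monomorphisms SSet.{u}).rlp (toSSet.map p) := by
  rw [SSet.rlp_monomorphisms]
  rintro _ _ _ ⟨n⟩
  refine ⟨fun {a b} sq => ?_⟩
  -- It suffices to lift against boundary inclusions. For `n = 0` the boundary is empty and the
  -- problem is surjectivity; otherwise the simplex is a ball.
  rcases n with _ | k
  · let β : C(stdSimplex ℝ (Fin 1), B) := toSSetObjEquiv B (op ⦋0⦌) (yonedaEquiv b)
    obtain ⟨e, he⟩ := h₀ (β default)
    refine ⟨⟨⟨yonedaEquiv.symm ((toSSetObjEquiv E (op ⦋0⦌)).symm (ContinuousMap.const _ e)),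
      ?_, ?_⟩⟩⟩
    · ext
    · apply SSet.yonedaEquiv.injective
      rw [SSet.yonedaEquiv_comp, Equiv.apply_symm_apply]
      apply (toSSetObjEquiv B (op ⦋0⦌)).injective
      ext z
      exact he.trans (congrArg β (Subsingleton.elim _ _))
  · obtain ⟨φ, hφ⟩ := SimplexBall.exists_glue (bdryFace a) (bdryFace_apply a)
    let β : C(stdSimplex ℝ (Fin (k + 2)), B) := toSSetObjEquiv B (op ⦋k + 1⦌) (yonedaEquiv b)
    have hβ (i : Fin (k + 2)) (z : stdSimplex ℝ (Fin (k + 1))) :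
        β (stdSimplex.map i.succAbove z) = p (bdryFace a i z) := by
      unfold bdryFace
      rw [← toSSet_map_toSSetObjEquiv, ← SSet.yonedaEquiv_comp, Category.assoc, sq.w,
        boundary.ι_ι_assoc, ← δ_yonedaEquiv, toSSetObjEquiv_δ_apply]
    obtain ⟨Φ, h1, h2⟩ := SimplexBall.exists_lift (h k) φ β (by
      rintro ⟨x, i, hi⟩
      rw [hφ i _ hi]
      exact (congrArg β (stdSimplex.map_del i x hi).symm).trans (hβ i _))
    refine ⟨⟨⟨yonedaEquiv.symm ((toSSetObjEquiv E (op ⦋k + 1⦌)).symm Φ), ?_, ?_⟩⟩⟩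
    · refine boundary.hom_ext fun i => SSet.yonedaEquiv.injective ?_
      rw [boundary.ι_ι_assoc, ← δ_yonedaEquiv, Equiv.apply_symm_apply]
      apply (toSSetObjEquiv E (op ⦋k⦌)).injective
      ext z
      rw [toSSetObjEquiv_δ_apply, Equiv.apply_symm_apply]
      have hz : stdSimplex.map i.succAbove z i = 0 :=
        stdSimplex.map_apply_eq_zero _ (Fin.succAbove_ne _)
      refine (h1 ⟨_, i, hz⟩).trans ((hφ i _ hz).trans (congrArg (bdryFace a i) ?_))
      exact stdSimplex.map_injective Fin.succAbove_right_injective (stdSimplex.map_del _ _ _)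
    · apply SSet.yonedaEquiv.injective
      rw [SSet.yonedaEquiv_comp, Equiv.apply_symm_apply]
      apply (toSSetObjEquiv B (op ⦋k + 1⦌)).injective
      ext z
      exact h2 z

end TopCat

/-! ### Trivial fibrations of simplicial sets on chains. -/

namespace SSet

open Simplicial Opposite MonoidalCategory

/-- The inclusion of the two ends of a cylinder. -/
def endsι (S : SSet.{u}) : (FunctorToTypes.coprod S S : SSet.{u}) ⟶ S ⊗ Δ[1] :=
  FunctorToTypes.coprod.desc ι₀ ι₁

/-- The ends are disjoint because their components in `Δ[1]` are constant at different vertices; on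
each end the first projection recovers the simplex. -/
instance (S : SSet.{u}) : Mono (endsι S) := by
  have (n : SimplexCategoryᵒᵖ) : Mono ((endsι S).app n) := by
    rw [mono_iff_injective]
    have key (m : ℕ) (x y : S _⦋m⦌) : (ι₀ : S ⟶ S ⊗ Δ[1]).app (op ⦋m⦌) x ≠
        (ι₁ : S ⟶ S ⊗ Δ[1]).app (op ⦋m⦌) y := by
      intro e
      have e' := congrArg (fun z : (S ⊗ Δ[1] : SSet.{u}) _⦋m⦌ => z.2 (0 : Fin (m + 1))) e
      exact zero_ne_one (α := Fin 2) e'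
    rintro (x | x) (y | y) h
    · exact congrArg Sum.inl (congrArg Prod.fst h)
    · exact absurd h (key n.unop.len x y)
    · exact absurd h.symm (key n.unop.len y x)
    · exact congrArg Sum.inr (congrArg Prod.fst h)
  exact NatTrans.mono_of_mono_app _

/-- A trivial fibration of simplicial sets is a homotopy equivalence, hence induces a
quasi-isomorphism on chain complexes. -/
lemma quasiIso_chainComplexMap_of_rlp {S T : SSet.{u}} (p : S ⟶ T)
    (hp : (MorphismProperty.monomorphisms SSet.{u}).rlp p) (R : AddCommGrpCat.{u}) :
    QuasiIso (chainComplexMap p R) := by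
  -- Lifting against ∅ → T gives a section `s`; lifting against the two ends of the cylinder on `S`
  -- then gives a homotopy from `p ≫ s` to the identity.
  have h₁ := hp (initial.to T) (MorphismProperty.monomorphisms.infer_property _)
  have sq₁ : CommSq (initial.to S) (initial.to T) p (𝟙 T) := ⟨by simp⟩
  let s : T ⟶ S := sq₁.lift
  have hs : s ≫ p = 𝟙 T := sq₁.fac_right
  have h₂ := hp (endsι S) (MorphismProperty.monomorphisms.infer_property _)
  have sq₂ : CommSq (FunctorToTypes.coprod.desc (p ≫ s) (𝟙 S)) (endsι S) p
      (CartesianMonoidalCategory.fst S Δ[1] ≫ p) := ⟨by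
    ext n (x | x)
    · exact congrArg (fun φ : T ⟶ T => φ.app n (p.app n x)) hs
    · rfl⟩
  let H : SSet.Homotopy (p ≫ s) (𝟙 S) :=
    { h := sq₂.lift
      h₀ := congrArg (fun φ => FunctorToTypes.coprod.inl ≫ φ) sq₂.fac_left
      h₁ := congrArg (fun φ => FunctorToTypes.coprod.inr ≫ φ) sq₂.fac_left
      rel := by
        ext n x
        exact x.1.2.elim }
  let e : HomotopyEquiv (S.chainComplex R) (T.chainComplex R) :=
    { hom := chainComplexMap p R
      inv := chainComplexMap s R
      homotopyHomInvId := (Homotopy.ofEq (Functor.map_comp _ _ _).symm).trans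
        ((H.chainComplexMap R).trans (Homotopy.ofEq (CategoryTheory.Functor.map_id _ _)))
      homotopyInvHomId := Homotopy.ofEq ((Functor.map_comp _ _ _).symm.trans
        ((congrArg _ hs).trans (CategoryTheory.Functor.map_id _ _))) }
  exact e.quasiIso_hom

end SSet

/-! ## Singular chains of weak equivalences -/

/-- Singular chains in nonnegative degrees. -/
abbrev natSingularChains : TopCat.{u} ⥤ ChainComplex AddCommGrpCat.{u} ℕ :=
  (AlgebraicTopology.singularChainComplexFunctor AddCommGrpCat.{u}).obj
    (AddCommGrpCat.of (ULift.{u} ℤ))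

/-- Singular chains send homotopy equivalences to quasi-isomorphisms. -/
lemma quasiIso_natSingularChains_of_homotopyEquiv {A B : TopCat.{u}} (i : A ⟶ B) (r : B ⟶ A)
    (h₁ : TopCat.Homotopy (i ≫ r) (𝟙 A)) (h₂ : TopCat.Homotopy (r ≫ i) (𝟙 B)) :
    QuasiIso (natSingularChains.map i) := by
  let e : HomotopyEquiv (natSingularChains.obj A) (natSingularChains.obj B) :=
    { hom := natSingularChains.map i
      inv := natSingularChains.map r
      homotopyHomInvId := (Homotopy.ofEq (natSingularChains.map_comp _ _).symm).trans
        ((h₁.singularChainComplexFunctorObjMap _).trans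
          (Homotopy.ofEq (natSingularChains.map_id _)))
      homotopyInvHomId := (Homotopy.ofEq (natSingularChains.map_comp _ _).symm).trans
        ((h₂.singularChainComplexFunctorObjMap _).trans
          (Homotopy.ofEq (natSingularChains.map_id _))) }
  exact e.quasiIso_hom

open BallLifting in
lemma quasiIso_natSingularChains_const {X Y : TopCat.{u}} (f : X ⟶ Y) :
    QuasiIso (natSingularChains.map
      (TopCat.ofHom (MappingPath.const f.hom) : X ⟶ TopCat.of (MappingPath f.hom))) := by
  refine quasiIso_natSingularChains_of_homotopyEquiv _ (TopCat.ofHom (MappingPath.fst f.hom))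
    (ContinuousMap.Homotopy.refl _) ?_
  exact
    { toContinuousMap := MappingPath.mk ((MappingPath.fst f.hom).comp ContinuousMap.snd)
        ⟨fun z => (z.1.2).1.2 (z.2 * z.1.1),
          MappingPath.continuous_path (by fun_prop) (by fun_prop)⟩
        (fun a => by
          change a.2.1.2 (0 * _) = _
          rw [zero_mul]
          exact a.2.2)
      map_zero_left := fun z => by
        refine Subtype.ext (Prod.ext rfl (ContinuousMap.ext fun t => ?_))
        change z.1.2 (t * 0) = _
        rw [mul_zero]
        exact z.2
      map_one_left := fun z => by
        refine Subtype.ext (Prod.ext rfl (ContinuousMap.ext fun t => ?_))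
        change z.1.2 (t * 1) = _
        rw [mul_one]
        rfl }

open BallLifting in
/-- Weak homotopy equivalences induce quasi-isomorphisms on singular chains. -/
theorem IsWeakHomotopyEquiv.quasiIso_natSingularChains {X Y : TopCat.{u}} {f : X ⟶ Y}
    (hf : IsWeakHomotopyEquiv f) : QuasiIso (natSingularChains.map f) := by
  let i : X ⟶ TopCat.of (MappingPath f.hom) := TopCat.ofHom (MappingPath.const f.hom)
  let p : TopCat.of (MappingPath f.hom) ⟶ Y := TopCat.ofHom (MappingPath.p f.hom)
  have hp := TopCat.rlp_toSSet_map p hf.surjective_mappingPath fun k φ => hf.hasLifts φ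
  have h₁ : QuasiIso (natSingularChains.map i) := quasiIso_natSingularChains_const f
  have h₂ : QuasiIso (natSingularChains.map p) := SSet.quasiIso_chainComplexMap_of_rlp _ hp _
  have e : f = i ≫ p := rfl
  rw [e, Functor.map_comp]
  infer_instance

/-! ## Elements of simplicial chain complexes -/

namespace SSet

open Simplicial Opposite

/-- Simplicial chains with integral coefficients. -/
abbrev intChains (S : SSet.{u}) : ChainComplex AddCommGrpCat.{u} ℕ :=
  S.chainComplex (AddCommGrpCat.of (ULift.{u} ℤ))

/-- The map on simplicial chains induced by a morphism. -/
abbrev intChainsMap {S T : SSet.{u}} (f : S ⟶ T) : S.intChains ⟶ T.intChains :=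
  chainComplexMap f (AddCommGrpCat.of (ULift.{u} ℤ))

variable {S T : SSet.{u}} {n : ℕ}

/-- The inclusion of the summand given by a simplex. -/
abbrev genHom (x : S _⦋n⦌) : AddCommGrpCat.of (ULift.{u} ℤ) ⟶ S.intChains.X n :=
  S.ιChainComplex x

/-- The generator of the group of chains given by a simplex. -/
def gen (x : S _⦋n⦌) : S.intChains.X n := (genHom x).hom (ULift.up (1 : ℤ))

lemma intChains_hom_ext {A : Type u} [AddCommGroup A] {φ ψ : S.intChains.X n →+ A}
    (h : ∀ x : S _⦋n⦌, φ (gen x) = ψ (gen x)) : φ = ψ := by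
  suffices AddCommGrpCat.ofHom φ = AddCommGrpCat.ofHom ψ from
    congrArg AddCommGrpCat.Hom.hom this
  apply chainComplex_hom_ext
  intro x
  apply AddCommGrpCat.hom_ext
  let e : ℤ →+ (ULift.{u} ℤ) := AddEquiv.ulift.symm.toAddMonoidHom
  have key : (φ.comp (genHom x).hom).comp e = (ψ.comp (genHom x).hom).comp e :=
    AddMonoidHom.ext_int (h x)
  ext ⟨k⟩
  exact DFunLike.congr_fun key k

/-- Homomorphisms out of a group of chains, given by values on simplices. -/
def liftChains {A : Type u} [AddCommGroup A] (φ : S _⦋n⦌ → A) : S.intChains.X n →+ A :=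
  AddCommGrpCat.Hom.hom (Y := AddCommGrpCat.of A) (Sigma.desc (f := fun _ : S _⦋n⦌ =>
    AddCommGrpCat.of (ULift.{u} ℤ)) (P := AddCommGrpCat.of A) fun x =>
      AddCommGrpCat.ofHom (((zmultiplesHom A) (φ x)).comp AddEquiv.ulift.toAddMonoidHom))

@[simp]
lemma liftChains_gen {A : Type u} [AddCommGroup A] (φ : S _⦋n⦌ → A) (x : S _⦋n⦌) :
    liftChains φ (gen x) = φ x := by
  have := Sigma.ι_desc (f := fun _ : S _⦋n⦌ =>
    AddCommGrpCat.of (ULift.{u} ℤ)) (P := AddCommGrpCat.of A) (fun x =>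
      AddCommGrpCat.ofHom (((zmultiplesHom A) (φ x)).comp AddEquiv.ulift.toAddMonoidHom)) x
  refine (ConcreteCategory.congr_hom this (ULift.up (1 : ℤ))).trans ?_
  exact one_zsmul (φ x)

/-- The quotient map by the generated subgroup kills every generator, hence is zero. -/
lemma closure_range_gen (S : SSet.{u}) (n : ℕ) :
    AddSubgroup.closure (Set.range (gen : S _⦋n⦌ → S.intChains.X n)) = ⊤ := by
  have h : QuotientAddGroup.mk' (AddSubgroup.closure (Set.range (gen : S _⦋n⦌ → _))) = 0 :=
    intChains_hom_ext fun x => by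
      rw [AddMonoidHom.zero_apply, QuotientAddGroup.mk'_apply, QuotientAddGroup.eq_zero_iff]
      exact AddSubgroup.subset_closure ⟨x, rfl⟩
  rw [← QuotientAddGroup.ker_mk' (AddSubgroup.closure _), h]
  exact AddMonoidHom.ker_zero

lemma d_gen (x : S _⦋n + 1⦌) :
    S.intChains.d (n + 1) n (gen x) = ∑ i : Fin (n + 2), (-1 : ℤ) ^ i.val • gen (S.δ i x) := by
  have := ιChainComplex_d S (AddCommGrpCat.of (ULift.{u} ℤ)) x
  refine (ConcreteCategory.congr_hom this (ULift.up (1 : ℤ))).trans ?_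
  let ev : (AddCommGrpCat.of (ULift.{u} ℤ) ⟶ S.intChains.X n) →+ S.intChains.X n :=
    AddMonoidHom.mk' (fun f => f.hom (ULift.up (1 : ℤ))) fun _ _ => rfl
  change ev (∑ i : Fin (n + 2), (-1 : ℤ) ^ i.val • S.ιChainComplex (S.δ i x)) = _
  rw [map_sum]
  exact Finset.sum_congr rfl fun i _ => map_zsmul ev _ _

@[simp]
lemma intChainsMap_gen (f : S ⟶ T) (x : S _⦋n⦌) :
    (intChainsMap f).f n (gen x) = gen (f.app _ x) :=
  ConcreteCategory.congr_hom (ι_chainComplexMap_f _ _ f (AddCommGrpCat.of (ULift.{u} ℤ)) x)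
    (ULift.up (1 : ℤ))

end SSet

/-! ## Barycentric subdivision of formal affine chains -/

/-- Formal chains of tuples of points, with an augmentation: the degree is the number of
vertices. -/
abbrev TupleChains (P : Type*) (n : ℕ) : Type _ := FreeAbelianGroup (Fin n → P)

namespace TupleChains

open FreeAbelianGroup

variable {P Q : Type*} {n : ℕ}

/-- The boundary. -/
def d : TupleChains P (n + 1) →+ TupleChains P n :=
  lift fun v => ∑ i : Fin (n + 1), (-1 : ℤ) ^ i.val • of (v ∘ i.succAbove)

lemma d_of (v : Fin (n + 1) → P) :
    d (of v) = ∑ i : Fin (n + 1), (-1 : ℤ) ^ i.val • of (v ∘ i.succAbove) :=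
  lift_apply_of _ _

/-- The cone with a given apex. -/
def cone (p : P) : TupleChains P n →+ TupleChains P (n + 1) := lift fun v => of (Fin.cons p v)

@[simp] lemma cone_of (p : P) (v : Fin n → P) : cone p (of v) = of (Fin.cons p v) :=
  lift_apply_of _ _

/-- The map induced by a map of vertices. -/
def map (φ : P → Q) : TupleChains P n →+ TupleChains Q n := lift fun v => of (φ ∘ v)

@[simp] lemma map_of (φ : P → Q) (v : Fin n → P) : map φ (of v) = of (φ ∘ v) :=
  lift_apply_of _ _

/-- In the bottom degree of the augmented complex there is no boundary of `c`, hence no correction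
term as in `d_cone`. -/
lemma d_cone_zero (p : P) (c : TupleChains P 0) : d (cone p c) = c := by
  have : d.comp (cone p) = AddMonoidHom.id (TupleChains P 0) := by
    ext v
    simp only [AddMonoidHom.comp_apply, cone_of, d_of, AddMonoidHom.id_apply]
    rw [Fin.sum_univ_succ, Fin.sum_univ_zero, add_zero, Fin.val_zero, pow_zero, one_smul]
    congr 1
  exact DFunLike.congr_fun this c

lemma cons_comp_succAbove_succ (p : P) (v : Fin (n + 1) → P) (j : Fin (n + 1)) :
    (Fin.cons p v : Fin (n + 2) → P) ∘ j.succ.succAbove = Fin.cons p (v ∘ j.succAbove) := by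
  funext k
  cases k using Fin.cases with
  | zero => simp
  | succ k => simp

lemma d_cone (p : P) (c : TupleChains P (n + 1)) : d (cone p c) = c - cone p (d c) := by
  have : d.comp (cone p) = AddMonoidHom.id (TupleChains P (n + 1)) - (cone p).comp d := by
    ext v
    simp only [AddMonoidHom.comp_apply, cone_of, d_of, AddMonoidHom.id_apply,
      AddMonoidHom.sub_apply, map_sum, map_zsmul]
    rw [Fin.sum_univ_succ, Fin.val_zero, pow_zero, one_smul, sub_eq_add_neg,
      ← Finset.sum_neg_distrib]
    congr 1
    refine Finset.sum_congr rfl fun j _ => ?_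
    rw [cons_comp_succAbove_succ, Fin.val_succ, pow_succ, mul_neg_one, neg_smul]
  exact DFunLike.congr_fun this c

/-- Every nonempty tuple is the cone on its tail, so the cone formula and induction replace the
usual sign cancellation. -/
lemma d_d : ∀ {n : ℕ} (c : TupleChains P (n + 2)), d (d c) = 0 := by
  suffices ∀ n, (d.comp d : TupleChains P (n + 2) →+ TupleChains P n) = 0 from
    fun {n} c => DFunLike.congr_fun (this n) c
  intro n
  induction n with
  | zero =>
    ext v
    rw [AddMonoidHom.comp_apply, ← Fin.cons_self_tail v, ← cone_of, d_cone, map_sub, d_cone_zero,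
      sub_self, AddMonoidHom.zero_apply]
  | succ n ih =>
    ext v
    rw [AddMonoidHom.comp_apply, ← Fin.cons_self_tail v, ← cone_of, d_cone, map_sub, d_cone,
      ← AddMonoidHom.comp_apply d d, ih]
    simp

lemma map_d (φ : P → Q) (c : TupleChains P (n + 1)) : map φ (d c) = d (map φ c) := by
  have : (map φ).comp d = d.comp (map φ : TupleChains P (n + 1) →+ _) := by
    ext v
    simp [d_of, Function.comp_assoc]
  exact DFunLike.congr_fun this c

lemma map_cone (φ : P → Q) (p : P) (c : TupleChains P n) :
    map φ (cone p c) = cone (φ p) (map φ c) := by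
  have : (map φ).comp (cone p) = (cone (φ p)).comp (map φ : TupleChains P n →+ _) := by
    ext v
    simp only [AddMonoidHom.comp_apply, cone_of, map_of]
    congr 1
    exact Fin.comp_cons φ p v
  exact DFunLike.congr_fun this c

/-- An operation associating a point with any non-empty tuple of points. -/
abbrev Center (P : Type*) : Type _ := ∀ n : ℕ, (Fin (n + 1) → P) → P

variable (b : Center P)

/-- The barycentric subdivision. -/
def subdiv : ∀ n : ℕ, TupleChains P n →+ TupleChains P n
  | 0 => AddMonoidHom.id _
  | n + 1 => lift fun v => cone (b n v) (subdiv n (d (of v)))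

/-- The homotopy from the identity to the barycentric subdivision. -/
def subdivHomotopy : ∀ n : ℕ, TupleChains P n →+ TupleChains P (n + 1)
  | 0 => 0
  | n + 1 => lift fun v => cone (b n v) (of v - subdivHomotopy n (d (of v)))

lemma subdiv_succ_of (v : Fin (n + 1) → P) :
    subdiv b (n + 1) (of v) = cone (b n v) (subdiv b n (d (of v))) :=
  lift_apply_of _ _

lemma subdivHomotopy_succ_of (v : Fin (n + 1) → P) :
    subdivHomotopy b (n + 1) (of v) =
      cone (b n v) (of v - subdivHomotopy b n (d (of v))) :=
  lift_apply_of _ _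

/-- By the cone formula the error term is a cone on d(Sd(dv)), which is Sd(ddv) = 0 by induction. -/
lemma d_subdiv : ∀ {n : ℕ} (c : TupleChains P (n + 1)),
    d (subdiv b (n + 1) c) = subdiv b n (d c) := by
  suffices ∀ n, d.comp (subdiv b (n + 1)) = (subdiv b n).comp d from
    fun {n} c => DFunLike.congr_fun (this n) c
  intro n
  induction n with
  | zero =>
    ext v
    rw [AddMonoidHom.comp_apply, subdiv_succ_of, d_cone_zero, AddMonoidHom.comp_apply]
  | succ n ih =>
    ext v
    rw [AddMonoidHom.comp_apply, subdiv_succ_of, d_cone, AddMonoidHom.comp_apply,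
      ← AddMonoidHom.comp_apply d (subdiv b (n + 1)), ih, AddMonoidHom.comp_apply, d_d, map_zero,
      map_zero, sub_zero]

lemma d_subdivHomotopy_zero (c : TupleChains P 1) :
    d (subdivHomotopy b 1 c) + subdivHomotopy b 0 (d c) = c - subdiv b 1 c := by
  have : d.comp (subdivHomotopy b 1) + (subdivHomotopy b 0).comp d =
      AddMonoidHom.id _ - subdiv b 1 := by
    ext v
    simp only [AddMonoidHom.add_apply, AddMonoidHom.comp_apply, subdivHomotopy_succ_of,
      AddMonoidHom.sub_apply, AddMonoidHom.id_apply, subdiv_succ_of, d_cone]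
    simp [subdivHomotopy, subdiv]
  exact DFunLike.congr_fun this c

/-- Write H for the homotopy. By induction d(v - H(dv)) = Sd(dv), whose cone is Sd(v), so the cone
formula gives d(H(v)) = v - H(dv) - Sd(v). -/
lemma d_subdivHomotopy : ∀ {n : ℕ} (c : TupleChains P (n + 1)),
    d (subdivHomotopy b (n + 1) c) + subdivHomotopy b n (d c) = c - subdiv b (n + 1) c := by
  suffices ∀ n, d.comp (subdivHomotopy b (n + 1)) + (subdivHomotopy b n).comp d =
      AddMonoidHom.id _ - subdiv b (n + 1) from
    fun {n} c => DFunLike.congr_fun (this n) c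
  intro n
  induction n with
  | zero =>
    ext v
    exact d_subdivHomotopy_zero b (of v)
  | succ n ih =>
    ext v
    have h := DFunLike.congr_fun ih (d (of v))
    simp only [AddMonoidHom.add_apply, AddMonoidHom.comp_apply, AddMonoidHom.sub_apply,
      AddMonoidHom.id_apply, d_d, map_zero, add_zero] at h
    simp only [AddMonoidHom.add_apply, AddMonoidHom.comp_apply, subdivHomotopy_succ_of,
      AddMonoidHom.sub_apply, AddMonoidHom.id_apply, subdiv_succ_of, d_cone, map_sub, h]
    abel

variable {b}

lemma map_subdiv {b' : Center Q} {φ : P → Q} (h : ∀ n v, φ (b n v) = b' n (φ ∘ v)) :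
    ∀ {n : ℕ} (c : TupleChains P n), map φ (subdiv b n c) = subdiv b' n (map φ c) := by
  suffices ∀ n, (map φ).comp (subdiv b n) = (subdiv b' n).comp (map φ) from
    fun {n} c => DFunLike.congr_fun (this n) c
  intro n
  induction n with
  | zero => rfl
  | succ n ih =>
    ext v
    rw [AddMonoidHom.comp_apply, subdiv_succ_of, map_cone, ← AddMonoidHom.comp_apply (map φ), ih,
      AddMonoidHom.comp_apply, map_d, AddMonoidHom.comp_apply, map_of, subdiv_succ_of, h]

lemma map_subdivHomotopy {b' : Center Q} {φ : P → Q} (h : ∀ n v, φ (b n v) = b' n (φ ∘ v)) :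
    ∀ {n : ℕ} (c : TupleChains P n),
      map φ (subdivHomotopy b n c) = subdivHomotopy b' n (map φ c) := by
  suffices ∀ n, (map φ).comp (subdivHomotopy b n) = (subdivHomotopy b' n).comp (map φ) from
    fun {n} c => DFunLike.congr_fun (this n) c
  intro n
  induction n with
  | zero => ext v; simp [subdivHomotopy]
  | succ n ih =>
    ext v
    rw [AddMonoidHom.comp_apply, subdivHomotopy_succ_of, map_cone, map_sub,
      ← AddMonoidHom.comp_apply (map φ) (subdivHomotopy b n), ih,
      AddMonoidHom.comp_apply, map_d, AddMonoidHom.comp_apply, map_of, subdivHomotopy_succ_of, h]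

section Metric

variable [PseudoMetricSpace P]

/-- The tuples obtained by subdividing a given tuple: their points belong to all balls containing
the given points, and have small distances from each other. -/
def SmallTuples (v : Fin n → P) (k : ℕ) (r : ℝ) : Set (Fin k → P) :=
  {w | (∀ (c : P) (s : ℝ), (∀ i, dist c (v i) ≤ s) → ∀ i, dist c (w i) ≤ s) ∧
    ∀ i j, dist (w i) (w j) ≤ r}

/-- Besides the mesh, the induction tracks that new vertices stay in every ball containing the old
ones. Since `h₂` puts all old vertices within `n / (n + 1) * r` of the apex, this bounds the
distances from the apex to the subdivided faces. -/
lemma subdiv_mem_closure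
    (h₁ : ∀ n (v : Fin (n + 1) → P) (c : P) (s : ℝ), (∀ i, dist c (v i) ≤ s) →
      dist c (b n v) ≤ s)
    (h₂ : ∀ n (v : Fin (n + 1) → P) (s : ℝ), (∀ i j, dist (v i) (v j) ≤ s) →
      ∀ j, dist (b n v) (v j) ≤ n / (n + 1) * s)
    {q r : ℝ} (hr : 0 ≤ r) (hq : 0 ≤ q) :
    ∀ (n : ℕ) (v : Fin n → P), (n - 1 : ℝ) / n ≤ q → (∀ i j, dist (v i) (v j) ≤ r) →
      subdiv b n (of v) ∈ AddSubgroup.closure (of '' SmallTuples v n (q * r)) := by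
  intro n
  induction n with
  | zero =>
    intro v _ _
    exact AddSubgroup.subset_closure ⟨v, ⟨fun _ _ _ i => i.elim0, fun i => i.elim0⟩, rfl⟩
  | succ n ih =>
    intro v hn hv
    have hqr : 0 ≤ q * r := mul_nonneg hq hr
    have hn' : (n : ℝ) / (n + 1) ≤ q := by simpa using hn
    have hn'' : (n - 1 : ℝ) / n ≤ q := by
      refine le_trans ?_ hn'
      -- For `n = 0` the quotient has denominator zero and equals 0 by convention.
      rcases n.eq_zero_or_pos with rfl | hn0
      · simp
      · have : (0 : ℝ) < n := by exact_mod_cast hn0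
        rw [div_le_div_iff₀ this (by linarith)]
        nlinarith
    rw [subdiv_succ_of, d_of, map_sum, map_sum]
    refine AddSubgroup.sum_mem _ fun i _ => ?_
    rw [map_zsmul, map_zsmul]
    refine AddSubgroup.zsmul_mem _ ?_ _
    have h := ih (v ∘ i.succAbove) hn'' fun j k => hv _ _
    have h' := AddSubgroup.mem_map_of_mem (cone (b n v)) h
    rw [AddMonoidHom.map_closure] at h'
    refine AddSubgroup.closure_mono ?_ h'
    rintro _ ⟨_, ⟨w, ⟨hw₁, hw₂⟩, rfl⟩, rfl⟩
    rw [cone_of]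
    have hbw (j) : dist (b n v) (w j) ≤ q * r :=
      hw₁ _ _ (fun j => (h₂ n v r hv _).trans (mul_le_mul_of_nonneg_right hn' hr)) j
    refine ⟨_, ⟨fun c s hs j => ?_, fun j k => ?_⟩, rfl⟩
    · cases j using Fin.cases with
      | zero => exact h₁ n v c s hs
      | succ j => exact hw₁ c s (fun j => hs _) j
    · cases j using Fin.cases with
      | zero =>
        cases k using Fin.cases with
        | zero => simpa using hqr
        | succ k => exact hbw k
      | succ j =>
        cases k using Fin.cases with
        | zero => exact (dist_comm _ _).trans_le (hbw j)
        | succ k => exact hw₂ j k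

lemma iterate_subdiv_mem_closure
    (h₁ : ∀ n (v : Fin (n + 1) → P) (c : P) (s : ℝ), (∀ i, dist c (v i) ≤ s) →
      dist c (b n v) ≤ s)
    (h₂ : ∀ n (v : Fin (n + 1) → P) (s : ℝ), (∀ i j, dist (v i) (v j) ≤ s) →
      ∀ j, dist (b n v) (v j) ≤ n / (n + 1) * s)
    {r : ℝ} (hr : 0 ≤ r) (n : ℕ) (v : Fin (n + 1) → P) (hv : ∀ i j, dist (v i) (v j) ≤ r) (k : ℕ) :
      (subdiv b (n + 1))^[k] (of v) ∈ AddSubgroup.closure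
        (of '' {w | ∀ i j, dist (w i) (w j) ≤ (n / (n + 1) : ℝ) ^ k * r}) := by
  induction k with
  | zero =>
    refine AddSubgroup.subset_closure ⟨v, fun i j => ?_, rfl⟩
    simpa using hv i j
  | succ k ih =>
    rw [Function.iterate_succ_apply']
    have h' := AddSubgroup.mem_map_of_mem (subdiv b (n + 1)) ih
    rw [AddMonoidHom.map_closure] at h'
    refine (AddSubgroup.closure_le _).2 ?_ h'
    rintro _ ⟨_, ⟨w, hw, rfl⟩, rfl⟩
    have hq : (0 : ℝ) ≤ n / (n + 1) := by positivity
    refine AddSubgroup.closure_mono ?_ (subdiv_mem_closure h₁ h₂ (q := n / (n + 1))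
      (mul_nonneg (pow_nonneg hq k) hr) hq (n + 1) w (by simp) hw)
    refine Set.image_mono fun w' hw' i j => (hw'.2 i j).trans_eq ?_
    rw [pow_succ]
    ring

end Metric

end TupleChains

/-! ## Affine maps between simplices -/

namespace stdSimplex

variable {ι κ μ : Type*} [Fintype ι] [Fintype κ] [Fintype μ]

/-- The affine map given by the images of the vertices. -/
def affineMap (v : ι → stdSimplex ℝ κ) : C(stdSimplex ℝ ι, stdSimplex ℝ κ) where
  toFun t := ⟨∑ i, t i • (v i : κ → ℝ),
    (convex_stdSimplex ℝ κ).sum_mem (fun i _ => t.2.1 i) t.2.2 fun i _ => (v i).2⟩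
  continuous_toFun := by
    refine Continuous.subtype_mk (continuous_finsetSum _ fun i _ => ?_) _
    exact ((continuous_apply i).comp continuous_subtype_val).smul continuous_const

lemma affineMap_apply (v : ι → stdSimplex ℝ κ) (t : stdSimplex ℝ ι) (j : κ) :
    affineMap v t j = ∑ i, t i * v i j := by
  change (∑ i, t i • (v i : κ → ℝ)) j = _
  rw [Finset.sum_apply]
  rfl

lemma affineMap_affineMap (v : ι → stdSimplex ℝ κ) (w : μ → stdSimplex ℝ ι) (t : stdSimplex ℝ μ) :
    affineMap v (affineMap w t) = affineMap (fun i => affineMap v (w i)) t := by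
  refine stdSimplex.ext (funext fun j => ?_)
  simp only [affineMap_apply, Finset.sum_mul, Finset.mul_sum, mul_assoc]
  exact Finset.sum_comm

lemma affineMap_map (v : ι → stdSimplex ℝ κ) (f : μ → ι) (t : stdSimplex ℝ μ) :
    affineMap v (map f t) = affineMap (v ∘ f) t := by
  classical
  refine stdSimplex.ext (funext fun j => ?_)
  simp only [affineMap_apply, map_coe, FunOnFinite.linearMap_apply_apply, Finset.sum_mul]
  rw [← Finset.sum_fiberwise Finset.univ f]
  refine Finset.sum_congr rfl fun i _ => Finset.sum_congr rfl fun k hk => ?_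
  rw [Function.comp_apply, (Finset.mem_filter.1 hk).2]

variable [DecidableEq ι]

lemma affineMap_vertex (v : ι → stdSimplex ℝ κ) (i : ι) : affineMap v (vertex i) = v i := by
  refine stdSimplex.ext (funext fun j => ?_)
  rw [affineMap_apply, Finset.sum_eq_single i]
  · simp
  · intro k _ hk
    simp [hk]
  · simp

lemma affineMap_vertex_eq_id : affineMap (vertex : ι → stdSimplex ℝ ι) = ContinuousMap.id _ := by
  ext t j
  rw [affineMap_apply, Finset.sum_eq_single j]
  · simp
  · intro k _ hk
    simp [hk.symm]
  · simp

lemma dist_affineMap_le (v : ι → stdSimplex ℝ κ) (t : stdSimplex ℝ ι) (c : stdSimplex ℝ κ) :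
    dist c (affineMap v t) ≤ ∑ i, t i * dist c (v i) := by
  refine (dist_pi_le_iff (Finset.sum_nonneg fun i _ =>
    mul_nonneg (zero_le t i) dist_nonneg)).2 fun j => ?_
  have e : c j - affineMap v t j = ∑ i, t i * (c j - v i j) := by
    rw [affineMap_apply]
    simp only [mul_sub, Finset.sum_sub_distrib, ← Finset.sum_mul]
    rw [sum_eq_one t, one_mul]
  change |c j - affineMap v t j| ≤ _
  rw [e]
  refine (Finset.abs_sum_le_sum_abs _ _).trans (Finset.sum_le_sum fun i _ => ?_)
  rw [abs_mul, abs_of_nonneg (zero_le t i)]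
  exact mul_le_mul_of_nonneg_left (dist_le_pi_dist (c : κ → ℝ) (v i : κ → ℝ) j) (zero_le t i)

lemma dist_affineMap_le_of_forall {v : ι → stdSimplex ℝ κ} {c : stdSimplex ℝ κ} {s : ℝ}
    (h : ∀ i, dist c (v i) ≤ s) (t : stdSimplex ℝ ι) : dist c (affineMap v t) ≤ s := by
  refine (dist_affineMap_le v t c).trans ((Finset.sum_le_sum fun i _ =>
    mul_le_mul_of_nonneg_left (h i) (zero_le t i)).trans ?_)
  rw [← Finset.sum_mul, sum_eq_one t, one_mul]

variable (κ) in
/-- The barycenters of tuples of points of a simplex. -/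
def center : TupleChains.Center (stdSimplex ℝ κ) := fun _ v => affineMap v barycenter

lemma affineMap_center (v : ι → stdSimplex ℝ κ) (n : ℕ) (w : Fin (n + 1) → stdSimplex ℝ ι) :
    affineMap v (center ι n w) = center κ n (affineMap v ∘ w) :=
  affineMap_affineMap _ _ _

/-- The distance from `v j` to the barycenter is at most the average of its distances to the `n + 1`
vertices, and one of these distances is zero. -/
lemma dist_center_le (n : ℕ) (v : Fin (n + 1) → stdSimplex ℝ κ) (s : ℝ)
    (h : ∀ i j, dist (v i) (v j) ≤ s) (j : Fin (n + 1)) :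
    dist (center κ n v) (v j) ≤ n / (n + 1) * s := by
  rw [dist_comm]
  refine (dist_affineMap_le _ _ _).trans ?_
  have h1 (i : Fin (n + 1)) : (barycenter : stdSimplex ℝ (Fin (n + 1))) i = (n + 1 : ℝ)⁻¹ := by
    refine (barycenter_apply i).trans ?_
    simp
  simp only [h1]
  rw [← Finset.mul_sum, Fin.sum_univ_succAbove _ j, dist_self, zero_add, div_mul_eq_mul_div,
    inv_mul_eq_div]
  refine div_le_div_of_nonneg_right ?_ (by positivity)
  refine (Finset.sum_le_sum fun i _ => h j (j.succAbove i)).trans ?_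
  simp

end stdSimplex

/-! ## Barycentric subdivision of singular chains -/

namespace TopCat

open SSet Simplicial Opposite

variable {X : TopCat.{u}} {n m : ℕ}

/-- The generator of the group of singular chains given by a singular simplex. -/
def singGen (τ : C(stdSimplex ℝ (Fin (n + 1)), X)) : (toSSet.obj X).intChains.X n :=
  gen ((toSSetObjEquiv X (op ⦋n⦌)).symm τ)

lemma singGen_toSSetObjEquiv (x : toSSet.obj X _⦋n⦌) :
    singGen (toSSetObjEquiv X (op ⦋n⦌) x) = gen x :=
  congrArg gen (Equiv.symm_apply_apply _ _)

lemma sing_hom_ext {A : Type u} [AddCommGroup A] {φ ψ : (toSSet.obj X).intChains.X n →+ A}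
    (h : ∀ τ : C(stdSimplex ℝ (Fin (n + 1)), X), φ (singGen τ) = ψ (singGen τ)) : φ = ψ :=
  intChains_hom_ext fun x => by rw [← singGen_toSSetObjEquiv, h]

/-- Homomorphisms out of a group of singular chains, given by values on simplices. -/
def liftSing {A : Type u} [AddCommGroup A] (φ : C(stdSimplex ℝ (Fin (n + 1)), X) → A) :
    (toSSet.obj X).intChains.X n →+ A :=
  liftChains fun x => φ (toSSetObjEquiv X (op ⦋n⦌) x)

@[simp]
lemma liftSing_singGen {A : Type u} [AddCommGroup A] (φ : C(stdSimplex ℝ (Fin (n + 1)), X) → A)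
    (τ : C(stdSimplex ℝ (Fin (n + 1)), X)) : liftSing φ (singGen τ) = φ τ := by
  rw [liftSing, singGen, liftChains_gen, Equiv.apply_symm_apply]

variable (X) in
/-- The boundary of singular chains. -/
def singD (n : ℕ) : (toSSet.obj X).intChains.X (n + 1) →+ (toSSet.obj X).intChains.X n :=
  ((toSSet.obj X).intChains.d (n + 1) n).hom

lemma singD_singGen (τ : C(stdSimplex ℝ (Fin (n + 2)), X)) :
    singD X n (singGen τ) = ∑ i : Fin (n + 2), (-1 : ℤ) ^ i.val •
      singGen (τ.comp ⟨stdSimplex.map i.succAbove, stdSimplex.continuous_map _⟩) :=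
  d_gen _

/-- The singular chain given by a chain of tuples of points of the standard simplex and
a singular simplex. -/
def realize (τ : C(stdSimplex ℝ (Fin (m + 1)), X)) (n : ℕ) :
    TupleChains (stdSimplex ℝ (Fin (m + 1))) (n + 1) →+ (toSSet.obj X).intChains.X n :=
  FreeAbelianGroup.lift fun v => singGen (τ.comp (stdSimplex.affineMap v))

@[simp]
lemma realize_of (τ : C(stdSimplex ℝ (Fin (m + 1)), X))
    (v : Fin (n + 1) → stdSimplex ℝ (Fin (m + 1))) :
    realize τ n (FreeAbelianGroup.of v) = singGen (τ.comp (stdSimplex.affineMap v)) :=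
  FreeAbelianGroup.lift_apply_of _ _

lemma realize_vertex (τ : C(stdSimplex ℝ (Fin (n + 1)), X)) :
    realize τ n (FreeAbelianGroup.of stdSimplex.vertex) = singGen τ := by
  rw [realize_of, stdSimplex.affineMap_vertex_eq_id, ContinuousMap.comp_id]

lemma singD_realize (τ : C(stdSimplex ℝ (Fin (m + 1)), X))
    (c : TupleChains (stdSimplex ℝ (Fin (m + 1))) (n + 2)) :
    singD X n (realize τ (n + 1) c) = realize τ n (TupleChains.d c) := by
  have : (singD X n).comp (realize τ (n + 1)) = (realize τ n).comp TupleChains.d := by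
    ext v
    simp only [AddMonoidHom.comp_apply, realize_of, singD_singGen, TupleChains.d_of, map_sum,
      map_zsmul]
    refine Finset.sum_congr rfl fun i _ => ?_
    congr 2
    ext t
    exact congrArg τ (stdSimplex.affineMap_map v i.succAbove t)
  exact DFunLike.congr_fun this c

lemma realize_comp_affineMap {k : ℕ} (τ : C(stdSimplex ℝ (Fin (m + 1)), X))
    (v : Fin (k + 1) → stdSimplex ℝ (Fin (m + 1)))
    (c : TupleChains (stdSimplex ℝ (Fin (k + 1))) (n + 1)) :
    realize (τ.comp (stdSimplex.affineMap v)) n c =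
      realize τ n (TupleChains.map (stdSimplex.affineMap v) c) := by
  have : realize (τ.comp (stdSimplex.affineMap v)) n =
      (realize τ n).comp (TupleChains.map (stdSimplex.affineMap v)) := by
    ext w
    simp only [AddMonoidHom.comp_apply, realize_of, TupleChains.map_of]
    congr 1
    ext t
    exact congrArg τ (stdSimplex.affineMap_affineMap v w t)
  exact DFunLike.congr_fun this c

open TupleChains in
/-- The barycentric subdivision of singular chains. -/
def singSubdiv (X : TopCat.{u}) (n : ℕ) :
    (toSSet.obj X).intChains.X n →+ (toSSet.obj X).intChains.X n :=
  liftSing fun τ => realize τ n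
    (subdiv (stdSimplex.center _) (n + 1) (FreeAbelianGroup.of stdSimplex.vertex))

open TupleChains in
/-- The homotopy from the identity to the barycentric subdivision of singular chains. -/
def singHomotopy (X : TopCat.{u}) (n : ℕ) :
    (toSSet.obj X).intChains.X n →+ (toSSet.obj X).intChains.X (n + 1) :=
  liftSing fun τ => realize τ (n + 1)
    (subdivHomotopy (stdSimplex.center _) (n + 1) (FreeAbelianGroup.of stdSimplex.vertex))

/-- Affine maps preserve barycenters, so subdivision commutes with realization. Identities for
singular chains thus reduce to those for formal tuples. -/
lemma singSubdiv_realize (τ : C(stdSimplex ℝ (Fin (m + 1)), X))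
    (c : TupleChains (stdSimplex ℝ (Fin (m + 1))) (n + 1)) :
    singSubdiv X n (realize τ n c) =
      realize τ n (TupleChains.subdiv (stdSimplex.center _) (n + 1) c) := by
  have : (singSubdiv X n).comp (realize τ n) =
      (realize τ n).comp (TupleChains.subdiv (stdSimplex.center _) (n + 1)) := by
    ext v
    rw [AddMonoidHom.comp_apply, realize_of, singSubdiv, liftSing_singGen, realize_comp_affineMap,
      TupleChains.map_subdiv (stdSimplex.affineMap_center v), TupleChains.map_of,
      AddMonoidHom.comp_apply]
    rw [show stdSimplex.affineMap v ∘ stdSimplex.vertex = v from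
      funext (stdSimplex.affineMap_vertex v)]
  exact DFunLike.congr_fun this c

lemma singHomotopy_realize (τ : C(stdSimplex ℝ (Fin (m + 1)), X))
    (c : TupleChains (stdSimplex ℝ (Fin (m + 1))) (n + 1)) :
    singHomotopy X n (realize τ n c) =
      realize τ (n + 1) (TupleChains.subdivHomotopy (stdSimplex.center _) (n + 1) c) := by
  have : (singHomotopy X n).comp (realize τ n) =
      (realize τ (n + 1)).comp (TupleChains.subdivHomotopy (stdSimplex.center _) (n + 1)) := by
    ext v
    rw [AddMonoidHom.comp_apply, realize_of, singHomotopy, liftSing_singGen,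
      realize_comp_affineMap, TupleChains.map_subdivHomotopy (stdSimplex.affineMap_center v),
      TupleChains.map_of, AddMonoidHom.comp_apply]
    rw [show stdSimplex.affineMap v ∘ stdSimplex.vertex = v from
      funext (stdSimplex.affineMap_vertex v)]
  exact DFunLike.congr_fun this c

lemma singD_singSubdiv (c : (toSSet.obj X).intChains.X (n + 1)) :
    singD X n (singSubdiv X (n + 1) c) = singSubdiv X n (singD X n c) := by
  have : (singD X n).comp (singSubdiv X (n + 1)) = (singSubdiv X n).comp (singD X n) :=
    sing_hom_ext fun τ => by
      rw [AddMonoidHom.comp_apply, AddMonoidHom.comp_apply, ← realize_vertex, singSubdiv_realize,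
        singD_realize, singD_realize, singSubdiv_realize, TupleChains.d_subdiv]
  exact DFunLike.congr_fun this c

lemma singD_singHomotopy_zero (c : (toSSet.obj X).intChains.X 0) :
    singD X 0 (singHomotopy X 0 c) = c - singSubdiv X 0 c := by
  have : (singD X 0).comp (singHomotopy X 0) = AddMonoidHom.id _ - singSubdiv X 0 :=
    sing_hom_ext fun τ => by
      have h := TupleChains.d_subdivHomotopy (stdSimplex.center (Fin 1))
        (FreeAbelianGroup.of (stdSimplex.vertex : Fin 1 → stdSimplex ℝ (Fin 1)))
      rw [show TupleChains.subdivHomotopy (stdSimplex.center (Fin 1)) 0 = 0 from rfl,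
        AddMonoidHom.zero_apply, add_zero] at h
      rw [AddMonoidHom.comp_apply, AddMonoidHom.sub_apply, AddMonoidHom.id_apply,
        ← realize_vertex, singHomotopy_realize, singSubdiv_realize, singD_realize, h, map_sub]
  exact DFunLike.congr_fun this c

lemma singD_singHomotopy (c : (toSSet.obj X).intChains.X (n + 1)) :
    singD X (n + 1) (singHomotopy X (n + 1) c) + singHomotopy X n (singD X n c) =
      c - singSubdiv X (n + 1) c := by
  have : (singD X (n + 1)).comp (singHomotopy X (n + 1)) + (singHomotopy X n).comp (singD X n) =
      AddMonoidHom.id _ - singSubdiv X (n + 1) :=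
    sing_hom_ext fun τ => by
      rw [AddMonoidHom.add_apply, AddMonoidHom.comp_apply, AddMonoidHom.comp_apply,
        AddMonoidHom.sub_apply, AddMonoidHom.id_apply, ← realize_vertex, singHomotopy_realize,
        singSubdiv_realize, singD_realize, singD_realize, singHomotopy_realize, ← map_add,
        TupleChains.d_subdivHomotopy, map_sub]
  exact DFunLike.congr_fun this c

end TopCat

/-! ## Small singular chains -/

namespace TopCat

open SSet Simplicial Opposite

variable {X : TopCat.{u}} {ι : Type*} (O : ι → Set X)

/-- The singular simplices whose image is contained in a member of a family of subsets. -/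
def smallSimplices (n : ℕ) : Set C(stdSimplex ℝ (Fin (n + 1)), X) :=
  {τ | ∃ i, ∀ t, τ t ∈ O i}

/-- The chains generated by small singular simplices. -/
def smallChains (n : ℕ) : AddSubgroup ((toSSet.obj X).intChains.X n) :=
  AddSubgroup.closure (singGen '' smallSimplices O n)

variable {O}

lemma realize_mem_smallChains {m : ℕ} {τ : C(stdSimplex ℝ (Fin (m + 1)), X)}
    (hτ : τ ∈ smallSimplices O m) (n : ℕ)
    (c : TupleChains (stdSimplex ℝ (Fin (m + 1))) (n + 1)) : realize τ n c ∈ smallChains O n := by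
  obtain ⟨i, hi⟩ := hτ
  induction c using FreeAbelianGroup.induction_on with
  | zero => rw [map_zero]; exact zero_mem _
  | of v =>
    rw [realize_of]
    exact AddSubgroup.subset_closure ⟨_, ⟨i, fun t => hi _⟩, rfl⟩
  | neg v h => rw [map_neg]; exact neg_mem h
  | add x y hx hy => rw [map_add]; exact add_mem hx hy

lemma singSubdiv_mem_smallChains {n : ℕ} {c : (toSSet.obj X).intChains.X n}
    (hc : c ∈ smallChains O n) : singSubdiv X n c ∈ smallChains O n := by
  have : smallChains O n ≤ (smallChains O n).comap (singSubdiv X n) := by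
    refine (AddSubgroup.closure_le _).2 ?_
    rintro _ ⟨τ, hτ, rfl⟩
    change singSubdiv X n (singGen τ) ∈ smallChains O n
    rw [singSubdiv, liftSing_singGen]
    exact realize_mem_smallChains hτ _ _
  exact this hc

lemma singHomotopy_mem_smallChains {n : ℕ} {c : (toSSet.obj X).intChains.X n}
    (hc : c ∈ smallChains O n) : singHomotopy X n c ∈ smallChains O (n + 1) := by
  have : smallChains O n ≤ (smallChains O (n + 1)).comap (singHomotopy X n) := by
    refine (AddSubgroup.closure_le _).2 ?_
    rintro _ ⟨τ, hτ, rfl⟩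
    change singHomotopy X n (singGen τ) ∈ smallChains O (n + 1)
    rw [singHomotopy, liftSing_singGen]
    exact realize_mem_smallChains hτ _ _
  exact this hc

lemma iterate_singSubdiv_mem_smallChains {n k : ℕ} {c : (toSSet.obj X).intChains.X n}
    (hc : c ∈ smallChains O n) : (singSubdiv X n)^[k] c ∈ smallChains O n := by
  induction k with
  | zero => exact hc
  | succ k ih =>
    rw [Function.iterate_succ_apply']
    exact singSubdiv_mem_smallChains ih

lemma iterate_singSubdiv_realize {m n : ℕ} (τ : C(stdSimplex ℝ (Fin (m + 1)), X))
    (c : TupleChains (stdSimplex ℝ (Fin (m + 1))) (n + 1)) (k : ℕ) :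
    (singSubdiv X n)^[k] (realize τ n c) =
      realize τ n ((TupleChains.subdiv (stdSimplex.center _) (n + 1))^[k] c) := by
  induction k with
  | zero => rfl
  | succ k ih => rw [Function.iterate_succ_apply', ih, singSubdiv_realize,
      Function.iterate_succ_apply']

lemma singD_iterate_singSubdiv {n : ℕ} (c : (toSSet.obj X).intChains.X (n + 1)) (k : ℕ) :
    singD X n ((singSubdiv X (n + 1))^[k] c) = (singSubdiv X n)^[k] (singD X n c) := by
  induction k with
  | zero => rfl
  | succ k ih => rw [Function.iterate_succ_apply', singD_singSubdiv, ih,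
      Function.iterate_succ_apply']

/-- Iterated subdivisions of a singular chain are small. -/
lemma eventually_iterate_singSubdiv_mem (hO : ∀ i, IsOpen (O i)) (hO' : ⋃ i, O i = Set.univ)
    {n : ℕ} (c : (toSSet.obj X).intChains.X n) :
    ∀ᶠ k in Filter.atTop, (singSubdiv X n)^[k] c ∈ smallChains O n := by
  have hc : c ∈ AddSubgroup.closure (Set.range (gen : toSSet.obj X _⦋n⦌ → _)) := by
    rw [closure_range_gen]
    trivial
  induction hc using AddSubgroup.closure_induction with
  | zero => simp [iterate_map_zero, zero_mem]
  | add x y _ _ hx hy =>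
    filter_upwards [hx, hy] with k hx hy
    rw [iterate_map_add]
    exact add_mem hx hy
  | neg x _ hx =>
    filter_upwards [hx] with k hx
    rw [iterate_map_neg]
    exact neg_mem hx
  | mem c hc =>
    obtain ⟨x, rfl⟩ := hc
    rw [← singGen_toSSetObjEquiv]
    let τ : C(stdSimplex ℝ (Fin (n + 1)), X) := toSSetObjEquiv X (op ⦋n⦌) x
    change ∀ᶠ k in Filter.atTop, (singSubdiv X n)^[k] (singGen τ) ∈ smallChains O n
    -- The mesh of the `k`-th subdivision is at most `(n / (n + 1)) ^ k`, since the simplex has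
    -- diameter at most 1. Once this is below a Lebesgue number of the pulled back cover, each piece
    -- lies in the ball around its vertex `w 0`.
    obtain ⟨δ, hδ, h⟩ := lebesgue_number_lemma_of_metric
      (isCompact_univ (X := stdSimplex ℝ (Fin (n + 1))))
      (c := fun i => τ ⁻¹' O i) (fun i => (hO i).preimage τ.continuous)
      (fun t _ => by
        have : τ t ∈ ⋃ i, O i := hO' ▸ Set.mem_univ _
        rwa [← Set.preimage_iUnion])
    have hv (i j : Fin (n + 1)) : dist (stdSimplex.vertex (S := ℝ) i) (stdSimplex.vertex j) ≤ 1 :=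
      (Metric.dist_le_diam_of_mem (bounded_stdSimplex (Fin (n + 1)))
        (stdSimplex.vertex i).2 (stdSimplex.vertex j).2).trans diam_stdSimplex_le
    have hlim : Filter.Tendsto (fun k : ℕ => (n / (n + 1) : ℝ) ^ k) Filter.atTop (𝓝 0) :=
      tendsto_pow_atTop_nhds_zero_of_lt_one (by positivity) (by
        rw [div_lt_one (by positivity)]
        linarith)
    filter_upwards [hlim.eventually (gt_mem_nhds hδ)] with k hk
    rw [← realize_vertex, iterate_singSubdiv_realize]
    have h1 := AddSubgroup.mem_map_of_mem (realize τ n)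
      (TupleChains.iterate_subdiv_mem_closure (b := stdSimplex.center (Fin (n + 1)))
        (fun n v c s hs => stdSimplex.dist_affineMap_le_of_forall hs _)
        stdSimplex.dist_center_le zero_le_one n stdSimplex.vertex hv k)
    rw [AddMonoidHom.map_closure] at h1
    refine AddSubgroup.closure_mono ?_ h1
    rintro _ ⟨_, ⟨w, hw, rfl⟩, rfl⟩
    rw [realize_of]
    obtain ⟨i, hi⟩ := h (w 0) (Set.mem_univ _)
    refine ⟨τ.comp (stdSimplex.affineMap w), ⟨i, fun t => hi ?_⟩, rfl⟩
    rw [Metric.mem_ball']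
    refine (stdSimplex.dist_affineMap_le_of_forall (fun j => hw 0 j) t).trans_lt ?_
    rwa [mul_one]

lemma exists_sub_sub_mem_zero (c : (toSSet.obj X).intChains.X 0) (k : ℕ) :
    ∃ w, c - singD X 0 w - (singSubdiv X 0)^[k] c ∈ smallChains O 0 := by
  induction k with
  | zero => exact ⟨0, by simp [zero_mem]⟩
  | succ k ih =>
    obtain ⟨w, hw⟩ := ih
    refine ⟨w + singHomotopy X 0 ((singSubdiv X 0)^[k] c), ?_⟩
    rw [map_add, singD_singHomotopy_zero, Function.iterate_succ_apply']
    convert hw using 1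
    abel

/-- Summing c' - Sd(c') = d(H(c')) + H(d(c')) over the iterates c' of `c` yields boundaries and
terms H(d(c')), which are small because d(c) is small and both Sd and H preserve smallness. -/
lemma exists_sub_sub_mem_succ {n : ℕ} {c : (toSSet.obj X).intChains.X (n + 1)}
    (hc : singD X n c ∈ smallChains O n) (k : ℕ) :
    ∃ w, c - singD X (n + 1) w - (singSubdiv X (n + 1))^[k] c ∈ smallChains O (n + 1) := by
  induction k with
  | zero => exact ⟨0, by simp [zero_mem]⟩
  | succ k ih =>
    obtain ⟨w, hw⟩ := ih
    refine ⟨w + singHomotopy X (n + 1) ((singSubdiv X (n + 1))^[k] c), ?_⟩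
    have h1 := singD_singHomotopy ((singSubdiv X (n + 1))^[k] c)
    rw [singD_iterate_singSubdiv] at h1
    have h2 : singHomotopy X n ((singSubdiv X n)^[k] (singD X n c)) ∈ smallChains O (n + 1) :=
      singHomotopy_mem_smallChains (iterate_singSubdiv_mem_smallChains hc)
    rw [map_add, eq_sub_of_add_eq h1, Function.iterate_succ_apply']
    convert add_mem hw h2 using 1
    abel

/-- Any singular chain of dimension zero is homologous to a small chain. -/
lemma exists_sub_mem_smallChains_zero (hO : ∀ i, IsOpen (O i)) (hO' : ⋃ i, O i = Set.univ)
    (c : (toSSet.obj X).intChains.X 0) : ∃ w, c - singD X 0 w ∈ smallChains O 0 := by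
  obtain ⟨k, hk⟩ := (eventually_iterate_singSubdiv_mem hO hO' c).exists
  obtain ⟨w, hw⟩ := exists_sub_sub_mem_zero (O := O) c k
  exact ⟨w, by simpa using add_mem hw hk⟩

/-- Any singular chain with small boundary is homologous to a small chain. -/
lemma exists_sub_mem_smallChains_succ (hO : ∀ i, IsOpen (O i)) (hO' : ⋃ i, O i = Set.univ)
    {n : ℕ} {c : (toSSet.obj X).intChains.X (n + 1)} (hc : singD X n c ∈ smallChains O n) :
    ∃ w, c - singD X (n + 1) w ∈ smallChains O (n + 1) := by
  obtain ⟨k, hk⟩ := (eventually_iterate_singSubdiv_mem hO hO' c).exists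
  obtain ⟨w, hw⟩ := exists_sub_sub_mem_succ hc k
  exact ⟨w, by simpa using add_mem hw hk⟩

end TopCat

/-! ## Elementwise criteria for complexes of abelian groups -/

namespace HomologicalComplex

variable {ι ι' : Type*} {c : ComplexShape ι} {c' : ComplexShape ι'}

/-- In a short exact sequence of complexes, the first map is a quasi-isomorphism if the third
complex is acyclic. -/
lemma quasiIso_f_of_acyclic {S : ShortComplex (HomologicalComplex AddCommGrpCat.{u} c)}
    (hS : S.ShortExact) (hc : ∀ j, ∃ i, c.Rel i j) (h : S.X₃.Acyclic) : QuasiIso S.f := by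
  rw [quasiIso_iff]
  intro j
  rw [quasiIsoAt_iff_isIso_homologyMap]
  obtain ⟨i, hij⟩ := hc j
  have h' (k : ι) : IsZero (S.X₃.homology k) := (exactAt_iff_isZero_homology _ _).1 (h k)
  have : Epi (homologyMap S.f j) := (hS.homology_exact₂ j).epi_f ((h' j).eq_of_tgt _ _)
  have : Mono (homologyMap S.f j) := (hS.homology_exact₁ i j hij).mono_g ((h' i).eq_of_src _ _)
  exact isIso_of_mono_of_epi _

lemma f_surjective_of_epi {K L : HomologicalComplex AddCommGrpCat.{u} c} (φ : K ⟶ L) [Epi φ]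
    (n : ι) : Function.Surjective (φ.f n) :=
  (AddCommGrpCat.epi_iff_surjective _).1 inferInstance

/-- A criterion for the inclusion of a subcomplex to be a quasi-isomorphism. -/
lemma quasiIso_of_forall_exists {K L : ChainComplex AddCommGrpCat.{u} ℕ} (j : K ⟶ L) [Mono j]
    (h₀ : ∀ z : L.X 0, ∃ (w : L.X 1) (a : K.X 0), z - L.d 1 0 w = j.f 0 a)
    (h : ∀ (n : ℕ) (z : L.X (n + 1)), (∃ b, L.d (n + 1) n z = j.f n b) →
      ∃ (w : L.X (n + 2)) (a : K.X (n + 1)), z - L.d (n + 2) (n + 1) w = j.f (n + 1) a) :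
    QuasiIso j := by
  let S : ShortComplex (ChainComplex AddCommGrpCat.{u} ℕ) :=
    ShortComplex.mk j (cokernel.π j) (cokernel.condition j)
  have hS : S.ShortExact :=
    { exact := S.exact_of_g_is_cokernel (cokernelIsCokernel j) }
  have hπ (n : ℕ) (x : L.X n) (hx : (cokernel.π j).f n x = 0) : ∃ a, j.f n a = x := by
    have := hS.exact.map (eval _ _ n)
    rw [ShortComplex.ab_exact_iff] at this
    exact this x hx
  have hπ' (n : ℕ) (a : K.X n) : (cokernel.π j).f n (j.f n a) = 0 := by
    have := congrArg (fun φ => φ.f n) (cokernel.condition j)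
    exact ConcreteCategory.congr_hom this a
  have hd (n m : ℕ) (x : L.X n) :
      (cokernel.π j).f m (L.d n m x) = (cokernel j).d n m ((cokernel.π j).f n x) :=
    (ConcreteCategory.congr_hom ((cokernel.π j).comm n m) x).symm
  -- The hypotheses say exactly that cycles of the quotient by `K` bound: a cycle there is
  -- represented by a chain with boundary in `K`.
  refine quasiIso_f_of_acyclic hS (fun j => ⟨j + 1, rfl⟩) fun n => ?_
  rcases n with _ | n
  -- The index following 0 is 0 itself by convention, with zero differential, so every element of
  -- degree 0 is a cycle.
  · rw [exactAt_iff' _ 1 0 0 (by simp) (by simp), ShortComplex.ab_exact_iff]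
    intro x _
    obtain ⟨z, rfl⟩ := f_surjective_of_epi (cokernel.π j) 0 x
    obtain ⟨w, a, hw⟩ := h₀ z
    refine ⟨(cokernel.π j).f 1 w, ?_⟩
    refine (hd _ _ _).symm.trans ?_
    rw [eq_comm, ← sub_eq_zero, ← map_sub, hw, hπ']
  · rw [exactAt_iff' _ (n + 2) (n + 1) n (by simp) (by simp), ShortComplex.ab_exact_iff]
    intro x hx
    obtain ⟨z, rfl⟩ := f_surjective_of_epi (cokernel.π j) (n + 1) x
    obtain ⟨b, hb⟩ := hπ n (L.d (n + 1) n z) ((hd _ _ _).trans hx)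
    obtain ⟨w, a, hw⟩ := h n z ⟨b, hb.symm⟩
    refine ⟨(cokernel.π j).f (n + 2) w, ?_⟩
    refine (hd _ _ _).symm.trans ?_
    rw [eq_comm, ← sub_eq_zero, ← map_sub, hw, hπ']

/-- The short exactness of the sequence attached to a square, in terms of elements. -/
structure ElementwiseExact {A B C D : HomologicalComplex AddCommGrpCat.{u} c} (f : A ⟶ B)
    (g : A ⟶ C) (p : B ⟶ D) (q : C ⟶ D) : Prop where
  injective (n : ι) (a : A.X n) : f.f n a = 0 → g.f n a = 0 → a = 0
  exact (n : ι) (b : B.X n) (c : C.X n) : p.f n b = q.f n c → ∃ a, f.f n a = b ∧ g.f n a = c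
  surjective (n : ι) (d : D.X n) : ∃ b c, d = p.f n b - q.f n c

variable {A B C D : HomologicalComplex AddCommGrpCat.{u} c} {f : A ⟶ B} {g : A ⟶ C}
  {p : B ⟶ D} {q : C ⟶ D}

lemma ElementwiseExact.shortExact (h : ElementwiseExact f g p q) (sq : CommSq f g p q) :
    sq.shortComplex'.ShortExact := by
  have e {X Y Z : HomologicalComplex AddCommGrpCat.{u} c} {α : X ⟶ Y} {β : Y ⟶ Z} {γ : X ⟶ Z}
      (w : α ≫ β = γ) (n : ι) (x : X.X n) : β.f n (α.f n x) = γ.f n x :=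
    ConcreteCategory.congr_hom (congrArg (fun φ => φ.f n) w) x
  have hneg (n : ι) (x : C.X n) : (-q).f n x = -q.f n x := rfl
  have tot (n : ι) (x : (B ⊞ C).X n) : x = (biprod.inl : B ⟶ B ⊞ C).f n
      ((biprod.fst : B ⊞ C ⟶ B).f n x) + (biprod.inr : C ⟶ B ⊞ C).f n
      ((biprod.snd : B ⊞ C ⟶ C).f n x) := by
    have := congrArg (fun φ => φ.f n) (biprod.total (X := B) (Y := C))
    exact (ConcreteCategory.congr_hom this x).symm
  have hl (n : ι) (a : A.X n) : (biprod.lift f g).f n a =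
      (biprod.inl : B ⟶ B ⊞ C).f n (f.f n a) + (biprod.inr : C ⟶ B ⊞ C).f n (g.f n a) := by
    conv_lhs => rw [tot n ((biprod.lift f g).f n a), e (biprod.lift_fst f g),
      e (biprod.lift_snd f g)]
  refine shortExact_of_degreewise_shortExact _ fun n => ?_
  refine ShortComplex.ShortExact.mk' ?_ ?_ ?_
  · rw [ShortComplex.ab_exact_iff]
    intro x hx
    have hx' : (biprod.desc p (-q)).f n x = 0 := hx
    rw [tot n x, map_add, e (biprod.inl_desc p (-q)), e (biprod.inr_desc p (-q)), hneg] at hx'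
    obtain ⟨a, h1, h2⟩ := h.exact n _ _ (add_neg_eq_zero.1 hx')
    refine ⟨a, (hl n a).trans ?_⟩
    rw [h1, h2]
    exact (tot n x).symm
  · rw [AddCommGrpCat.mono_iff_injective, injective_iff_map_eq_zero]
    intro (a : A.X n) ha
    have ha' : (biprod.lift f g).f n a = 0 := ha
    refine h.injective n a ?_ ?_
    · exact (e (biprod.lift_fst f g) n a).symm.trans ((congrArg _ ha').trans (map_zero _))
    · exact (e (biprod.lift_snd f g) n a).symm.trans ((congrArg _ ha').trans (map_zero _))
  · rw [AddCommGrpCat.epi_iff_surjective]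
    intro d
    obtain ⟨b, c, hd⟩ := h.surjective n d
    refine ⟨(biprod.inl : B ⟶ B ⊞ C).f n b + (biprod.inr : C ⟶ B ⊞ C).f n c, ?_⟩
    change (biprod.desc p (-q)).f n _ = d
    rw [map_add, e (biprod.inl_desc p (-q)), e (biprod.inr_desc p (-q)), hneg, hd,
      sub_eq_add_neg]

/-- Degrees in the image of `e` reproduce the original complexes up to isomorphism; in all others
every term is zero. -/
lemma ElementwiseExact.extendMap (h : ElementwiseExact f g p q) (e : c.Embedding c') :
    ElementwiseExact (extendMap f e) (extendMap g e) (extendMap p e) (extendMap q e) := by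
  have key {X Y : HomologicalComplex AddCommGrpCat.{u} c} (φ : X ⟶ Y) (i : ι)
      (x : (X.extend e).X (e.f i)) :
      (extendXIso Y e rfl).hom ((HomologicalComplex.extendMap φ e).f (e.f i) x) =
        φ.f i ((extendXIso X e rfl).hom x) := by
    rw [extendMap_f φ e rfl]
    exact ConcreteCategory.congr_hom (show (extendXIso X e rfl).hom ≫ φ.f i ≫
      (extendXIso Y e rfl).inv ≫ (extendXIso Y e rfl).hom =
        (extendXIso X e rfl).hom ≫ φ.f i by simp) x
  have inj {X : HomologicalComplex AddCommGrpCat.{u} c} (i : ι) :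
      Function.Injective (extendXIso X e (rfl : e.f i = e.f i)).hom :=
    (AddCommGrpCat.mono_iff_injective _).1 inferInstance
  have surj {X : HomologicalComplex AddCommGrpCat.{u} c} (i : ι) :
      Function.Surjective (extendXIso X e (rfl : e.f i = e.f i)).hom :=
    (AddCommGrpCat.epi_iff_surjective _).1 inferInstance
  have sub {X : HomologicalComplex AddCommGrpCat.{u} c} {n : ι'} (hn : ∀ i, e.f i ≠ n)
      (x y : (X.extend e).X n) : x = y :=
    ConcreteCategory.congr_hom ((X.isZero_extend_X e n hn).eq_of_src (𝟙 _) 0) x |>.trans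
      (ConcreteCategory.congr_hom ((X.isZero_extend_X e n hn).eq_of_src (𝟙 _) 0) y).symm
  refine ⟨fun n a ha ha' => ?_, fun n b c hbc => ?_, fun n d => ?_⟩
  all_goals by_cases hn : ∃ i, e.f i = n
  · obtain ⟨i, rfl⟩ := hn
    refine inj i ((h.injective i _ ?_ ?_).trans (map_zero _).symm)
    · rw [← key, ha, map_zero]
    · rw [← key, ha', map_zero]
  · exact sub (fun i hi => hn ⟨i, hi⟩) _ _
  · obtain ⟨i, rfl⟩ := hn
    obtain ⟨a, h1, h2⟩ := h.exact i ((extendXIso B e rfl).hom b) ((extendXIso C e rfl).hom c)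
      (by rw [← key, hbc, key])
    obtain ⟨a, rfl⟩ := surj i a
    exact ⟨a, inj i (by rw [key, h1]), inj i (by rw [key, h2])⟩
  · exact ⟨0, sub (fun i hi => hn ⟨i, hi⟩) _ _, sub (fun i hi => hn ⟨i, hi⟩) _ _⟩
  · obtain ⟨i, rfl⟩ := hn
    obtain ⟨b, c, hd⟩ := h.surjective i ((extendXIso D e rfl).hom d)
    obtain ⟨b, rfl⟩ := surj i b
    obtain ⟨c, rfl⟩ := surj i c
    exact ⟨b, c, inj i (by rw [map_sub, key, key, hd])⟩
  · exact ⟨0, 0, sub (fun i hi => hn ⟨i, hi⟩) _ _⟩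

end HomologicalComplex

/-! ## The Mayer-Vietoris short exact sequence -/

namespace TopCat

open SSet Simplicial Opposite

/-- The map induced on singular chains. -/
abbrev singMap {X Y : TopCat.{u}} (f : X ⟶ Y) :
    (toSSet.obj X).intChains ⟶ (toSSet.obj Y).intChains :=
  intChainsMap (toSSet.map f)

section

variable {X Y Z : TopCat.{u}} {n : ℕ}

@[simp]
lemma singMap_singGen (f : X ⟶ Y) (τ : C(stdSimplex ℝ (Fin (n + 1)), X)) :
    (singMap f).f n (singGen τ) = singGen (f.hom.comp τ) :=
  intChainsMap_gen _ _

lemma singMap_comp_apply (f : X ⟶ Y) (g : Y ⟶ Z) (c : (toSSet.obj X).intChains.X n) :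
    (singMap g).f n ((singMap f).f n c) = (singMap (f ≫ g)).f n c := by
  have : ((singMap g).f n).hom.comp ((singMap f).f n).hom = ((singMap (f ≫ g)).f n).hom :=
    sing_hom_ext fun τ => by
      refine (congrArg ((singMap g).f n) (singMap_singGen f τ)).trans ?_
      refine (singMap_singGen g _).trans (Eq.symm ?_)
      exact singMap_singGen (f ≫ g) τ
  exact DFunLike.congr_fun this c

/-- A left inverse sends a simplex that factors through `f` to its unique factorization, and any
other simplex to zero. -/
lemma singMap_injective {f : X ⟶ Y} (hf : Function.Injective f) :
    Function.Injective ((singMap f).f n) := by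
  classical
  let r : (toSSet.obj Y).intChains.X n →+ (toSSet.obj X).intChains.X n :=
    liftSing fun τ => if h : ∃ τ', f.hom.comp τ' = τ then singGen h.choose else 0
  have : r.comp ((singMap f).f n).hom = AddMonoidHom.id _ := sing_hom_ext fun τ => by
    have h : ∃ τ', f.hom.comp τ' = f.hom.comp τ := ⟨τ, rfl⟩
    have h' : h.choose = τ :=
      ContinuousMap.ext fun t => hf (DFunLike.congr_fun h.choose_spec t)
    refine (congrArg r (singMap_singGen f τ)).trans ?_
    simp only [r, liftSing_singGen, AddMonoidHom.id_apply]
    rw [dif_pos h, h']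
  exact Function.LeftInverse.injective (DFunLike.congr_fun this)

end

variable {X : TopCat.{u}}

section

variable {ι : Type*} (O : ι → Set X)

lemma d_mem_smallChains (i j : ℕ) {c : (toSSet.obj X).intChains.X i} (hc : c ∈ smallChains O i) :
    (toSSet.obj X).intChains.d i j c ∈ smallChains O j := by
  by_cases hij : j + 1 = i
  · subst hij
    have : smallChains O (j + 1) ≤ (smallChains O j).comap (singD X j) := by
      refine (AddSubgroup.closure_le _).2 ?_
      rintro _ ⟨τ, ⟨k, hk⟩, rfl⟩
      change singD X j (singGen τ) ∈ smallChains O j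
      rw [singD_singGen]
      refine sum_mem fun i _ => zsmul_mem ?_ _
      exact AddSubgroup.subset_closure ⟨_, ⟨k, fun t => hk _⟩, rfl⟩
    exact this hc
  · rw [(toSSet.obj X).intChains.shape i j hij]
    exact zero_mem _

/-- The complex of small singular chains. -/
def smallComplex : ChainComplex AddCommGrpCat.{u} ℕ where
  X n := AddCommGrpCat.of (smallChains O n)
  d i j := AddCommGrpCat.ofHom ((((toSSet.obj X).intChains.d i j).hom.comp
    (smallChains O i).subtype).codRestrict (smallChains O j) fun c => d_mem_smallChains O i j c.2)
  shape i j hij := by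
    ext c
    exact (ConcreteCategory.congr_hom ((toSSet.obj X).intChains.shape i j hij) c.1)
  d_comp_d' i j k _ _ := by
    ext c
    exact (ConcreteCategory.congr_hom
      ((toSSet.obj X).intChains.d_comp_d i j k) c.1)

/-- The inclusion of the complex of small singular chains. -/
def smallι : smallComplex O ⟶ (toSSet.obj X).intChains where
  f n := AddCommGrpCat.ofHom (smallChains O n).subtype
  comm' _ _ _ := rfl

instance : Mono (smallι O) := by
  have (n : ℕ) : Mono ((smallι O).f n) :=
    (AddCommGrpCat.mono_iff_injective _).2 Subtype.val_injective
  exact HomologicalComplex.mono_of_mono_f _ this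

/-- The inclusion of small singular chains for an open cover is a quasi-isomorphism. -/
theorem quasiIso_smallι (hO : ∀ i, IsOpen (O i)) (hO' : ⋃ i, O i = Set.univ) :
    QuasiIso (smallι O) := by
  refine HomologicalComplex.quasiIso_of_forall_exists _ (fun z => ?_) fun n z => ?_
  · obtain ⟨w, hw⟩ := exists_sub_mem_smallChains_zero hO hO' z
    exact ⟨w, ⟨_, hw⟩, rfl⟩
  · rintro ⟨b, hb⟩
    obtain ⟨w, hw⟩ := exists_sub_mem_smallChains_succ hO hO' (c := z)
      (show (toSSet.obj X).intChains.d (n + 1) n z ∈ _ from hb ▸ b.2)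
    exact ⟨w, ⟨_, hw⟩, rfl⟩

variable {O}

/-- The inclusion of a subspace. -/
def incl (S : Set X) : TopCat.of S ⟶ X := ofHom ⟨Subtype.val, continuous_subtype_val⟩

/-- The inclusion of a subspace in another one. -/
def inclLE {S T : Set X} (h : S ⊆ T) : TopCat.of S ⟶ TopCat.of T :=
  ofHom ⟨Set.inclusion h, continuous_inclusion h⟩

lemma incl_injective (S : Set X) : Function.Injective (incl S) := Subtype.val_injective

lemma inclLE_injective {S T : Set X} (h : S ⊆ T) : Function.Injective (inclLE h) :=
  Set.inclusion_injective h

lemma inclLE_incl {S T : Set X} (h : S ⊆ T) : inclLE h ≫ incl T = incl S := rfl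

/-- The restriction of a singular simplex to a subspace containing its image. -/
def restrictSimplex {n : ℕ} (S : Set X) (τ : C(stdSimplex ℝ (Fin (n + 1)), X))
    (h : ∀ t, τ t ∈ S) : C(stdSimplex ℝ (Fin (n + 1)), TopCat.of S) :=
  ⟨fun t => ⟨τ t, h t⟩, by fun_prop⟩

lemma singMap_incl_mem (i : ι) (n : ℕ) (c : (toSSet.obj (TopCat.of (O i))).intChains.X n) :
    (singMap (incl (O i))).f n c ∈ smallChains O n := by
  have hc : c ∈ AddSubgroup.closure (Set.range (gen : toSSet.obj _ _⦋n⦌ → _)) := by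
    rw [closure_range_gen]
    trivial
  induction hc using AddSubgroup.closure_induction with
  | zero => rw [map_zero]; exact zero_mem _
  | add x y _ _ hx hy => rw [map_add]; exact add_mem hx hy
  | neg x _ hx => rw [map_neg]; exact neg_mem hx
  | mem x hx =>
    obtain ⟨x, rfl⟩ := hx
    rw [← singGen_toSSetObjEquiv, singMap_singGen]
    exact AddSubgroup.subset_closure ⟨_, ⟨i, fun t => ((toSSetObjEquiv _ _ x) t).2⟩, rfl⟩

/-- The map from singular chains of a member of the cover to small chains. -/
def toSmall (i : ι) : (toSSet.obj (TopCat.of (O i))).intChains ⟶ smallComplex O where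
  f n := AddCommGrpCat.ofHom (((singMap (incl (O i))).f n).hom.codRestrict (smallChains O n)
    (singMap_incl_mem i n))
  comm' j k _ := by
    ext c
    exact Subtype.ext (ConcreteCategory.congr_hom ((singMap (incl (O i))).comm j k) c)

lemma toSmall_smallι (i : ι) : toSmall i ≫ smallι O = singMap (incl (O i)) := rfl

end

section Pair

/-- The projection `ρ` keeps only the simplices lying in `T`. It fixes chains coming from `T` and
sends chains from `S` into those of the intersection, via `r`; a chain coming from both is therefore
the image of `r b`. -/
lemma exists_of_singMap_incl_eq {S T : Set X} {n : ℕ}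
    (b : (toSSet.obj (TopCat.of S)).intChains.X n) (c : (toSSet.obj (TopCat.of T)).intChains.X n)
    (h : (singMap (incl S)).f n b = (singMap (incl T)).f n c) :
    ∃ a : (toSSet.obj (TopCat.of (S ∩ T : Set X))).intChains.X n,
      (singMap (inclLE Set.inter_subset_left)).f n a = b ∧
        (singMap (inclLE Set.inter_subset_right)).f n a = c := by
  classical
  let r : (toSSet.obj (TopCat.of S)).intChains.X n →+
      (toSSet.obj (TopCat.of (S ∩ T : Set X))).intChains.X n :=
    liftSing fun τ => if h : ∀ t, (τ t : X) ∈ T then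
      singGen (restrictSimplex _ ((incl S).hom.comp τ) fun t => ⟨(τ t).2, h t⟩) else 0
  let ρ : (toSSet.obj X).intChains.X n →+ (toSSet.obj X).intChains.X n :=
    liftSing fun τ => if ∀ t, (τ t : X) ∈ T then singGen τ else 0
  have h₁ : ρ.comp ((singMap (incl T)).f n).hom = ((singMap (incl T)).f n).hom :=
    sing_hom_ext fun τ => by
      refine (congrArg ρ (singMap_singGen _ τ)).trans (Eq.trans ?_ (singMap_singGen _ τ).symm)
      simp only [ρ, liftSing_singGen]
      exact if_pos fun t => (τ t).2
  have h₂ : ρ.comp ((singMap (incl S)).f n).hom =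
      ((singMap (incl (S ∩ T))).f n).hom.comp r :=
    sing_hom_ext fun τ => by
      refine (congrArg ρ (singMap_singGen _ τ)).trans ?_
      simp only [ρ, r, liftSing_singGen, AddMonoidHom.comp_apply]
      split_ifs with h1 h2 h2
      · exact (singMap_singGen (incl (S ∩ T)) (restrictSimplex _ ((incl S).hom.comp τ) _)).symm
      · exact absurd h1 h2
      · exact absurd h2 h1
      · exact (map_zero _).symm
  have h₃ : (singMap (incl S)).f n b = (singMap (incl (S ∩ T))).f n (r b) := by
    refine Eq.trans ?_ (DFunLike.congr_fun h₂ b)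
    refine Eq.trans ?_ (congrArg ρ h).symm
    exact h.trans (DFunLike.congr_fun h₁ c).symm
  refine ⟨r b, singMap_injective (incl_injective S) ?_, singMap_injective (incl_injective T) ?_⟩
  · rw [singMap_comp_apply, inclLE_incl, h₃]
  · rw [singMap_comp_apply, inclLE_incl, ← h, h₃]

/-- The family of two subsets. -/
abbrev pairFamily (S T : Set X) : Bool → Set X := fun b => if b then S else T

lemma exists_eq_sub_of_mem_smallChains {S T : Set X} {n : ℕ} {d : (toSSet.obj X).intChains.X n}
    (hd : d ∈ smallChains (pairFamily S T) n) : ∃ (b : (toSSet.obj (TopCat.of S)).intChains.X n)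
      (c : (toSSet.obj (TopCat.of T)).intChains.X n),
      d = (singMap (incl S)).f n b - (singMap (incl T)).f n c := by
  induction hd using AddSubgroup.closure_induction with
  | zero => exact ⟨0, 0, by simp⟩
  | add x y _ _ hx hy =>
    obtain ⟨b, c, rfl⟩ := hx
    obtain ⟨b', c', rfl⟩ := hy
    refine ⟨b + b', c + c', ?_⟩
    rw [map_add, map_add]
    abel
  | neg x _ hx =>
    obtain ⟨b, c, rfl⟩ := hx
    refine ⟨-b, -c, ?_⟩
    rw [map_neg, map_neg]
    abel
  | mem x hx =>
    -- The case `false`, standing for `T`, comes first; the sign there offsets the minus in the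
    -- difference.
    obtain ⟨τ, ⟨_ | _, hi⟩, rfl⟩ := hx
    · refine ⟨0, -singGen (restrictSimplex T τ hi), ?_⟩
      rw [map_neg, map_zero, singMap_singGen, zero_sub, neg_neg]
      rfl
    · refine ⟨singGen (restrictSimplex S τ hi), 0, ?_⟩
      rw [map_zero, singMap_singGen, sub_zero]
      rfl

/-- The Mayer-Vietoris sequence of small chains. -/
lemma elementwiseExact_small (S T : Set X) :
    HomologicalComplex.ElementwiseExact
      (singMap (inclLE (Set.inter_subset_left : S ∩ T ⊆ S)))
      (singMap (inclLE (Set.inter_subset_right : S ∩ T ⊆ T)))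
      (toSmall (O := pairFamily S T) true) (toSmall (O := pairFamily S T) false) where
  injective n a ha _ := singMap_injective (inclLE_injective _) (ha.trans (map_zero _).symm)
  exact n b c h := exists_of_singMap_incl_eq b c (congrArg Subtype.val h)
  surjective n d := by
    obtain ⟨b, c, h⟩ := exists_eq_sub_of_mem_smallChains d.2
    exact ⟨b, c, Subtype.ext h⟩

end Pair

end TopCat

/-! ## The geometry of the double mapping cylinder -/

namespace DoubleMappingCylinder

variable {W U V X : TopCat.{u}} (f : W ⟶ U) (g : W ⟶ V)

/-- The projection onto the double mapping cylinder. -/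
def proj : C(U ⊕ (W × I) ⊕ V, doubleMappingCylinder f g) := ⟨Quot.mk _, continuous_quot_mk⟩

lemma isQuotientMap_proj : Topology.IsQuotientMap (proj f g) := isQuotientMap_quot_mk

/-- The inclusion of the left end. -/
def left : C(U, doubleMappingCylinder f g) := (proj f g).comp ⟨Sum.inl, continuous_inl⟩

/-- The inclusion of the right end. -/
def right : C(V, doubleMappingCylinder f g) :=
  (proj f g).comp ⟨Sum.inr ∘ Sum.inr, continuous_inr.comp continuous_inr⟩

/-- The inclusion of the cylinder. -/
def middle : C(W × I, doubleMappingCylinder f g) :=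
  (proj f g).comp ⟨Sum.inr ∘ Sum.inl, continuous_inr.comp continuous_inl⟩

variable {f g}

lemma middle_zero (w : W) : middle f g (w, 0) = left f g (f w) :=
  (Quot.sound (Rel.left w)).symm

lemma middle_one (w : W) : middle f g (w, 1) = right f g (g w) := Quot.sound (Rel.right w)

lemma cases_point (x : doubleMappingCylinder f g) :
    (∃ u, x = left f g u) ∨ (∃ w t, x = middle f g (w, t)) ∨ ∃ v, x = right f g v := by
  obtain ⟨z, rfl⟩ := Quot.exists_rep x
  rcases z with u | ⟨w, t⟩ | v
  · exact Or.inl ⟨u, rfl⟩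
  · exact Or.inr (Or.inl ⟨w, t, rfl⟩)
  · exact Or.inr (Or.inr ⟨v, rfl⟩)

variable (f g)

/-- The height function. -/
def height : C(doubleMappingCylinder f g, I) where
  toFun := Quot.lift (Sum.elim (fun _ => 0) (Sum.elim Prod.snd fun _ => 1)) (by
    rintro _ _ (w | w) <;> rfl)
  continuous_toFun := continuous_quot_lift _ (by fun_prop)

variable {f g}

/-- Maps out of an open subspace of the double mapping cylinder. -/
lemma exists_desc {S : Set (doubleMappingCylinder f g)} (hS : IsOpen S) {E F : Type*}
    [TopologicalSpace E] [TopologicalSpace F] {i : E → F} (hi : Topology.IsEmbedding i)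
    (ρ : C(U ⊕ (W × I) ⊕ V, F)) (h₁ : ∀ z, proj f g z ∈ S → ρ z ∈ Set.range i)
    (h₂ : ∀ z z', Rel f g z z' → proj f g z ∈ S → ρ z = ρ z') :
    ∃ r : C(S, E), ∀ z (hz : proj f g z ∈ S), i (r ⟨proj f g z, hz⟩) = ρ z := by
  classical
  have key (z z') (hz : proj f g z ∈ S) (h : proj f g z = proj f g z') : ρ z = ρ z' := by
    -- Values over `S` are compared by descending to the whole quotient, with `none` off `S`; only
    -- the generating relations need checking.
    let ρ' : doubleMappingCylinder f g → Option F :=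
      Quot.lift (fun z => if proj f g z ∈ S then some (ρ z) else none) (by
        intro z z' h
        have e : proj f g z = proj f g z' := Quot.sound h
        rw [← e]
        split_ifs with h'
        · rw [h₂ z z' h h']
        · rfl)
    have e := congrArg ρ' h
    have e₁ : ρ' (proj f g z) = some (ρ z) := if_pos hz
    have e₂ : ρ' (proj f g z') = some (ρ z') := if_pos (h ▸ hz)
    rw [e₁, e₂] at e
    exact Option.some.inj e
  -- Openness of `S` is what keeps the restricted projection a quotient map.
  have hq : Topology.IsQuotientMap (S.restrictPreimage (proj f g)) :=
    (isQuotientMap_proj f g).restrictPreimage_isOpen hS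
  have hr (x : S) : ∃ y, ∀ z (hz : proj f g z ∈ S), (⟨proj f g z, hz⟩ : S) = x → i y = ρ z := by
    obtain ⟨⟨z, hz⟩, rfl⟩ := hq.surjective x
    obtain ⟨y, hy⟩ := h₁ z hz
    exact ⟨y, fun z' hz' e => hy.trans (key z z' hz (congrArg Subtype.val e).symm)⟩
  choose r hr using hr
  refine ⟨⟨r, ?_⟩, fun z hz => hr _ z hz rfl⟩
  rw [hq.continuous_iff, hi.continuous_iff]
  refine (ρ.continuous.comp continuous_subtype_val).congr fun z => ?_
  exact (hr _ z.1 z.2 rfl).symm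

/-- Linear interpolation between a function and the identity. -/
def interp (φ : C(I, I)) : C(I × I, I) where
  toFun z := ⟨(1 - z.2) * φ z.1 + z.2 * z.1, by
    have h₁ := z.2.2.1
    have h₂ : 0 ≤ 1 - (z.2 : ℝ) := sub_nonneg.2 z.2.2.2
    refine ⟨add_nonneg (mul_nonneg h₂ (φ z.1).2.1) (mul_nonneg h₁ z.1.2.1), ?_⟩
    have h₃ := mul_le_of_le_one_right h₂ (φ z.1).2.2
    have h₄ := mul_le_of_le_one_right h₁ z.1.2.2
    linarith⟩
  continuous_toFun := by fun_prop

lemma interp_zero (φ : C(I, I)) (t : I) : interp φ (t, 0) = φ t := Subtype.ext (by simp [interp])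

lemma interp_one (φ : C(I, I)) (t : I) : interp φ (t, 1) = t := Subtype.ext (by simp [interp])

lemma interp_eq (φ : C(I, I)) {t : I} (h : φ t = t) (s : I) : interp φ (t, s) = t :=
  Subtype.ext (by simp only [interp, ContinuousMap.coe_mk, h]; ring)

/-- The homotopy of the double mapping cylinder given by a reparametrization of the interval. -/
def reparam (φ : C(I, I)) (h₀ : φ 0 = 0) (h₁ : φ 1 = 1) :
    C(doubleMappingCylinder f g, C(I, doubleMappingCylinder f g)) where
  -- The time variable is curried into the target, so continuity follows from the quotient topology
  -- without examining its product with the interval.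
  toFun := Quot.lift (Sum.elim (fun u => ContinuousMap.const I (left f g u))
      (Sum.elim (((middle f g).comp ⟨fun z : (W × I) × I => (z.1.1, interp φ (z.1.2, z.2)),
        by fun_prop⟩).curry) fun v => ContinuousMap.const I (right f g v))) (by
    rintro _ _ (w | w)
    · ext s
      change left f g (f w) = middle f g (w, interp φ (0, s))
      rw [interp_eq φ h₀, middle_zero]
    · ext s
      change middle f g (w, interp φ (1, s)) = right f g (g w)
      rw [interp_eq φ h₁, middle_one])
  continuous_toFun := by
    refine continuous_quot_lift _ (Continuous.sumElim ?_ (Continuous.sumElim ?_ ?_))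
    · exact ContinuousMap.continuous_const'.comp (left f g).continuous
    · exact ContinuousMap.continuous _
    · exact ContinuousMap.continuous_const'.comp (right f g).continuous

section

variable (φ : C(I, I)) (h₀ : φ 0 = 0) (h₁ : φ 1 = 1)

@[simp] lemma reparam_middle (w : W) (t s : I) :
    reparam φ h₀ h₁ (middle f g (w, t)) s = middle f g (w, interp φ (t, s)) := rfl

lemma height_reparam (x : doubleMappingCylinder f g) (s : I) :
    height f g (reparam φ h₀ h₁ x s) = interp φ (height f g x, s) := by
  obtain ⟨u, rfl⟩ | ⟨w, t, rfl⟩ | ⟨v, rfl⟩ := cases_point x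
  · exact (interp_eq φ h₀ s).symm
  · rfl
  · exact (interp_eq φ h₁ s).symm

lemma reparam_one (x : doubleMappingCylinder f g) : reparam φ h₀ h₁ x 1 = x := by
  obtain ⟨u, rfl⟩ | ⟨w, t, rfl⟩ | ⟨v, rfl⟩ := cases_point x
  · rfl
  · rw [reparam_middle, interp_one]
  · rfl

/-- A criterion for a retraction of a subspace of the double mapping cylinder to induce a
quasi-isomorphism. -/
lemma quasiIso_retraction {S : Set (doubleMappingCylinder f g)}
    (hS : ∀ x ∈ S, ∀ s, reparam φ h₀ h₁ x s ∈ S) {E : TopCat.{u}} (r : TopCat.of S ⟶ E)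
    (i : E ⟶ TopCat.of S) (hir : i ≫ r = 𝟙 E)
    (hri : ∀ x : S, ((i (r x) : S) : doubleMappingCylinder f g) = reparam φ h₀ h₁ x.1 0) :
    QuasiIso (natSingularChains.map r) := by
  refine quasiIso_natSingularChains_of_homotopyEquiv r i ?_
    (hir ▸ ContinuousMap.Homotopy.refl _)
  exact
    { toFun := fun z => (⟨reparam φ h₀ h₁ z.2.1 z.1, hS _ z.2.2 _⟩ : S)
      continuous_toFun := by
        refine Continuous.subtype_mk ?_ _
        fun_prop
      map_zero_left := fun x => Subtype.ext (hri x).symm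
      map_one_left := fun x => Subtype.ext (reparam_one φ h₀ h₁ x.1) }

end

end DoubleMappingCylinder

/-! ### The open cover of the double mapping cylinder and its retractions. -/

namespace DoubleMappingCylinder

open TopCat

variable {W U V : TopCat.{u}} (f : W ⟶ U) (g : W ⟶ V)

/-- The open part of the double mapping cylinder retracting onto the left end. -/
def leftPart : Set (doubleMappingCylinder f g) := {x | (height f g x : ℝ) < 2 / 3}

/-- The open part of the double mapping cylinder retracting onto the right end. -/
def rightPart : Set (doubleMappingCylinder f g) := {x | 1 / 3 < (height f g x : ℝ)}

lemma isOpen_leftPart : IsOpen (leftPart f g) :=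
  isOpen_lt (continuous_subtype_val.comp (height f g).continuous) continuous_const

lemma isOpen_rightPart : IsOpen (rightPart f g) :=
  isOpen_lt continuous_const (continuous_subtype_val.comp (height f g).continuous)

lemma left_mem_leftPart (u : U) : left f g u ∈ leftPart f g := by
  change ((0 : I) : ℝ) < 2 / 3
  norm_num

lemma right_mem_rightPart (v : V) : right f g v ∈ rightPart f g := by
  change 1 / 3 < ((1 : I) : ℝ)
  norm_num

lemma left_notMem_rightPart (u : U) : left f g u ∉ rightPart f g := by
  change ¬ 1 / 3 < ((0 : I) : ℝ)
  norm_num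

lemma right_notMem_leftPart (v : V) : right f g v ∉ leftPart f g := by
  change ¬ ((1 : I) : ℝ) < 2 / 3
  norm_num

/-- The collapse along the cylinder is first defined everywhere with values in `U ⊕ V`, to avoid
partial functions. It violates the relation at the right end, which does not occur over `leftPart`.
-/
lemma exists_left_retraction : ∃ r : C(leftPart f g, U),
    (∀ u hu, r ⟨left f g u, hu⟩ = u) ∧ ∀ w t hw, r ⟨middle f g (w, t), hw⟩ = f w := by
  obtain ⟨r, hr⟩ := exists_desc (isOpen_leftPart f g) (Topology.IsEmbedding.inl (X := U) (Y := V))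
    ⟨Sum.elim Sum.inl (Sum.elim (fun z => Sum.inl (f z.1)) Sum.inr), by fun_prop⟩
    (by
      rintro (u | ⟨w, t⟩ | v) h
      · exact ⟨u, rfl⟩
      · exact ⟨f w, rfl⟩
      · exact absurd h (right_notMem_leftPart f g v))
    (by
      rintro _ _ (w | w) h
      · rfl
      · exact absurd (middle_one (f := f) (g := g) w ▸ h) (right_notMem_leftPart f g _))
  exact ⟨r, fun u hu => Sum.inl_injective (hr (Sum.inl u) hu),
    fun w t hw => Sum.inl_injective (hr (Sum.inr (Sum.inl (w, t))) hw)⟩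

lemma exists_right_retraction : ∃ r : C(rightPart f g, V),
    (∀ v hv, r ⟨right f g v, hv⟩ = v) ∧ ∀ w t hw, r ⟨middle f g (w, t), hw⟩ = g w := by
  obtain ⟨r, hr⟩ := exists_desc (isOpen_rightPart f g) (Topology.IsEmbedding.inr (X := U) (Y := V))
    ⟨Sum.elim Sum.inl (Sum.elim (fun z => Sum.inr (g z.1)) Sum.inr), by fun_prop⟩
    (by
      rintro (u | ⟨w, t⟩ | v) h
      · exact absurd h (left_notMem_rightPart f g u)
      · exact ⟨g w, rfl⟩
      · exact ⟨v, rfl⟩)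
    (by
      rintro _ _ (w | w) h
      · exact absurd h (left_notMem_rightPart f g _)
      · rfl)
  exact ⟨r, fun v hv => Sum.inr_injective (hr (Sum.inr (Sum.inr v)) hv),
    fun w t hw => Sum.inr_injective (hr (Sum.inr (Sum.inl (w, t))) hw)⟩

lemma exists_middle_retraction : ∃ r : C((leftPart f g ∩ rightPart f g : Set _), W),
    ∀ w t hw, r ⟨middle f g (w, t), hw⟩ = w := by
  obtain ⟨r, hr⟩ := exists_desc ((isOpen_leftPart f g).inter (isOpen_rightPart f g))
    ((Topology.IsEmbedding.inr (X := U) (Y := W ⊕ V)).comp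
      (Topology.IsEmbedding.inl (X := W) (Y := V)))
    ⟨Sum.elim Sum.inl (Sum.elim (fun z => Sum.inr (Sum.inl z.1)) (Sum.inr ∘ Sum.inr)), by fun_prop⟩
    (by
      rintro (u | ⟨w, t⟩ | v) h
      · exact absurd h.2 (left_notMem_rightPart f g u)
      · exact ⟨w, rfl⟩
      · exact absurd h.1 (right_notMem_leftPart f g v))
    (by
      rintro _ _ (w | w) h
      · exact absurd h.2 (left_notMem_rightPart f g _)
      · exact absurd (middle_one (f := f) (g := g) w ▸ h.1) (right_notMem_leftPart f g _))
  exact ⟨r, fun w t hw => Sum.inl_injective (Sum.inr_injective (hr (Sum.inr (Sum.inl (w, t))) hw))⟩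

/-- A function on the interval contracting an initial segment. -/
def contractLeft : C(I, I) :=
  ⟨fun t => Set.projIcc 0 1 zero_le_one (3 * (t : ℝ) - 2),
    continuous_projIcc.comp (by fun_prop)⟩

/-- A function on the interval contracting a final segment. -/
def contractRight : C(I, I) :=
  ⟨fun t => Set.projIcc 0 1 zero_le_one (3 * (t : ℝ)), continuous_projIcc.comp (by fun_prop)⟩

/-- A function on the interval contracting a segment in the middle. -/
def contractMiddle : C(I, I) :=
  ⟨fun t => Set.projIcc 0 1 zero_le_one
    -- This is 3t/2 up to 1/3, constant 1/2 up to 2/3, and (3t - 1)/2 afterwards.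
    (max (min (3 * (t : ℝ) / 2) (1 / 2)) ((3 * (t : ℝ) - 1) / 2)),
    continuous_projIcc.comp (by fun_prop)⟩

/-- The midpoint of the unit interval. -/
def half : I := ⟨1 / 2, by norm_num, by norm_num⟩

lemma contractLeft_of_le {t : I} (h : (t : ℝ) ≤ 2 / 3) : contractLeft t = 0 :=
  Set.projIcc_of_le_left zero_le_one (by linarith)

lemma contractLeft_one : contractLeft 1 = 1 :=
  Set.projIcc_of_right_le zero_le_one (by norm_num)

lemma contractRight_of_le {t : I} (h : 1 / 3 ≤ (t : ℝ)) : contractRight t = 1 :=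
  Set.projIcc_of_right_le zero_le_one (by linarith)

lemma contractRight_zero : contractRight 0 = 0 :=
  Set.projIcc_of_le_left zero_le_one (by norm_num)

lemma contractMiddle_zero : contractMiddle 0 = 0 :=
  Set.projIcc_of_le_left zero_le_one (by norm_num)

lemma contractMiddle_one : contractMiddle 1 = 1 :=
  Set.projIcc_of_right_le zero_le_one (by norm_num)

lemma contractMiddle_of_le {t : I} (h₁ : 1 / 3 ≤ (t : ℝ)) (h₂ : (t : ℝ) ≤ 2 / 3) :
    contractMiddle t = half := by
  have : max (min (3 * (t : ℝ) / 2) (1 / 2)) ((3 * (t : ℝ) - 1) / 2) = 1 / 2 := by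
    rw [min_eq_right (by linarith), max_eq_left (by linarith)]
  change Set.projIcc 0 1 zero_le_one _ = _
  rw [this]
  exact Set.projIcc_of_mem zero_le_one half.2

lemma coe_interp (φ : C(I, I)) (t s : I) :
    (interp φ (t, s) : ℝ) = (1 - s) * φ t + s * t := rfl

variable {f g}

lemma quasiIso_left_retraction {r : C(leftPart f g, U)} (h₁ : ∀ u hu, r ⟨left f g u, hu⟩ = u)
    (h₂ : ∀ w t hw, r ⟨middle f g (w, t), hw⟩ = f w) :
    QuasiIso (natSingularChains.map (ofHom r : TopCat.of (leftPart f g) ⟶ U)) := by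
  refine quasiIso_retraction contractLeft (contractLeft_of_le (by norm_num)) contractLeft_one
    (fun x hx s => ?_) (ofHom r)
    (ofHom ⟨fun u => ⟨left f g u, left_mem_leftPart f g u⟩, by fun_prop⟩) ?_ ?_
  · have hx' : (height f g x : ℝ) < 2 / 3 := hx
    change (height f g _ : ℝ) < 2 / 3
    -- During the homotopy the height is scaled by `s`, so it stays below 2/3.
    rw [height_reparam, coe_interp, contractLeft_of_le hx'.le]
    have := mul_le_of_le_one_left (height f g x).2.1 s.2.2
    rw [show ((0 : I) : ℝ) = 0 from rfl, mul_zero, zero_add]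
    exact this.trans_lt hx'
  · ext u
    exact h₁ u _
  · rintro ⟨x, hx⟩
    obtain ⟨u, rfl⟩ | ⟨w, t, rfl⟩ | ⟨v, rfl⟩ := cases_point x
    · exact congrArg (left f g) (h₁ u _)
    · refine (congrArg (left f g) (h₂ w t _)).trans ?_
      rw [reparam_middle, interp_zero, contractLeft_of_le (show (t : ℝ) < 2 / 3 from hx).le,
        middle_zero]
    · exact absurd hx (right_notMem_leftPart f g v)

lemma quasiIso_right_retraction {r : C(rightPart f g, V)} (h₁ : ∀ v hv, r ⟨right f g v, hv⟩ = v)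
    (h₂ : ∀ w t hw, r ⟨middle f g (w, t), hw⟩ = g w) :
    QuasiIso (natSingularChains.map (ofHom r : TopCat.of (rightPart f g) ⟶ V)) := by
  refine quasiIso_retraction contractRight contractRight_zero (contractRight_of_le (by norm_num))
    (fun x hx s => ?_) (ofHom r)
    (ofHom ⟨fun v => ⟨right f g v, right_mem_rightPart f g v⟩, by fun_prop⟩) ?_ ?_
  · have hx' : 1 / 3 < (height f g x : ℝ) := hx
    change 1 / 3 < (height f g _ : ℝ)
    rw [height_reparam, coe_interp, contractRight_of_le hx'.le]
    have := mul_nonneg (sub_nonneg.2 s.2.2) (sub_nonneg.2 (height f g x).2.2)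
    rw [show ((1 : I) : ℝ) = 1 from rfl]
    nlinarith
  · ext v
    exact h₁ v _
  · rintro ⟨x, hx⟩
    obtain ⟨u, rfl⟩ | ⟨w, t, rfl⟩ | ⟨v, rfl⟩ := cases_point x
    · exact absurd hx (left_notMem_rightPart f g u)
    · refine (congrArg (right f g) (h₂ w t _)).trans ?_
      rw [reparam_middle, interp_zero, contractRight_of_le (show 1 / 3 < (t : ℝ) from hx).le,
        middle_one]
    · exact congrArg (right f g) (h₁ v _)

/-- The section is the slice at height 1/2. Heights move linearly between 1/2 and their original
value, hence remain in the convex interval (1/3, 2/3). -/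
lemma quasiIso_middle_retraction {r : C((leftPart f g ∩ rightPart f g : Set _), W)}
    (h : ∀ w t hw, r ⟨middle f g (w, t), hw⟩ = w) :
    QuasiIso (natSingularChains.map
      (ofHom r : TopCat.of (leftPart f g ∩ rightPart f g : Set _) ⟶ W)) := by
  have hhalf (w : W) : middle f g (w, half) ∈ leftPart f g ∩ rightPart f g := by
    constructor
    · change (1 / 2 : ℝ) < 2 / 3
      norm_num
    · change (1 / 3 : ℝ) < 1 / 2
      norm_num
  refine quasiIso_retraction contractMiddle contractMiddle_zero contractMiddle_one
    (fun x hx s => ?_) (ofHom r)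
    (ofHom ⟨fun w => ⟨middle f g (w, half), hhalf w⟩, by fun_prop⟩) ?_ ?_
  · have hx₁ : (height f g x : ℝ) < 2 / 3 := hx.1
    have hx₂ : 1 / 3 < (height f g x : ℝ) := hx.2
    have h₁ := s.2.1
    have h₂ := s.2.2
    have e : (height f g (reparam contractMiddle contractMiddle_zero contractMiddle_one x s) : ℝ) =
        (1 - s) * (1 / 2) + s * height f g x := by
      rw [height_reparam, coe_interp, contractMiddle_of_le hx₂.le hx₁.le]
      rfl
    constructor
    · change (height f g _ : ℝ) < 2 / 3
      rw [e]
      nlinarith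
    · change 1 / 3 < (height f g _ : ℝ)
      rw [e]
      nlinarith
  · ext w
    exact h w _ _
  · rintro ⟨x, hx⟩
    obtain ⟨u, rfl⟩ | ⟨w, t, rfl⟩ | ⟨v, rfl⟩ := cases_point x
    · exact absurd hx.2 (left_notMem_rightPart f g u)
    · refine (congrArg (fun w => middle f g (w, half)) (h w t _)).trans ?_
      rw [reparam_middle, interp_zero, contractMiddle_of_le (show 1 / 3 < (t : ℝ) from hx.2).le
        (show (t : ℝ) < 2 / 3 from hx.1).le]
    · exact absurd hx.1 (right_notMem_leftPart f g v)

end DoubleMappingCylinder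

/-! ### Assembling the comparison of squares. -/

open DoubleMappingCylinder TopCat HomologicalComplex in
/-- Singular chains send homotopy pushout squares to homotopy pullback squares. -/
theorem IsHomotopyPushout.isHomotopyPullback_singularChains {W U V X : TopCat.{u}} {f : W ⟶ U}
    {g : W ⟶ V} {p : U ⟶ X} {q : V ⟶ X} (h : IsHomotopyPushout f g p q) :
    IsHomotopyPullback (singularChains.map f) (singularChains.map g)
      (singularChains.map p) (singularChains.map q) := by
  let e := embeddingNatIntDown
  let M := doubleMappingCylinder f g
  let S : Set M := leftPart f g
  let T : Set M := rightPart f g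
  have hS : S ∩ T ⊆ S := Set.inter_subset_left
  have hT : S ∩ T ⊆ T := Set.inter_subset_right
  let c : M ⟶ X := doubleMappingCylinderCollapse f g ≫ pushout.desc p q h.comm
  have hcl (u : U) : c (left f g u) = p u :=
    ConcreteCategory.congr_hom (pushout.inl_desc p q h.comm) u
  have hcr (v : V) : c (right f g v) = q v :=
    ConcreteCategory.congr_hom (pushout.inr_desc p q h.comm) v
  -- Independence of `t` is what makes the comparison squares commute strictly and not just up to
  -- homotopy.
  have hcm (w : W) (t : I) : c (middle f g (w, t)) = p (f w) :=
    ConcreteCategory.congr_hom (pushout.inl_desc p q h.comm) (f w)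
  have hpq (w : W) : p (f w) = q (g w) := ConcreteCategory.congr_hom h.comm w
  obtain ⟨rU, hU₁, hU₂⟩ := exists_left_retraction f g
  obtain ⟨rV, hV₁, hV₂⟩ := exists_right_retraction f g
  obtain ⟨rW, hW⟩ := exists_middle_retraction f g
  have hf : inclLE hS ≫ ofHom rU = ofHom rW ≫ f := by
    ext ⟨x, hx⟩
    obtain ⟨u, rfl⟩ | ⟨w, t, rfl⟩ | ⟨v, rfl⟩ := cases_point x
    · exact absurd hx.2 (left_notMem_rightPart f g u)
    · exact (hU₂ w t hx.1).trans (congrArg f (hW w t hx)).symm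
    · exact absurd hx.1 (right_notMem_leftPart f g v)
  have hg : inclLE hT ≫ ofHom rV = ofHom rW ≫ g := by
    ext ⟨x, hx⟩
    obtain ⟨u, rfl⟩ | ⟨w, t, rfl⟩ | ⟨v, rfl⟩ := cases_point x
    · exact absurd hx.2 (left_notMem_rightPart f g u)
    · exact (hV₂ w t hx.2).trans (congrArg g (hW w t hx)).symm
    · exact absurd hx.1 (right_notMem_leftPart f g v)
  have hp : incl S ≫ c = ofHom rU ≫ p := by
    ext ⟨x, hx⟩
    obtain ⟨u, rfl⟩ | ⟨w, t, rfl⟩ | ⟨v, rfl⟩ := cases_point x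
    · exact (hcl u).trans (congrArg p (hU₁ u hx)).symm
    · exact (hcm w t).trans (congrArg p (hU₂ w t hx)).symm
    · exact absurd hx (right_notMem_leftPart f g v)
  have hq : incl T ≫ c = ofHom rV ≫ q := by
    ext ⟨x, hx⟩
    obtain ⟨u, rfl⟩ | ⟨w, t, rfl⟩ | ⟨v, rfl⟩ := cases_point x
    · exact absurd hx (left_notMem_rightPart f g u)
    · exact (hcm w t).trans ((hpq w).trans (congrArg q (hV₂ w t hx)).symm)
    · exact (hcr v).trans (congrArg q (hV₁ v hx)).symm
  have hO (b : Bool) : IsOpen (pairFamily S T b) := by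
    cases b
    · exact isOpen_rightPart f g
    · exact isOpen_leftPart f g
  have hO' : ⋃ b, pairFamily S T b = Set.univ := by
    refine Set.eq_univ_of_forall fun x => Set.mem_iUnion.2 ?_
    by_cases hx : (height f g x : ℝ) < 2 / 3
    · exact ⟨true, hx⟩
    · refine ⟨false, ?_⟩
      change 1 / 3 < (height f g x : ℝ)
      linarith
  have ex := elementwiseExact_small S T
  have comm : singMap (inclLE hS) ≫
      toSmall (O := pairFamily S T) true =
      singMap (inclLE hT) ≫
        toSmall (O := pairFamily S T) false := by
    rw [← cancel_mono (smallι (pairFamily S T)), Category.assoc, Category.assoc]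
    exact (natSingularChains.map_comp (inclLE hS) (incl S)).symm.trans
      (natSingularChains.map_comp (inclLE hT) (incl T))
  have sq : CommSq (HomologicalComplex.extendMap (singMap (inclLE hS)) e)
      (HomologicalComplex.extendMap (singMap (inclLE hT)) e)
      (HomologicalComplex.extendMap (toSmall (O := pairFamily S T) true) e)
      (HomologicalComplex.extendMap (toSmall (O := pairFamily S T) false) e) :=
    ⟨by rw [← extendMap_comp, ← extendMap_comp, comm]⟩
  have hqi {A B : ChainComplex AddCommGrpCat.{u} ℕ} (φ : A ⟶ B) (hφ : QuasiIso φ) :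
      QuasiIso (HomologicalComplex.extendMap φ e) := (quasiIso_extendMap_iff φ e).2 hφ
  have hι : QuasiIso (smallι (pairFamily S T)) := quasiIso_smallι _ hO hO'
  have hc : QuasiIso (singMap c) := h.isWeakHomotopyEquiv.quasiIso_natSingularChains
  refine Ch.isHomotopyPullback_of_shortExact ?_ sq (ex.extendMap e |>.shortExact sq)
    (singularChains.map (ofHom rW)) (singularChains.map (ofHom rU)) (singularChains.map (ofHom rV))
    -- At the fourth corner small chains of the cylinder are compared with `X` in two steps, the
    -- small chain theorem and the weak equivalence `c`.
    (HomologicalComplex.extendMap (smallι (pairFamily S T) ≫ singMap c) e) ?_ ?_ ?_ ?_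
    (hqi _ (quasiIso_middle_retraction hW)) (hqi _ (quasiIso_left_retraction hU₁ hU₂))
    (hqi _ (quasiIso_right_retraction hV₁ hV₂)) (hqi _ inferInstance)
  · rw [← Functor.map_comp, h.comm, Functor.map_comp]
  · exact (singularChains.map_comp _ _).symm.trans
      ((congrArg singularChains.map hf).trans (singularChains.map_comp _ _))
  · exact (singularChains.map_comp _ _).symm.trans
      ((congrArg singularChains.map hg).trans (singularChains.map_comp _ _))
  · refine (extendMap_comp _ _ _).symm.trans ?_
    rw [← Category.assoc, toSmall_smallι]
    exact (congrArg (extendMap · e) (natSingularChains.map_comp (incl S) c).symm).trans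
      ((congrArg singularChains.map hp).trans (singularChains.map_comp _ _))
  · refine (extendMap_comp _ _ _).symm.trans ?_
    rw [← Category.assoc, toSmall_smallι]
    exact (congrArg (extendMap · e) (natSingularChains.map_comp (incl T) c).symm).trans
      ((congrArg singularChains.map hq).trans (singularChains.map_comp _ _))

end

theorem mainTheorem3 {W U V X : TopCat.{u}} (f : W ⟶ U) (g : W ⟶ V) (p : U ⟶ X) (q : V ⟶ X)
    (h : IsHomotopyPushout f g p q) :
    IsHomotopyPullback (singularChains.map f) (singularChains.map g)
      (singularChains.map p) (singularChains.map q) := by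
  exact h.isHomotopyPullback_singularChains
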